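/- Let $\mathcal H$ be a complex Hilbert space, $\mathcal H_1\subseteq\mathcal H$ a closed subspace and $\mathcal H_2=\mathcal H_1^\perp$, so that $\mathcal H=\mathcal H_1\oplus\mathcal H_2$. Let $\mathcal F_{\mathcal K}=\mathbb C\oplus\mathcal K\oplus(\mathcal K\wedge\mathcal K)\oplus\cdots$ denote the fermion Fock space over a Hilbert space $\mathcal K$, with vacuum vector $\Omega$, creators $a_g^\dagger$ and annihilators $a_g=(a_g^\dagger)^*$, and let $N=\sum_j a_{f_j}^\dagger a_{f_j}$ ($\{f_j\}$ an orthonormal basis of $\mathcal H$) and $N_1=\sum_j a_{e_j}^\dagger a_{e_j}$ ($\{e_j\}$ an orthonormal basis of $\mathcal H_1$) be the number operators on $\mathcal F_{\mathcal H}$ of $\mathcal H$ and of $\mathcal H_1$. For a density operator $D$ on $\mathcal F_{\mathcal K}$ that commutes with the number operator of $\mathcal K$ and has finite mean particle number, let $\gamma_D$ be the operator on $\mathcal K$ with $\langle h|\gamma_D g\rangle=\mathrm{Tr}(D\,a_g^\dagger a_h)$ for all $g,h\in\mathcal K$. Let $\{f_j\}$ be an (ordered) orthonormal basis of $\mathcal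 K$ with $\gamma_D f_j=p_jf_j$, and let $$\Gamma_{\gamma_D}=\sum_{\mathbf s}\Big(\prod_{i\in\mathbf s}p_i\prod_{j\notin\mathbf s}(1-p_j)\Big)\,|a_{\mathbf s}^\dagger\Omega\rangle\langle a_{\mathbf s}^\dagger\Omega| ,$$ where $\mathbf s$ runs over the finite sets of indices and $a^\dagger_{\mathbf s}$ is the ordered product of the $a_{f_i}^\dagger$, $i\in\mathbf s$; this is the density operator of the free state with the same $1$-particle statistical operator as $D$. The nonfreeness of $D$ is the relative entropy $\mathfrak C(D)=S(D\,|\,\Gamma_{\gamma_D})=\mathrm{Tr}\big(D(\log D-\log\Gamma_{\gamma_D})\big)\in[0,\infty]$. Here, for density operators $D,G$ with $\ker G\subseteq\ker D$, the relative entropy is given by $$S(D|G)=\sum_{j,k}|\langle\phi_j,\psi_k\rangle|^2\,(d_j\log d_j-d_j\log g_k+g_k-d_j),$$ where $\{\phi_j\}$, $\{\psi_k\}$ are orthonormal bases of eigenvectors of $D$, $G$ with eigenvalues $d_j$, $g_k$ (with $0\log 0=0$, and terms with $\langle\phi_j,\psi_k\rangle=0$ or $d_j=g_k=0$ counted as $0$),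 and $S(D|G)=\infty$ if $\ker G\not\subseteq\ker D$. Let $\Delta$ be a density operator on $\mathcal F_{\mathcal H}$ with $\Delta N=N\Delta$ and $\mathrm{Tr}(\Delta N)<\infty$. Let $\Delta_1=\mathrm{Tr}_{\mathcal F_{\mathcal H_2}}\Delta$ and $\Delta_2=\mathrm{Tr}_{\mathcal F_{\mathcal H_1}}\Delta$ be its restrictions over $\mathcal H_1$ and $\mathcal H_2$, i.e. its partial traces with respect to the identification of $\mathcal F_{\mathcal H_1}\otimes\mathcal F_{\mathcal H_2}$ with $\mathcal F_{\mathcal H}$ given by $(v_1\wedge\dots\wedge v_k)\otimes(w_1\wedge\dots\wedge w_l)\leftrightarrow v_1\wedge\dots\wedge v_k\wedge w_1\wedge\dots\wedge w_l$. If $N_1\Delta=\Delta N_1=n\Delta$ for some integer $n$, then $$\mathfrak C(\Delta)\ \ge\ \mathfrak C(\Delta_1)+\mathfrak C(\Delta_2).$$ -/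

import Mathlib

open scoped InnerProductSpace ENNReal

namespace Fermion

section Kernel

open scoped ComplexOrder

variable {H : Type*} [NormedAddCommGroup H] [InnerProductSpace ℂ H]

theorem posSemidef_gram_any {X : Type*} {E : Type*} [NormedAddCommGroup E]
    [InnerProductSpace ℂ E] (u : X → E) : (Matrix.of fun x y => ⟪u x, u y⟫_ℂ).PosSemidef := by
  refine ⟨by ext x y; simp, fun f => ?_⟩
  have h : (f.sum fun x fx => f.sum fun y fy =>
      star fx * (Matrix.of fun x y => ⟪u x, u y⟫_ℂ) x y * fy)
      = ⟪f.sum fun x fx => fx • u x, f.sum fun x fx => fx • u x⟫_ℂ := by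
    simp only [Finsupp.sum, sum_inner, inner_sum, inner_smul_left, inner_smul_right]
    simp only [Finset.mul_sum]
    rw [Finset.sum_comm]
    refine Finset.sum_congr rfl fun x _ => Finset.sum_congr rfl fun y _ => ?_
    simp only [Matrix.of_apply, RCLike.star_def]
    ring
  rw [h, inner_self_eq_norm_sq_to_K, ← RCLike.ofReal_pow]
  have h0 : (0 : ℝ) ≤ ‖f.sum fun x fx => fx • u x‖ ^ 2 := sq_nonneg _
  exact Complex.zero_le_real.2 h0

theorem posSemidef_prod_gram {X : Type*} {n : ℕ} (u : Fin n → X → H) (s : Finset (Fin n)) :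
    (Matrix.of fun x y => ∏ i ∈ s, ⟪u i x, u i y⟫_ℂ).PosSemidef := by
  classical
  induction s using Finset.induction_on with
  | empty =>
    have h := posSemidef_gram_any (fun _ : X => (1 : ℂ))
    simpa using h
  | insert a s ha ih =>
    have h := (posSemidef_gram_any (u a)).hadamard ih
    have e : (Matrix.of fun x y => ∏ i ∈ insert a s, ⟪u i x, u i y⟫_ℂ) =
        (Matrix.of fun x y => ⟪u a x, u a y⟫_ℂ).hadamard
          (Matrix.of fun x y => ∏ i ∈ s, ⟪u i x, u i y⟫_ℂ) := by
      ext x y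
      simp [Finset.prod_insert ha]
    rw [e]
    exact h

theorem posSemidef_det_inner (n : ℕ) :
    (Matrix.of fun v w : Fin n → H =>
      (Matrix.of fun i j => ⟪v i, w j⟫_ℂ).det).PosSemidef := by
  classical
  refine ⟨?_, fun f => ?_⟩
  · ext v w
    simp only [Matrix.conjTranspose_apply, Matrix.of_apply]
    rw [← Matrix.det_conjTranspose]
    congr 1
    ext i j
    simp
  · let g : (Fin n → H) × Equiv.Perm (Fin n) →₀ ℂ :=
      Finsupp.onFinset (f.support ×ˢ Finset.univ)
        (fun x => ((Equiv.Perm.sign x.2 : ℤ) : ℂ) * f x.1) (by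
          intro x hx
          simp only [Finset.mem_product, Finset.mem_univ, and_true, Finsupp.mem_support_iff]
          exact right_ne_zero_of_mul hx)
    have h := (posSemidef_prod_gram (H := H) (n := n)
      (X := (Fin n → H) × Equiv.Perm (Fin n)) (fun i x => x.1 (x.2 i)) Finset.univ).2 g
    have hd : ∀ v w : Fin n → H, ∑ τ : Equiv.Perm (Fin n), ∑ σ : Equiv.Perm (Fin n),
        ((Equiv.Perm.sign σ : ℤ) : ℂ) * ((Equiv.Perm.sign τ : ℤ) : ℂ) *
          ∏ i, ⟪v (σ i), w (τ i)⟫_ℂ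
        = (n.factorial : ℂ) * (Matrix.of fun i j => ⟪v i, w j⟫_ℂ).det := by
      intro v w
      have : ∀ τ : Equiv.Perm (Fin n), ∑ σ : Equiv.Perm (Fin n),
          ((Equiv.Perm.sign σ : ℤ) : ℂ) * ((Equiv.Perm.sign τ : ℤ) : ℂ) *
          ∏ i, ⟪v (σ i), w (τ i)⟫_ℂ = (Matrix.of fun i j => ⟪v i, w j⟫_ℂ).det := by
        intro τ
        have h1 := Matrix.det_permute' τ (Matrix.of fun i j => ⟪v i, w j⟫_ℂ)
        have h2 : ((Equiv.Perm.sign τ : ℤ) : ℂ) * ((Equiv.Perm.sign τ : ℤ) : ℂ) = 1 := by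
          rw [← Int.cast_mul, ← Units.val_mul, Int.units_mul_self]; simp
        rw [← one_mul (Matrix.det _), ← h2, mul_assoc, ← h1, Matrix.det_apply', Finset.mul_sum]
        refine Finset.sum_congr rfl fun σ _ => ?_
        simp only [Matrix.submatrix_apply, Matrix.of_apply, id]
        ring
      rw [Finset.sum_congr rfl fun τ _ => this τ]
      simp [Fintype.card_perm]
    have key : (g.sum fun x gx => g.sum fun y gy => star gx *
        (Matrix.of fun x y : (Fin n → H) × Equiv.Perm (Fin n) =>
          ∏ i, ⟪x.1 (x.2 i), y.1 (y.2 i)⟫_ℂ) x y * gy)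
        = (n.factorial : ℂ) * f.sum fun v fv => f.sum fun w fw => star fv *
          (Matrix.of fun v w : Fin n → H =>
            (Matrix.of fun i j => ⟪v i, w j⟫_ℂ).det) v w * fw := by
      simp only [g]
      rw [Finsupp.onFinset_sum _ (by simp)]
      simp only [Finsupp.sum, Finset.mul_sum]
      rw [Finset.sum_product]
      refine Finset.sum_congr rfl fun v _ => ?_
      have : ∀ σ : Equiv.Perm (Fin n), (Finsupp.onFinset (f.support ×ˢ Finset.univ)
          (fun x : (Fin n → H) × Equiv.Perm (Fin n) =>
            ((Equiv.Perm.sign x.2 : ℤ) : ℂ) * f x.1) (by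
          intro x hx
          simp only [Finset.mem_product, Finset.mem_univ, and_true, Finsupp.mem_support_iff]
          exact right_ne_zero_of_mul hx)).sum (fun y gy =>
            star (((Equiv.Perm.sign σ : ℤ) : ℂ) * f v) *
            (Matrix.of fun x y : (Fin n → H) × Equiv.Perm (Fin n) =>
              ∏ i, ⟪x.1 (x.2 i), y.1 (y.2 i)⟫_ℂ) (v, σ) y * gy)
          = ∑ w ∈ f.support, ∑ τ : Equiv.Perm (Fin n), star (f v) * f w *
            (((Equiv.Perm.sign σ : ℤ) : ℂ) * ((Equiv.Perm.sign τ : ℤ) : ℂ) *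
              ∏ i, ⟪v (σ i), w (τ i)⟫_ℂ) := by
        intro σ
        rw [Finsupp.onFinset_sum _ (by simp), Finset.sum_product]
        refine Finset.sum_congr rfl fun w _ => Finset.sum_congr rfl fun τ _ => ?_
        simp only [Matrix.of_apply, star_mul', star_intCast]
        ring
      refine (Finset.sum_congr rfl fun σ _ => this σ).trans ?_
      rw [Finset.sum_comm]
      refine Finset.sum_congr rfl fun w _ => ?_
      rw [Finset.sum_comm]
      simp only [← Finset.mul_sum]
      rw [hd]
      simp only [Matrix.of_apply]
      ring
    have h' : (0 : ℂ) ≤ (n.factorial : ℂ) * f.sum fun v fv => f.sum fun w fw => star fv *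
          (Matrix.of fun v w : Fin n → H =>
            (Matrix.of fun i j => ⟪v i, w j⟫_ℂ).det) v w * fw := by
      rw [← key]; exact h
    have hn : (0 : ℂ) < (n.factorial : ℂ) := by exact_mod_cast n.factorial_pos
    exact le_of_mul_le_mul_left (by simpa using h') hn


/-- Finite sequences of vectors: `⟨n, v⟩` stands for the wedge product `v 0 ∧ ⋯ ∧ v (n - 1)`. -/
abbrev Tuple (H : Type*) := Σ n : ℕ, Fin n → H

/-- The inner product of two wedge products:
`⟪v₁ ∧ ⋯ ∧ vₙ, w₁ ∧ ⋯ ∧ wₘ⟫` is `det ⟪vᵢ, wⱼ⟫` if `n = m`, and `0` otherwise. -/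
noncomputable def gramKernel (x y : Tuple H) : ℂ :=
  if h : x.1 = y.1 then (Matrix.of fun i j => ⟪x.2 i, y.2 (Fin.cast h j)⟫_ℂ).det else 0

/-- `gramKernel` as an operator-valued kernel. -/
noncomputable def kernelMatrix (H : Type*) [NormedAddCommGroup H] [InnerProductSpace ℂ H] :
    Matrix (Tuple H) (Tuple H) (ℂ →L[ℂ] ℂ) :=
  Matrix.of fun x y => gramKernel x y • ContinuousLinearMap.id ℂ ℂ


theorem gramKernel_of_eq {n m : ℕ} (h : n = m) (v : Fin n → H) (w : Fin m → H) :
    gramKernel ⟨n, v⟩ ⟨m, w⟩ = (Matrix.of fun i j => ⟪v i, w (Fin.cast h j)⟫_ℂ).det := by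
  subst h
  simp [gramKernel]

theorem gramKernel_self {n : ℕ} (v w : Fin n → H) :
    gramKernel ⟨n, v⟩ ⟨n, w⟩ = (Matrix.of fun i j => ⟪v i, w j⟫_ℂ).det :=
  gramKernel_of_eq rfl v w

theorem gramKernel_of_ne {n m : ℕ} (h : n ≠ m) (v : Fin n → H) (w : Fin m → H) :
    gramKernel ⟨n, v⟩ ⟨m, w⟩ = 0 := by
  simp [gramKernel, h]

theorem posSemidef_gramKernel : (Matrix.of fun x y : Tuple H => gramKernel x y).PosSemidef := by
  classical
  refine ⟨?_, fun f => ?_⟩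
  · ext ⟨n, v⟩ ⟨m, w⟩
    simp only [Matrix.conjTranspose_apply, Matrix.of_apply]
    by_cases h : n = m
    · subst h
      simp only [gramKernel, dite_true, Fin.cast_refl, id]
      rw [← Matrix.det_conjTranspose]
      congr 1
      ext i j
      simp
    · simp [gramKernel, h, Ne.symm h]
  · rw [Finsupp.sigma_sum]
    refine Finset.sum_nonneg fun n _ => ?_
    have h := (posSemidef_det_inner (H := H) n).2 (f.split n)
    have e : ((f.split n).sum fun v a => f.sum fun y b =>
          star a * (Matrix.of fun x y : Tuple H => gramKernel x y) ⟨n, v⟩ y * b)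
        = (f.split n).sum fun v a => (f.split n).sum fun w b => star a *
          (Matrix.of fun v w : Fin n → H =>
            (Matrix.of fun i j => ⟪v i, w j⟫_ℂ).det) v w * b := by
      refine Finset.sum_congr rfl fun v _ => ?_
      dsimp only
      rw [Finsupp.sigma_sum]
      by_cases hn : n ∈ f.splitSupport
      · rw [Finset.sum_eq_single n]
        · refine Finset.sum_congr rfl fun w _ => ?_
          simp [gramKernel]
        · intro m _ hm
          refine Finset.sum_eq_zero fun w _ => ?_
          simp [gramKernel, Ne.symm hm]
        · exact fun h => absurd hn h
      · contradiction
    rw [e]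
    exact h

instance instFactKernel : Fact (kernelMatrix H).PosSemidef := ⟨by
  have t := (RKHS.posSemidef_tfae (K := kernelMatrix H)).out 0 2
  refine t.2 ⟨?_, fun f => ?_⟩
  · ext x y
    have h := congrFun (congrFun (posSemidef_gramKernel (H := H)).1 x) y
    simp only [Matrix.conjTranspose_apply, Matrix.of_apply] at h
    rw [Matrix.conjTranspose_apply]
    simp only [kernelMatrix, Matrix.of_apply]
    rw [star_smul, h]
    rw [show star (ContinuousLinearMap.id ℂ ℂ) = ContinuousLinearMap.id ℂ ℂ from
      star_one (ℂ →L[ℂ] ℂ)]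
  · have h := (posSemidef_gramKernel (H := H)).2 f
    have h2 := (Complex.le_def.1 h).1
    have hs : ∀ x y : Tuple H, (starRingEnd ℂ) (gramKernel x y) = gramKernel y x := fun x y =>
      congrFun (congrFun (posSemidef_gramKernel (H := H)).1 y) x
    simpa [kernelMatrix, hs, mul_assoc, mul_comm, mul_left_comm] using h2⟩

/-- The fermion Fock space `ℂ ⊕ H ⊕ (H ∧ H) ⊕ ⋯`: the Hilbert space generated by the wedge products
of finite sequences of vectors of `H`, with the inner product `gramKernel`. Its elements are the
antisymmetric wave functions `ψ ⟨n, v⟩ = ⟪v 0 ∧ ⋯ ∧ v (n - 1), ψ⟫`. -/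
def Fock (H : Type*) [NormedAddCommGroup H] [InnerProductSpace ℂ H] : Type _ :=
  RKHS.OfKernel (kernelMatrix H)

noncomputable instance instNACGFock : NormedAddCommGroup (Fock H) :=
  inferInstanceAs (NormedAddCommGroup (RKHS.OfKernel (kernelMatrix H)))

noncomputable instance instIPSFock : InnerProductSpace ℂ (Fock H) :=
  inferInstanceAs (InnerProductSpace ℂ (RKHS.OfKernel (kernelMatrix H)))

instance instCompleteFock : CompleteSpace (Fock H) :=
  inferInstanceAs (CompleteSpace (RKHS.OfKernel (kernelMatrix H)))

noncomputable instance instRKHSFock : RKHS ℂ (Fock H) (Tuple H) ℂ :=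
  inferInstanceAs (RKHS ℂ (RKHS.OfKernel (kernelMatrix H)) (Tuple H) ℂ)

end Kernel

section Fock

variable {H : Type*} [NormedAddCommGroup H] [InnerProductSpace ℂ H]

theorem kernel_fock : RKHS.kernel (Fock H) = kernelMatrix H :=
  RKHS.OfKernel.kernel_ofKernel

/-- The vector `v 0 ∧ ⋯ ∧ v (n - 1)` of Fock space; for `n = 0` this is the vacuum vector. -/
noncomputable def wedge (x : Tuple H) : Fock H := RKHS.kerFun (Fock H) x 1

theorem inner_wedge_wedge (x y : Tuple H) : ⟪wedge x, wedge y⟫_ℂ = gramKernel x y := by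
  have h := RKHS.kernel_inner (Fock H) y x (1 : ℂ) (1 : ℂ)
  rw [wedge, wedge, ← h, kernel_fock]
  have h := congrFun (congrFun (posSemidef_gramKernel (H := H)).1 x) y
  simp only [Matrix.conjTranspose_apply, Matrix.of_apply] at h
  simp [kernelMatrix, ← h]


/-- Finite linear combinations of wedge products. -/
noncomputable def wedgeComb : (Tuple H →₀ ℂ) →ₗ[ℂ] Fock H := Finsupp.linearCombination ℂ wedge

/-- Wedge products span a dense subspace of Fock space. -/
theorem denseRange_wedgeComb : DenseRange (wedgeComb (H := H)) := by
  have h := RKHS.kerFun_dense (H := Fock H)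
  rw [← Submodule.dense_iff_topologicalClosure_eq_top] at h
  refine h.mono ?_
  have : Submodule.span ℂ {x : Fock H | ∃ t v, RKHS.kerFun (Fock H) t v = x}
      ≤ LinearMap.range (wedgeComb (H := H)) := by
    rw [Submodule.span_le]
    rintro _ ⟨t, v, rfl⟩
    refine ⟨Finsupp.single t v, ?_⟩
    rw [wedgeComb, Finsupp.linearCombination_single, wedge, ← map_smul]
    simp
  exact this

variable {K : Type*} [NormedAddCommGroup K] [InnerProductSpace ℂ K]

/-- The bounded operator with `wedge x ↦ wedge (φ x)`, for a map `φ` for which there is one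
(see `tupleMap_wedge`). -/
noncomputable def tupleMap (φ : Tuple H → Tuple K) : Fock H →L[ℂ] Fock K :=
  (Finsupp.linearCombination ℂ fun x => wedge (φ x)).extendOfNorm wedgeComb

theorem tupleMap_wedge {φ : Tuple H → Tuple K} (C : ℝ)
    (h : ∀ f : Tuple H →₀ ℂ,
      ‖Finsupp.linearCombination ℂ (fun x => wedge (φ x)) f‖ ≤ C * ‖wedgeComb f‖)
    (x : Tuple H) : tupleMap φ (wedge x) = wedge (φ x) := by
  have := LinearMap.extendOfNorm_eq denseRange_wedgeComb ⟨C, h⟩ (Finsupp.single x 1)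
  simpa [tupleMap, wedgeComb] using this

/-- `(v₁, …, vₙ) ↦ (h, v₁, …, vₙ)`. -/
def Tuple.cons (h : H) (x : Tuple H) : Tuple H := ⟨x.1 + 1, Fin.cons h x.2⟩

/-- The creator `a†_h`: the bounded operator `v₁ ∧ ⋯ ∧ vₙ ↦ h ∧ v₁ ∧ ⋯ ∧ vₙ`
(see `creator_wedge`). -/
noncomputable def creator (h : H) : Fock H →L[ℂ] Fock H := tupleMap (Tuple.cons h)

/-- The annihilator `a_h`, the adjoint of the creator `a†_h`. -/
noncomputable def annihilator (h : H) : Fock H →L[ℂ] Fock H := (creator h).adjoint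

/-- Concatenation of a sequence in `H₁` and a sequence in `H₂`, as a sequence in `H`. -/
def Tuple.append {H₁ H₂ : Submodule ℂ H} (x : Tuple H₁) (y : Tuple H₂) : Tuple H :=
  ⟨x.1 + y.1, Fin.append (fun i => (x.2 i : H)) (fun j => (y.2 j : H))⟩

/-- The bounded bilinear map `(ξ, η) ↦ ξ ∧ η`, which identifies `ξ ⊗ η` in the tensor product of
`Fock H₁` and `Fock H₂` with a vector of `Fock H` when `H` is the orthogonal sum of `H₁` and `H₂`
(see `wedgeProd_wedge`). Under it `a†_g` is `a†_g ⊗ 1` for `g` in `H₁`. -/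
noncomputable def wedgeProd (H₁ H₂ : Submodule ℂ H) : Fock H₁ →L[ℂ] Fock H₂ →L[ℂ] Fock H :=
  LinearMap.extendOfNorm (σ₁₂ := RingHom.id ℂ) (F := Fock H₂ →L[ℂ] Fock H)
    (Finsupp.linearCombination ℂ fun x : Tuple H₁ => tupleMap (Tuple.append (H₂ := H₂) x))
    wedgeComb

/-- Removes from each vector its component along `h`. -/
noncomputable def Tuple.proj (h : H) (x : Tuple H) : Tuple H :=
  ⟨x.1, fun i => x.2 i - (⟪h, x.2 i⟫_ℂ / ‖h‖ ^ 2) • h⟩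

theorem gramKernel_proj_proj (h : H) (x y : Tuple H) :
    gramKernel (x.proj h) (y.proj h) = gramKernel (x.proj h) y := by
  obtain ⟨n, v⟩ := x
  obtain ⟨m, w⟩ := y
  by_cases hnm : n = m
  · subst hnm
    change gramKernel ⟨n, _⟩ ⟨n, _⟩ = gramKernel ⟨n, _⟩ ⟨n, _⟩
    rw [gramKernel_self, gramKernel_self]
    congr 1
    ext i j
    simp only [Matrix.of_apply]
    rw [inner_sub_right, inner_smul_right]
    have e : ⟪h, h⟫_ℂ = (‖h‖ : ℂ) ^ 2 := inner_self_eq_norm_sq_to_K h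
    have : ⟪v i - (⟪h, v i⟫_ℂ / ‖h‖ ^ 2) • h, h⟫_ℂ = 0 := by
      by_cases hh : h = 0
      · simp [hh]
      · have hh' : (‖h‖ : ℂ) ≠ 0 := by simpa using hh
        rw [inner_sub_left, inner_smul_left, e, map_div₀, inner_conj_symm, map_pow,
          Complex.conj_ofReal]
        field_simp
        simp
    rw [this, mul_zero, sub_zero]
  · exact (gramKernel_of_ne hnm _ _).trans (gramKernel_of_ne hnm _ _).symm

theorem gramKernel_cons (h : H) (x y : Tuple H) :
    gramKernel (x.cons h) (y.cons h) = ‖h‖ ^ 2 * gramKernel (x.proj h) y := by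
  obtain ⟨n, v⟩ := x
  obtain ⟨m, w⟩ := y
  by_cases hnm : n = m
  · subst hnm
    change gramKernel ⟨n + 1, Fin.cons h v⟩ ⟨n + 1, Fin.cons h w⟩ = _ * gramKernel ⟨n, _⟩ ⟨n, _⟩
    by_cases hh : h = 0
    · subst hh
      rw [gramKernel_self, Matrix.det_eq_zero_of_row_eq_zero 0]
      · simp
      · intro j
        simp only [Matrix.of_apply, Fin.cons_zero, inner_zero_left]
    have hh' : (‖h‖ : ℂ) ^ 2 ≠ 0 := by simpa using hh
    rw [gramKernel_self, gramKernel_self]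
    let B : Matrix (Fin (n + 1)) (Fin (n + 1)) ℂ := Matrix.of
      (Fin.cons (fun j => ⟪h, (Fin.cons h w : Fin (n + 1) → H) j⟫_ℂ) fun i j =>
        ⟪v i - (⟪h, v i⟫_ℂ / ‖h‖ ^ 2) • h, (Fin.cons h w : Fin (n + 1) → H) j⟫_ℂ)
    rw [Matrix.det_eq_of_forall_row_eq_smul_add_const (B := B)
      (Fin.cons 0 fun i => (starRingEnd ℂ) (⟪h, v i⟫_ℂ / ‖h‖ ^ 2)) 0 (by simp)]
    · rw [Matrix.det_succ_column_zero, Fin.sum_univ_succ, Finset.sum_eq_zero]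
      · simp only [add_zero, B]
        have : ⟪h, h⟫_ℂ = (‖h‖ : ℂ) ^ 2 := inner_self_eq_norm_sq_to_K h
        simp only [Fin.val_zero, pow_zero, one_mul]
        congr 1
      · intro i _
        have : B i.succ 0 = 0 := by
          have e : ⟪h, h⟫_ℂ = (‖h‖ : ℂ) ^ 2 := inner_self_eq_norm_sq_to_K h
          simp only [B, Matrix.of_apply, Fin.cons_succ, Fin.cons_zero, inner_sub_left,
            inner_smul_left, e]
          rw [map_div₀, inner_conj_symm, map_pow, Complex.conj_ofReal]
          have hh2 : (‖h‖ : ℂ) ≠ 0 := by simpa using hh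
          field_simp
          simp
        simp [this]
    · intro i j
      refine Fin.cases ?_ (fun i => ?_) i
      · simp only [B, Matrix.of_apply, Fin.cons_zero, zero_mul, add_zero]
      · simp only [B, Matrix.of_apply, Fin.cons_zero, Fin.cons_succ, inner_sub_left,
          inner_smul_left]
        ring
  · rw [show gramKernel (Tuple.proj h ⟨n, v⟩) ⟨m, w⟩ = 0 from gramKernel_of_ne hnm _ _, mul_zero]
    exact gramKernel_of_ne (by simpa using hnm) _ _


/-- Auxiliary: `f ↦ ∑ x, f x • wedge (φ x)`. -/
noncomputable def wedgeCombMap {X : Type*} (φ : X → Tuple K) : (X →₀ ℂ) →ₗ[ℂ] Fock K :=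
  Finsupp.linearCombination ℂ fun x => wedge (φ x)

theorem inner_self_ofReal {E : Type*} [NormedAddCommGroup E] [InnerProductSpace ℂ E] (z : E) :
    ⟪z, z⟫_ℂ = ((‖z‖ ^ 2 : ℝ) : ℂ) := by
  rw [inner_self_eq_norm_sq_to_K]
  simp

theorem inner_linComb {X : Type*} (φ ψ : X → Tuple K) (f g : X →₀ ℂ) :
    ⟪wedgeCombMap φ f, wedgeCombMap ψ g⟫_ℂ =
      f.sum fun x a => g.sum fun y b => (starRingEnd ℂ) a * b * gramKernel (φ x) (ψ y) := by
  simp only [wedgeCombMap, Finsupp.linearCombination_apply, Finsupp.sum, sum_inner, inner_sum,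
    inner_smul_left, inner_smul_right, inner_wedge_wedge, Finset.mul_sum]
  rw [Finset.sum_comm]
  refine Finset.sum_congr rfl fun x _ => Finset.sum_congr rfl fun y _ => ?_
  ring

theorem creator_bound (h : H) (f : Tuple H →₀ ℂ) :
    ‖Finsupp.linearCombination ℂ (fun x => wedge (x.cons h)) f‖ ≤ ‖h‖ * ‖wedgeComb f‖ := by
  have e1 := inner_linComb (Tuple.cons h) (Tuple.cons h) f f
  have e2 := inner_linComb (Tuple.proj h) (Tuple.proj h) f f
  have e3 := inner_linComb (Tuple.proj h) id f f
  simp only [gramKernel_proj_proj] at e2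
  simp only [gramKernel_cons] at e1
  have e4 : ⟪wedgeCombMap (Tuple.cons h) f, wedgeCombMap (Tuple.cons h) f⟫_ℂ =
      ‖h‖ ^ 2 * ⟪wedgeCombMap (Tuple.proj h) f, wedgeCombMap (Tuple.proj h) f⟫_ℂ := by
    rw [e1, e2]
    simp only [Finsupp.sum, Finset.mul_sum]
    refine Finset.sum_congr rfl fun x _ => Finset.sum_congr rfl fun y _ => ?_
    ring
  have e5 : ⟪wedgeCombMap (Tuple.proj h) f, wedgeCombMap (Tuple.proj h) f⟫_ℂ =
      ⟪wedgeCombMap (Tuple.proj h) f, wedgeComb f⟫_ℂ := by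
    rw [e2]
    exact e3.symm
  have n1 : ‖wedgeCombMap (Tuple.proj h) f‖ ≤ ‖wedgeComb f‖ := by
    have h1 : ‖wedgeCombMap (Tuple.proj h) f‖ * ‖wedgeCombMap (Tuple.proj h) f‖ ≤
        ‖wedgeCombMap (Tuple.proj h) f‖ * ‖wedgeComb f‖ := by
      rw [← inner_self_eq_norm_mul_norm (𝕜 := ℂ), e5]
      exact re_inner_le_norm _ _
    rcases (norm_nonneg (wedgeCombMap (Tuple.proj h) f)).eq_or_lt with h0 | h0
    · rw [← h0]; exact norm_nonneg _
    · exact le_of_mul_le_mul_left h1 h0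
  have n2 : ‖wedgeCombMap (Tuple.cons h) f‖ ^ 2 =
      (‖h‖ * ‖wedgeCombMap (Tuple.proj h) f‖) ^ 2 := by
    rw [inner_self_ofReal, inner_self_ofReal] at e4
    rw [mul_pow]
    exact_mod_cast e4
  rw [sq_eq_sq₀ (norm_nonneg _) (by positivity)] at n2
  change ‖wedgeCombMap (Tuple.cons h) f‖ ≤ _
  rw [n2]
  gcongr

theorem creator_wedge (h : H) (x : Tuple H) : creator h (wedge x) = wedge (x.cons h) :=
  tupleMap_wedge ‖h‖ (creator_bound h) x

theorem gramKernel_append {H₁ H₂ : Submodule ℂ H} (hH : H₁ ⟂ H₂) (x x' : Tuple H₁)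
    (y y' : Tuple H₂) :
    gramKernel (x.append y) (x'.append y') = gramKernel x x' * gramKernel y y' := by
  classical
  obtain ⟨n, v⟩ := x
  obtain ⟨n', v'⟩ := x'
  obtain ⟨m, w⟩ := y
  obtain ⟨m', w'⟩ := y'
  have h12 : ∀ (a : H₁) (b : H₂), ⟪(a : H), (b : H)⟫_ℂ = 0 := fun a b =>
    hH.inner_eq a.2 b.2
  have h21 : ∀ (a : H₁) (b : H₂), ⟪(b : H), (a : H)⟫_ℂ = 0 := fun a b =>
    hH.symm.inner_eq b.2 a.2
  by_cases hn : n = n'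
  · subst hn
    by_cases hm : m = m'
    · subst hm
      change gramKernel ⟨n + m, Fin.append _ _⟩ ⟨n + m, Fin.append _ _⟩ = _
      rw [gramKernel_self, gramKernel_self, gramKernel_self]
      rw [← Matrix.det_submatrix_equiv_self finSumFinEquiv,
        ← Matrix.det_fromBlocks_zero₂₁ _ 0]
      congr 1
      ext i j
      rcases i with i | i <;> rcases j with j | j <;>
        simp [h12, h21]
    · rw [gramKernel_of_ne hm, mul_zero]
      exact gramKernel_of_ne (by simpa using hm) _ _
  · have hR : gramKernel (⟨n, v⟩ : Tuple H₁) ⟨n', v'⟩ = 0 := gramKernel_of_ne hn _ _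
    rw [hR, zero_mul]
    by_cases hs : n + m = n' + m'
    · change gramKernel ⟨n + m, Fin.append _ _⟩ ⟨n' + m', Fin.append _ _⟩ = _
      rw [gramKernel_of_eq hs, Matrix.det_apply]
      refine Finset.sum_eq_zero fun σ _ => ?_
      by_contra hne
      have hne := right_ne_zero_of_smul hne
      rw [Finset.prod_ne_zero_iff] at hne
      have key : ∀ j : Fin (n + m), j.val < n' ↔ (σ j).val < n := by
        intro j
        have h := hne j (Finset.mem_univ _)
        simp only [Matrix.of_apply] at h
        generalize hi : σ j = i at h
        generalize hj : Fin.cast hs j = j' at h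
        have hv : j.val = j'.val := by rw [← hj]; rfl
        rw [hv]
        revert h
        refine Fin.addCases (fun i => ?_) (fun i => ?_) i <;>
          refine Fin.addCases (fun k => ?_) (fun k => ?_) j' <;> intro h
        · simp
        · simp [h12] at h
        · simp [h21] at h
        · simp
      have hc : Fintype.card {j : Fin (n + m) // j.val < n'} =
          Fintype.card {j : Fin (n + m) // j.val < n} :=
        Fintype.card_congr (σ.subtypeEquiv key)
      have hcard : ∀ k, k ≤ n + m → Fintype.card {j : Fin (n + m) // j.val < k} = k := by
        intro k hk
        rw [Fintype.card_subtype]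
        simp [Fin.card_filter_val_lt, hk]
      rw [hcard n' (by omega), hcard n (by omega)] at hc
      exact hn hc.symm
    · exact gramKernel_of_ne hs _ _


theorem wedgeProd_bound {H₁ H₂ : Submodule ℂ H} (hH : H₁ ⟂ H₂) (f : Tuple H₁ →₀ ℂ)
    (g : Tuple H₂ →₀ ℂ) :
    ‖f.sum fun x a => g.sum fun y b => (a * b) • wedge (x.append y)‖ =
      ‖wedgeComb f‖ * ‖wedgeComb g‖ := by
  have e1 := inner_linComb (K := H₁) id id f f
  have e2 := inner_linComb (K := H₂) id id g g
  have e : ⟪f.sum fun x a => g.sum fun y b => (a * b) • wedge (x.append y),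
      f.sum fun x a => g.sum fun y b => (a * b) • wedge (x.append y)⟫_ℂ =
      ⟪wedgeComb f, wedgeComb f⟫_ℂ * ⟪wedgeComb g, wedgeComb g⟫_ℂ := by
    refine Eq.trans ?_ (congrArg₂ (· * ·) e1 e2).symm
    simp only [Finsupp.sum, ← Finset.sum_product', sum_inner, inner_sum, inner_smul_left,
      inner_smul_right, inner_wedge_wedge, gramKernel_append hH, id, map_mul]
    rw [Finset.sum_mul_sum]
    simp only [Finset.sum_product, Finset.mul_sum]
    conv_rhs => rw [Finset.sum_comm]
    refine Finset.sum_congr rfl fun x _ => ?_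
    rw [Finset.sum_comm]
    refine Finset.sum_congr rfl fun x' _ => ?_
    rw [Finset.sum_comm]
    refine Finset.sum_congr rfl fun y' _ => Finset.sum_congr rfl fun y _ => ?_
    ring
  rw [inner_self_ofReal, inner_self_ofReal, inner_self_ofReal, ← Complex.ofReal_mul,
    ← mul_pow] at e
  rw [← sq_eq_sq₀ (norm_nonneg _) (by positivity)]
  exact_mod_cast e

theorem wedgeProd_wedge {H₁ H₂ : Submodule ℂ H} (hH : H₁ ⟂ H₂) (x : Tuple H₁) (y : Tuple H₂) :
    wedgeProd H₁ H₂ (wedge x) (wedge y) = wedge (x.append y) := by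
  have h1 : ∀ (x : Tuple H₁) (y : Tuple H₂),
      tupleMap (Tuple.append (H₂ := H₂) x) (wedge y) = wedge (x.append y) := by
    intro x y
    refine tupleMap_wedge ‖wedge x‖ (fun g => ?_) y
    have := wedgeProd_bound hH (Finsupp.single x 1) g
    simp [wedgeComb] at this
    rw [← wedgeComb] at this
    rw [← this]
    rfl
  have h2 : ∀ f : Tuple H₁ →₀ ℂ, ‖Finsupp.linearCombination ℂ
      (fun x : Tuple H₁ => tupleMap (Tuple.append (H₂ := H₂) x)) f‖ ≤ 1 * ‖wedgeComb f‖ := by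
    intro f
    refine ContinuousLinearMap.opNorm_le_bound _ (by positivity) fun η => ?_
    refine denseRange_wedgeComb.induction (P := fun η => ‖Finsupp.linearCombination ℂ
      (fun x : Tuple H₁ => tupleMap (Tuple.append (H₂ := H₂) x)) f η‖ ≤ 1 * ‖wedgeComb f‖ * ‖η‖)
      ?_ (isClosed_le (by fun_prop) (by fun_prop)) η
    rintro _ ⟨g, rfl⟩
    rw [one_mul, ← wedgeProd_bound hH f g]
    apply le_of_eq
    congr 1
    simp only [Finsupp.linearCombination_apply, Finsupp.sum, wedgeComb,
      sum_apply, smul_apply, map_sum, map_smul, h1,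
      Finset.smul_sum, smul_smul]
    rw [Finset.sum_comm]
    simp only [mul_comm]
  have h3 := LinearMap.extendOfNorm_eq denseRange_wedgeComb ⟨1, h2⟩ (Finsupp.single x 1)
  simp only [wedgeComb, Finsupp.linearCombination_single, one_smul] at h3
  rw [wedgeProd, ← h1, ← h3]
  rfl

end Fock

section Operators

variable {E : Type*} [NormedAddCommGroup E] [InnerProductSpace ℂ E]

/-- The operator `T` has trace `z`, computed in any orthonormal basis. -/
def HasTrace (T : E →L[ℂ] E) (z : ℂ) : Prop :=
  ∀ (w : Set E) (b : HilbertBasis w ℂ E), HasSum (fun i => ⟪b i, T (b i)⟫_ℂ) z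

/-- Density operators: positive operators of trace one. -/
def IsDensity (D : E →L[ℂ] E) : Prop := D.IsPositive ∧ HasTrace D 1

/-- `b` is an orthonormal basis of eigenvectors of `T`, with eigenvalues `d`. -/
def IsEigenbasis {ι : Type*} (T : E →L[ℂ] E) (b : HilbertBasis ι ℂ E) (d : ι → ℝ) : Prop :=
  ∀ i, T (b i) = (d i : ℂ) • b i

/-- The relative entropy `Tr D (log D - log G)` of two density operators, in the form of the sum
`∑ |⟪φ_j, ψ_k⟫|² (d_j log d_j - d_j log g_k + g_k - d_j)` of nonnegative terms over orthonormal
eigenbases `φ`, `ψ` of `D`, `G`, whose value does not depend on the eigenbases; it is `∞` if the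
kernel of `G` is not contained in the kernel of `D`. (If it is contained, then the terms with
`g_k = 0` and the vectors in the kernel of `G` contribute nothing.) -/
noncomputable def relEntropy (D G : E →L[ℂ] E) : ℝ≥0∞ :=
  open Classical in
  if LinearMap.ker (G : E →ₗ[ℂ] E) ≤ LinearMap.ker (D : E →ₗ[ℂ] E) then
    sInf {S : ℝ≥0∞ | ∃ (w w' : Set E) (φ : HilbertBasis w ℂ E) (ψ : HilbertBasis w' ℂ E)
      (d : w → ℝ) (g : w' → ℝ), IsEigenbasis D φ d ∧ IsEigenbasis G ψ g ∧
      S = ∑' (j : w) (k : w'), ENNReal.ofReal (‖⟪φ j, ψ k⟫_ℂ‖ ^ 2 *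
        (d j * Real.log (d j) - d j * Real.log (g k) + g k - d j))}
  else ⊤

end Operators

section Basis

variable (E : Type*) [NormedAddCommGroup E] [InnerProductSpace ℂ E] [CompleteSpace E]

/-- The index set of a chosen orthonormal basis of a Hilbert space. -/
def stdIndex : Set E := (exists_hilbertBasis ℂ E).choose

/-- A chosen orthonormal basis of a Hilbert space. -/
noncomputable def stdBasis : HilbertBasis (stdIndex E) ℂ E :=
  (exists_hilbertBasis ℂ E).choose_spec.choose

end Basis

section States

variable {H : Type*} [NormedAddCommGroup H] [InnerProductSpace ℂ H]

/-- The (unbounded) number operator `∑ j, a†_{f j} a_{f j}` of an orthonormal family `f`, on its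
natural domain: the vectors for which the sum converges. It depends only on the closed span
of `f`. -/
noncomputable def numberOp {ι : Type*} (f : ι → H) : Fock H →ₗ.[ℂ] Fock H where
  domain :=
    { carrier := {ψ | Summable fun j => creator (f j) (annihilator (f j) ψ)}
      add_mem' := fun {ψ χ} hψ hχ => by
        simpa only [Set.mem_ofPred_eq, map_add] using Summable.add hψ hχ
      zero_mem' := by
        simpa only [Set.mem_ofPred_eq, map_zero] using summable_zero
      smul_mem' := fun c ψ hψ => by
        simpa only [Set.mem_ofPred_eq, map_smul] using Summable.const_smul c hψ }
  toFun :=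
    { toFun := fun ψ => ∑' j, creator (f j) (annihilator (f j) (ψ : Fock H))
      map_add' := fun ψ χ => by
        simpa only [Submodule.coe_add, map_add] using Summable.tsum_add ψ.2 χ.2
      map_smul' := fun c ψ => by
        simpa only [Submodule.coe_smul, map_smul, RingHom.id_apply] using
          Summable.tsum_const_smul c ψ.2 }

/-- The number operator `N` of the whole system. -/
noncomputable def number (H : Type*) [NormedAddCommGroup H] [InnerProductSpace ℂ H]
    [CompleteSpace H] : Fock H →ₗ.[ℂ] Fock H :=
  numberOp fun j => stdBasis H j

/-- The number operator of the subspace `H₁`, as an operator on the Fock space over `H`. -/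
noncomputable def numberOn (H₁ : Submodule ℂ H) [CompleteSpace H₁] : Fock H →ₗ.[ℂ] Fock H :=
  numberOp fun j => (stdBasis H₁ j : H)

/-- The bounded operator `D` commutes with the unbounded operator `A`. -/
def Commutes (A : Fock H →ₗ.[ℂ] Fock H) (D : Fock H →L[ℂ] Fock H) : Prop :=
  ∀ ψ : A.domain, ∃ h : D ψ ∈ A.domain, A ⟨D ψ, h⟩ = D (A ψ)

/-- `A D = D A = c D`; the first equation holds on the whole space, the second on the domain
of `A`. -/
def HasDefiniteValue (A : Fock H →ₗ.[ℂ] Fock H) (D : Fock H →L[ℂ] Fock H) (c : ℂ) : Prop :=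
  (∀ ψ, ∃ h : D ψ ∈ A.domain, A ⟨D ψ, h⟩ = c • D ψ) ∧ ∀ ψ : A.domain, D (A ψ) = c • D ψ

/-- The mean particle number `Tr (D N) = ∑ j, Tr (D a†_j a_j) = ∑ j, Tr (a_j D a†_j)`, a sum of
nonnegative terms for positive `D`. -/
noncomputable def meanNumber [CompleteSpace H] (D : Fock H →L[ℂ] Fock H) : ℝ≥0∞ :=
  ∑' (j : stdIndex H) (i : stdIndex (Fock H)), ENNReal.ofReal
    (⟪stdBasis (Fock H) i,
      annihilator (stdBasis H j) (D (creator (stdBasis H j) (stdBasis (Fock H) i)))⟫_ℂ).re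

/-- The class of density operators that commute with the number operator and have finite mean
particle number. -/
def IsFiniteState [CompleteSpace H] (D : Fock H →L[ℂ] Fock H) : Prop :=
  IsDensity D ∧ Commutes (number H) D ∧ meanNumber D < ⊤

/-- `γ` is the `1`-particle statistical operator of `D`:
`⟪h, γ g⟫ = Tr (D a†_g a_h)` for all `g`, `h`. -/
def IsOneParticleOp (D : Fock H →L[ℂ] Fock H) (γ : H →L[ℂ] H) : Prop :=
  ∀ g h : H, HasTrace (D ∘L creator g ∘L annihilator h) ⟪h, γ g⟫_ℂ

/-- The `1`-particle statistical operator of a density operator: the unique `γ` with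
`IsOneParticleOp D γ`. -/
noncomputable def oneParticleOp (D : Fock H →L[ℂ] Fock H) : H →L[ℂ] H :=
  Classical.epsilon (IsOneParticleOp D)

/-- The Slater determinant of the vectors `f i`, `i ∈ s`, taken in increasing order. -/
noncomputable def slater {ι : Type*} [LinearOrder ι] (f : ι → H) (s : Finset ι) : Fock H :=
  wedge ⟨s.card, fun i => f (s.orderEmbOfFin rfl i)⟩

/-- The weight `∏_{i ∈ s} p_i ∏_{j ∉ s} (1 - p_j)`. -/
noncomputable def freeWeight {ι : Type*} (p : ι → ℝ) (s : Finset ι) : ℝ :=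
  (∏ i ∈ s, p i) * ∏' j : {j // j ∉ s}, (1 - p j)

/-- `G` is the density operator `∑_s p(s) |a†_s Ω⟩⟨a†_s Ω|` of the free state built from an
orthonormal eigenbasis `f` of `γ` with eigenvalues `p`; the sum runs over the finite sets `s` of
indices. -/
def IsFreeDensity (γ : H →L[ℂ] H) (G : Fock H →L[ℂ] Fock H) : Prop :=
  ∃ (w : Set H) (_ : LinearOrder w) (f : HilbertBasis w ℂ H) (p : w → ℝ), IsEigenbasis γ f p ∧
    HasSum (fun s : Finset w =>
      (freeWeight p s : ℂ) • InnerProductSpace.rankOne ℂ (slater f s) (slater f s)) G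

/-- The density operator of the free state with `1`-particle statistical operator `γ`: the unique
`G` with `IsFreeDensity γ G`. -/
noncomputable def freeDensity (γ : H →L[ℂ] H) : Fock H →L[ℂ] Fock H :=
  Classical.epsilon (IsFreeDensity γ)

/-- The nonfreeness of `D`: its entropy relative to the free state with the same `1`-particle
statistical operator. -/
noncomputable def nonfreeness (D : Fock H →L[ℂ] Fock H) : ℝ≥0∞ :=
  relEntropy D (freeDensity (oneParticleOp D))

/-- The restriction of `D` over `H₁`: the partial trace of `D` over the second factor of
`Fock H ≅ Fock H₁ ⊗ Fock H₁ᗮ`, that is, the unique operator `D₁` with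
`⟪ξ, D₁ ξ'⟫ = ∑ i, ⟪ξ ∧ b i, D (ξ' ∧ b i)⟫` for every orthonormal basis `b` of `Fock H₁ᗮ`. -/
noncomputable def restrictFst (H₁ : Submodule ℂ H) (D : Fock H →L[ℂ] Fock H) :
    Fock H₁ →L[ℂ] Fock H₁ :=
  Classical.epsilon fun D₁ : Fock H₁ →L[ℂ] Fock H₁ =>
    ∀ (ξ ξ' : Fock H₁) (w : Set (Fock H₁ᗮ)) (b : HilbertBasis w ℂ (Fock H₁ᗮ)),
      HasSum (fun i => ⟪wedgeProd H₁ H₁ᗮ ξ (b i), D (wedgeProd H₁ H₁ᗮ ξ' (b i))⟫_ℂ)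
        ⟪ξ, D₁ ξ'⟫_ℂ

/-- The restriction of `D` over `H₁ᗮ`: the partial trace of `D` over the first factor of
`Fock H ≅ Fock H₁ ⊗ Fock H₁ᗮ`. -/
noncomputable def restrictSnd (H₁ : Submodule ℂ H) (D : Fock H →L[ℂ] Fock H) :
    Fock H₁ᗮ →L[ℂ] Fock H₁ᗮ :=
  Classical.epsilon fun D₂ : Fock H₁ᗮ →L[ℂ] Fock H₁ᗮ =>
    ∀ (η η' : Fock H₁ᗮ) (w : Set (Fock H₁)) (b : HilbertBasis w ℂ (Fock H₁)),
      HasSum (fun i => ⟪wedgeProd H₁ H₁ᗮ (b i) η, D (wedgeProd H₁ H₁ᗮ (b i) η')⟫_ℂ)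
        ⟪η, D₂ η'⟫_ℂ

end States

end Fermion

namespace Fermion

/-! ### Hilbert bases of arbitrary index type, Parseval, and eigenbases. -/

section HilbertBases

variable {E : Type*} [NormedAddCommGroup E] [InnerProductSpace ℂ E]

/-! Write `Δ = ∑ |x k⟩⟨x k|`. Since `N₁ Δ = n Δ`, every `x k` has exactly `n` particles in `H₁`. For
`g ∈ H₁` and `h ∈ H₁ᗮ` the vectors `a_g (x k)` and `a_h (x k)` have `n - 1` and `n` particles in
`H₁`, so they are orthogonal (`inner_annihilator_eq_zero`). Hence the one-particle operator `γ` of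
`Δ` is block diagonal. Its blocks are the one-particle operators of `Δ₁` and `Δ₂`, because `a†_g
a_h` with both vectors in the same summand acts on one tensor factor only. An eigenbasis of `γ` can
then be chosen as a union of eigenbases of the blocks, the weights multiply, and the free density is
a product `Γ₁ ⊗ Γ₂` (`IsFreeDensity.isEigenbasis_prod`).

What remains is the superadditivity `S(Δ | Γ₁ ⊗ Γ₂) ≥ S(Δ₁ | Γ₁) + S(Δ₂ | Γ₂)`
(`IsTensor.entropySum_add_le`). Formally the difference of the two sides is `S(Δ | Δ₁ ⊗ Δ₂)`, which
is nonnegative by Klein's inequality. The von Neumann entropies involved may be infinite, so this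
identity cannot be used as it stands. Instead `Δ₁ ⊗ Δ₂` is replaced by a trial product: in each
factor the compression of `Δᵢ` to finitely many eigenvectors of `Γᵢ`, completed by `Γᵢ` itself on
the remaining eigenvectors. Only finitely many logarithmic terms then differ from those of `Γ₁ ⊗
Γ₂`, and Klein's inequality for the trial operator becomes a lower bound for `S(Δ | Γ₁ ⊗ Γ₂)`
without infinite differences (`IsTensor.le_sum_quad_entropyTerm`). As the finite sets grow, the
compressions converge strongly to `Δᵢ`. Continuous functions of them then converge in the sense of
quadratic forms (`tendsto_quad`), which recovers every finite part of `S(Δᵢ | Γᵢ)` in the limit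
(`IsDensity.exists_trials`).

Two choices made in the definitions have to be shown harmless. The relative entropy does not depend
on the eigenbases (`entropySum_congr`), and any wedge product of vectors from an eigenbasis of `γ`
is an eigenvector of the chosen free density (`IsFreeDensity.apply_wedge`). -/

theorem HilbertBasis.ext_inner {ι : Type*} (b : HilbertBasis ι ℂ E) {x y : E}
    (h : ∀ i, ⟪b i, x⟫_ℂ = ⟪b i, y⟫_ℂ) : x = y := by
  apply b.repr.injective
  ext i
  simpa [b.repr_apply_apply] using h i

/-- Parseval's identity. -/
theorem HilbertBasis.hasSum_norm_sq {ι : Type*} (b : HilbertBasis ι ℂ E) (x : E) :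
    HasSum (fun i => ‖⟪b i, x⟫_ℂ‖ ^ 2) (‖x‖ ^ 2) := by
  have h := b.hasSum_inner_mul_inner x x
  rw [inner_self_ofReal] at h
  have h2 : ∀ i, ⟪x, b i⟫_ℂ * ⟪b i, x⟫_ℂ = ((‖⟪b i, x⟫_ℂ‖ ^ 2 : ℝ) : ℂ) := by
    intro i
    rw [← inner_conj_symm x (b i), ← Complex.normSq_eq_conj_mul_self, Complex.normSq_eq_norm_sq]
  simp only [h2] at h
  exact_mod_cast h

theorem HilbertBasis.tsum_ofReal_norm_sq {ι : Type*} (b : HilbertBasis ι ℂ E) (x : E) :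
    ∑' i, ENNReal.ofReal (‖⟪b i, x⟫_ℂ‖ ^ 2) = ENNReal.ofReal (‖x‖ ^ 2) := by
  rw [← ENNReal.ofReal_tsum_of_nonneg (fun i => by positivity)
    (HilbertBasis.hasSum_norm_sq b x).summable, (HilbertBasis.hasSum_norm_sq b x).tsum_eq]

/-- A Hilbert basis, indexed by its range. -/
noncomputable def HilbertBasis.toRange [CompleteSpace E] {ι : Type*} (b : HilbertBasis ι ℂ E) :
    HilbertBasis (Set.range b) ℂ E :=
  HilbertBasis.mk (v := ((↑) : Set.range b → E)) b.orthonormal.toSubtypeRange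
    (by rw [Subtype.range_coe]; exact b.dense_span.ge)

theorem HilbertBasis.toRange_apply [CompleteSpace E] {ι : Type*} (b : HilbertBasis ι ℂ E)
    (x : Set.range b) : HilbertBasis.toRange b x = x := by
  simp [HilbertBasis.toRange]

theorem HilbertBasis.injective {ι : Type*} (b : HilbertBasis ι ℂ E) : Function.Injective b :=
  b.orthonormal.linearIndependent.injective

/-- The index set of a Hilbert basis is equivalent to its range. -/
noncomputable def HilbertBasis.equivRange {ι : Type*} (b : HilbertBasis ι ℂ E) :
    ι ≃ Set.range b :=
  Equiv.ofInjective b (HilbertBasis.injective b)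

theorem HilbertBasis.toRange_equivRange [CompleteSpace E] {ι : Type*} (b : HilbertBasis ι ℂ E)
    (i : ι) : HilbertBasis.toRange b (HilbertBasis.equivRange b i) = b i := by
  rw [HilbertBasis.toRange_apply]; rfl

theorem HilbertBasis.norm_apply {ι : Type*} (b : HilbertBasis ι ℂ E) (i : ι) : ‖b i‖ = 1 :=
  b.orthonormal.1 i

/-- `HasTrace` quantifies only over bases indexed by sets of vectors; reindexing by the range
reaches all other index types. -/
theorem hasTrace_apply [CompleteSpace E] {T : E →L[ℂ] E} {z : ℂ} (h : HasTrace T z) {ι : Type*}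
    (b : HilbertBasis ι ℂ E) : HasSum (fun i => ⟪b i, T (b i)⟫_ℂ) z := by
  have := (HilbertBasis.equivRange b).hasSum_iff.2 (h _ (HilbertBasis.toRange b))
  simpa only [Function.comp_def, HilbertBasis.toRange_equivRange] using this

theorem hasTrace_unique [CompleteSpace E] {T : E →L[ℂ] E} {z z' : ℂ} (h : HasTrace T z)
    (h' : HasTrace T z') : z = z' := by
  obtain ⟨w, b, -⟩ := exists_hilbertBasis ℂ E
  exact (h w b).unique (h' w b)

theorem eigenvalue_nonneg {T : E →L[ℂ] E} (hT : T.IsPositive) {ι : Type*}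
    {b : HilbertBasis ι ℂ E} {d : ι → ℝ} (h : IsEigenbasis T b d) (i : ι) : 0 ≤ d i := by
  have := hT.re_inner_nonneg_right (b i)
  rw [h i, inner_smul_right, inner_self_ofReal, HilbertBasis.norm_apply] at this
  simpa using this

/-- No symmetry of `T` is needed: expand `x` in the eigenbasis and apply `T` term by term. -/
theorem inner_apply_of_isEigenbasis {T : E →L[ℂ] E} {ι : Type*}
    {b : HilbertBasis ι ℂ E} {d : ι → ℝ} (h : IsEigenbasis T b d) (i : ι) (x : E) :
    ⟪b i, T x⟫_ℂ = d i * ⟪b i, x⟫_ℂ := by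
  classical
  have h1 : HasSum (fun j => b.repr x j • T (b j)) (T x) := by
    simpa using (b.hasSum_repr x).mapL T
  have h2 : HasSum (fun j => ⟪b i, b.repr x j • T (b j)⟫_ℂ) ⟪b i, T x⟫_ℂ :=
    h1.mapL (innerSL ℂ (b i))
  have h3 : ∀ j, j ≠ i → ⟪b i, b.repr x j • T (b j)⟫_ℂ = 0 := by
    intro j hj
    rw [h j, inner_smul_right, inner_smul_right, b.orthonormal.2 hj.symm]
    simp
  rw [h2.unique (hasSum_single i h3), h i, inner_smul_right, inner_smul_right,
    b.repr_apply_apply, inner_self_ofReal, HilbertBasis.norm_apply]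
  simp [mul_comm]

end HilbertBases

/-! ### Positive trace class operators as sums of rank one operators. -/

section Gram

variable {E : Type*} [NormedAddCommGroup E] [InnerProductSpace ℂ E]

/-- `T = ∑ k, |x k⟩⟨x k|` is a positive trace class operator. -/
structure HasGram {κ : Type*} (x : κ → E) (T : E →L[ℂ] E) : Prop where
  summable : Summable fun k => ‖x k‖ ^ 2
  hasSum : ∀ u v, HasSum (fun k => ⟪u, x k⟫_ℂ * ⟪x k, v⟫_ℂ) ⟪u, T v⟫_ℂ

variable [CompleteSpace E]

theorem summable_rankOne {κ : Type*} {x : κ → E} (h : Summable fun k => ‖x k‖ ^ 2) :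
    Summable fun k => InnerProductSpace.rankOne ℂ (x k) (x k) := by
  refine Summable.of_norm ?_
  simpa [← sq] using h

theorem hasSum_inner_rankOne {κ : Type*} {x : κ → E} {T : E →L[ℂ] E}
    (h : HasSum (fun k => InnerProductSpace.rankOne ℂ (x k) (x k)) T) (u v : E) :
    HasSum (fun k => ⟪u, x k⟫_ℂ * ⟪x k, v⟫_ℂ) ⟪u, T v⟫_ℂ := by
  have h1 := (h.mapL (ContinuousLinearMap.apply ℂ E v)).mapL (innerSL ℂ u)
  simpa [inner_smul_right, mul_comm] using h1

theorem exists_hasGram {κ : Type*} {x : κ → E} (h : Summable fun k => ‖x k‖ ^ 2) :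
    ∃ T, HasGram x T :=
  ⟨_, h, hasSum_inner_rankOne (summable_rankOne h).hasSum⟩

theorem HasGram.hasSum_rankOne {κ : Type*} {x : κ → E} {T : E →L[ℂ] E} (h : HasGram x T) :
    HasSum (fun k => InnerProductSpace.rankOne ℂ (x k) (x k)) T := by
  have h1 := (summable_rankOne h.summable).hasSum
  convert h1
  ext v
  refine ext_inner_left ℂ fun u => ?_
  exact (h.hasSum u v).unique (hasSum_inner_rankOne h1 u v)

theorem isCompactOperator_rankOne (x y : E) :
    IsCompactOperator (InnerProductSpace.rankOne ℂ x y) := by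
  have h : IsCompactOperator (ContinuousLinearMap.toSpanSingleton ℂ x) :=
    isCompactOperator_of_locallyCompactSpace_rng
      (ContinuousLinearMap.toSpanSingleton ℂ x)
  rw [InnerProductSpace.rankOne_def']
  exact h.comp_clm _

/-- The series of rank one operators converges in norm, so `T` is a norm limit of finite rank
operators. -/
theorem HasGram.isCompactOperator {κ : Type*} {x : κ → E} {T : E →L[ℂ] E} (h : HasGram x T) :
    IsCompactOperator T := by
  refine isCompactOperator_of_tendsto h.hasSum_rankOne (Filter.Eventually.of_forall fun s => ?_)
  induction s using Finset.cons_induction with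
  | empty => simpa using isCompactOperator_zero
  | cons a s ha ih =>
    rw [Finset.sum_cons]
    exact (isCompactOperator_rankOne _ _).add ih

theorem HasGram.isPositive {κ : Type*} {x : κ → E} {T : E →L[ℂ] E} (h : HasGram x T) :
    T.IsPositive := by
  rw [ContinuousLinearMap.isPositive_def]
  have hs : ∀ u v, ⟪T u, v⟫_ℂ = ⟪u, T v⟫_ℂ := by
    intro u v
    rw [← inner_conj_symm]
    refine ((h.hasSum v u).mapL (Complex.conjCLE : ℂ →L[ℝ] ℂ)).unique ?_
    convert h.hasSum u v using 2 with k
    simp [mul_comm]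
  refine ⟨hs, fun u => ?_⟩
  rw [ContinuousLinearMap.reApplyInnerSelf_apply, hs]
  refine ((h.hasSum u u).mapL (Complex.reCLM)).nonneg fun k => ?_
  rw [← inner_conj_symm u, ← Complex.normSq_eq_conj_mul_self]
  simpa using Complex.normSq_nonneg _

/-- The spectral theorem for positive compact operators. -/
theorem exists_isEigenbasis {T : E →L[ℂ] E} (hc : IsCompactOperator T) (hp : T.IsPositive) :
    ∃ (w : Set E) (b : HilbertBasis w ℂ E) (d : w → ℝ), IsEigenbasis T b d := by
  let V : ℂ → Submodule ℂ E := fun μ => Module.End.eigenspace (T : Module.End ℂ E) μ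
  have hV : ∀ μ, IsClosed (V μ : Set E) := by
    intro μ
    have : (V μ : Set E) = {x | T x = μ • x} := by
      ext x
      exact Module.End.mem_eigenspace_iff
    rw [this]
    exact isClosed_eq (by fun_prop) (by fun_prop)
  have : ∀ μ, CompleteSpace (V μ) := fun μ => (hV μ).completeSpace_coe
  choose w b hb using fun μ => exists_hilbertBasis ℂ (V μ)
  let v : (Σ μ, w μ) → E := fun a => (b a.1 a.2 : V a.1)
  have hv : Orthonormal ℂ v := by
    have hF := hp.isSymmetric.orthogonalFamily_eigenspaces
    exact hF.orthonormal_sigma_orthonormal (v_family := fun μ => b μ) fun μ => (b μ).orthonormal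
  have hsp : (Submodule.span ℂ (Set.range v))ᗮ = ⊥ := by
    rw [eq_bot_iff, ← ContinuousLinearMap.orthogonalComplement_iSup_eigenspaces_eq_bot hc
      hp.isSymmetric]
    intro x hx
    rw [Submodule.mem_orthogonal] at hx
    rw [← Submodule.iInf_orthogonal, Submodule.mem_iInf]
    intro μ
    rw [Submodule.mem_orthogonal]
    intro y hy
    have h2 : HasSum _ y := ((b μ).hasSum_repr ⟨y, hy⟩).mapL (V μ).subtypeL
    have h3 := h2.mapL (innerSL ℂ x)
    have h4 : ⟪x, y⟫_ℂ = 0 := by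
      refine h3.unique ?_
      convert hasSum_zero with i
      have h5 := hx _ (Submodule.subset_span ⟨⟨μ, i⟩, rfl⟩)
      have h6 : ⟪x, ((b μ i : V μ) : E)⟫_ℂ = 0 := inner_eq_zero_symm.1 h5
      simp [h6]
    exact inner_eq_zero_symm.1 h4
  let c := HilbertBasis.mkOfOrthogonalEqBot hv hsp
  have hc' : ∀ a, T (c a) = a.1 • c a := by
    intro a
    rw [HilbertBasis.coe_mkOfOrthogonalEqBot]
    exact Module.End.mem_eigenspace_iff.1 (b a.1 a.2 : V a.1).2
  -- The eigenspaces are indexed by complex numbers, but symmetry makes every eigenvalue that occurs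
  -- in the basis real.
  have hre : ∀ a : (Σ μ, w μ), ((a.1.re : ℝ) : ℂ) = a.1 := by
    intro a
    have h1 := hp.isSymmetric (c a) (c a)
    rw [ContinuousLinearMap.coe_coe, hc', inner_smul_left, inner_smul_right, inner_self_ofReal,
      HilbertBasis.norm_apply] at h1
    exact Complex.conj_eq_iff_re.1 (by simpa using h1)
  refine ⟨_, HilbertBasis.toRange c, fun i => ((HilbertBasis.equivRange c).symm i).1.re,
    fun i => ?_⟩
  obtain ⟨a, rfl⟩ := (HilbertBasis.equivRange c).surjective i
  simp only [HilbertBasis.toRange_equivRange, hc', Equiv.symm_apply_apply, hre]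

/-- The trace of `A† T B`, in any basis. -/
theorem HasGram.hasSum_inner_map {κ : Type*} {x : κ → E} {T : E →L[ℂ] E} (h : HasGram x T)
    {F : Type*} [NormedAddCommGroup F] [InnerProductSpace ℂ F] [CompleteSpace F]
    (A B : F →L[ℂ] E) {ι : Type*} (b : HilbertBasis ι ℂ F) :
    HasSum (fun i => ⟪A (b i), T (B (b i))⟫_ℂ) (∑' k, ⟪B.adjoint (x k), A.adjoint (x k)⟫_ℂ) := by
  have hk : ∀ k, HasSum (fun i => ⟪A (b i), x k⟫_ℂ * ⟪x k, B (b i)⟫_ℂ)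
      ⟪B.adjoint (x k), A.adjoint (x k)⟫_ℂ := by
    intro k
    have := b.hasSum_inner_mul_inner (B.adjoint (x k)) (A.adjoint (x k))
    simpa [ContinuousLinearMap.adjoint_inner_left, ContinuousLinearMap.adjoint_inner_right,
      mul_comm] using this
  have hA : ∀ (A : F →L[ℂ] E) k, HasSum (fun i => ‖⟪A (b i), x k⟫_ℂ‖ ^ 2)
      (‖A.adjoint (x k)‖ ^ 2) := by
    intro A k
    convert HilbertBasis.hasSum_norm_sq b (A.adjoint (x k)) using 3 with i
    rw [ContinuousLinearMap.adjoint_inner_right]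
  have hn : ∀ k, HasSum (fun i => ‖⟪A (b i), x k⟫_ℂ‖ ^ 2 + ‖⟪x k, B (b i)⟫_ℂ‖ ^ 2)
      (‖A.adjoint (x k)‖ ^ 2 + ‖B.adjoint (x k)‖ ^ 2) := by
    intro k
    refine (hA A k).add ?_
    simp only [norm_inner_symm (x k)]
    exact hA B k
  have hB : ∀ B : F →L[ℂ] E, Summable fun k => ‖B.adjoint (x k)‖ ^ 2 := by
    intro B
    refine (h.summable.mul_left (‖B.adjoint‖ ^ 2)).of_nonneg_of_le (fun k => by positivity)
      fun k => ?_
    rw [← mul_pow]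
    gcongr
    exact B.adjoint.le_opNorm _
  -- By `|ab| ≤ a² + b²` the double series over `κ × ι` converges absolutely, so it may be summed in
  -- either order. Summing over `ι` first gives a value in which the basis `b` no longer appears.
  have hS : Summable fun p : κ × ι => ‖⟪A (b p.2), x p.1⟫_ℂ‖ ^ 2 + ‖⟪x p.1, B (b p.2)⟫_ℂ‖ ^ 2 := by
    refine (summable_prod_of_nonneg fun p => by positivity).2 ⟨fun k => (hn k).summable, ?_⟩
    simp only [(hn _).tsum_eq]
    exact (hB A).add (hB B)
  have hT : Summable fun p : κ × ι => ⟪A (b p.2), x p.1⟫_ℂ * ⟪x p.1, B (b p.2)⟫_ℂ := by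
    refine Summable.of_norm_bounded hS fun p => ?_
    rw [norm_mul]
    nlinarith [sq_nonneg (‖⟪A (b p.2), x p.1⟫_ℂ‖ - ‖⟪x p.1, B (b p.2)⟫_ℂ‖),
      sq_nonneg (‖⟪A (b p.2), x p.1⟫_ℂ‖), sq_nonneg ‖⟪x p.1, B (b p.2)⟫_ℂ‖]
  have h1 := hT.hasSum.prod_fiberwise hk
  have h2 := ((Equiv.prodComm κ ι).symm.hasSum_iff.2 hT.hasSum).prod_fiberwise
    fun i => h.hasSum (A (b i)) (B (b i))
  rw [h1.tsum_eq]
  exact h2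

theorem HasGram.hasSum_inner_comp {κ : Type*} {x : κ → E} {T : E →L[ℂ] E} (h : HasGram x T)
    (B : E →L[ℂ] E) {ι : Type*} (b : HilbertBasis ι ℂ E) :
    HasSum (fun i => ⟪b i, T (B (b i))⟫_ℂ) (∑' k, ⟪x k, B (x k)⟫_ℂ) := by
  have := h.hasSum_inner_map (ContinuousLinearMap.id ℂ E) B b
  simpa only [ContinuousLinearMap.adjoint_inner_right, ContinuousLinearMap.id_apply,
    ContinuousLinearMap.adjoint_inner_left] using this

theorem HasGram.hasTrace_comp {κ : Type*} {x : κ → E} {T : E →L[ℂ] E} (h : HasGram x T)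
    (B : E →L[ℂ] E) : HasTrace (T ∘L B) (∑' k, ⟪x k, B (x k)⟫_ℂ) :=
  fun _ b => h.hasSum_inner_comp B b

theorem HasGram.hasTrace {κ : Type*} {x : κ → E} {T : E →L[ℂ] E} (h : HasGram x T) :
    HasTrace T ((∑' k, ‖x k‖ ^ 2 : ℝ) : ℂ) := by
  have := h.hasTrace_comp (ContinuousLinearMap.id ℂ E)
  simpa only [ContinuousLinearMap.comp_id, ContinuousLinearMap.id_apply, inner_self_ofReal,
    ← Complex.ofReal_tsum] using this

/-- A density operator `D` is `∑ k, |x k⟩⟨x k|` with `x k = √D (b k)`, for a basis `b`. -/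
theorem IsDensity.exists_hasGram {D : E →L[ℂ] E} (hD : IsDensity D) :
    ∃ (w : Set E) (x : w → E), HasGram x D ∧ ∑' k, ‖x k‖ ^ 2 = 1 := by
  obtain ⟨w, b, -⟩ := exists_hilbertBasis ℂ E
  have h0 : 0 ≤ D := (ContinuousLinearMap.nonneg_iff_isPositive D).2 hD.1
  have hS : (CFC.sqrt D).IsPositive :=
    (ContinuousLinearMap.nonneg_iff_isPositive _).1 (CFC.sqrt_nonneg D)
  have hSS : ∀ v, CFC.sqrt D (CFC.sqrt D v) = D v := fun v => by
    conv_rhs => rw [← CFC.sqrt_mul_sqrt_self D h0]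
    rfl
  have hsum : HasSum (fun k => ‖CFC.sqrt D (b k)‖ ^ 2) 1 := by
    have h1 := hD.2 w b
    have h2 : ∀ k, ⟪b k, D (b k)⟫_ℂ = ((‖CFC.sqrt D (b k)‖ ^ 2 : ℝ) : ℂ) := by
      intro k
      rw [← hSS, ← hS.inner_left_eq_inner_right, inner_self_ofReal]
    simp only [h2] at h1
    rw [← Complex.ofReal_one] at h1
    exact Complex.hasSum_ofReal.1 h1
  refine ⟨w, fun k => CFC.sqrt D (b k), ⟨hsum.summable, fun u v => ?_⟩, hsum.tsum_eq⟩
  have h1 := b.hasSum_inner_mul_inner (CFC.sqrt D u) (CFC.sqrt D v)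
  rw [hS.inner_left_eq_inner_right, hSS] at h1
  simpa only [hS.inner_left_eq_inner_right] using h1

theorem HasGram.isDensity {κ : Type*} {x : κ → E} {T : E →L[ℂ] E} (h : HasGram x T)
    (h1 : ∑' k, ‖x k‖ ^ 2 = 1) : IsDensity T :=
  ⟨h.isPositive, by simpa [h1] using h.hasTrace⟩

/-- Here `0 = ⟪u, T u⟫ = ∑ |⟪u, x k⟫|²`, a sum of nonnegative terms. -/
theorem HasGram.inner_eq_zero {κ : Type*} {x : κ → E} {T : E →L[ℂ] E} (h : HasGram x T) {u : E}
    (hu : T u = 0) (k : κ) : ⟪u, x k⟫_ℂ = 0 := by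
  have h1 := (h.hasSum u u).mapL Complex.reCLM
  rw [hu, inner_zero_right, map_zero] at h1
  have h2 : ∀ k, Complex.reCLM (⟪u, x k⟫_ℂ * ⟪x k, u⟫_ℂ) = ‖⟪u, x k⟫_ℂ‖ ^ 2 := by
    intro k
    rw [← inner_conj_symm (x k), Complex.mul_conj, Complex.normSq_eq_norm_sq]
    exact Complex.ofReal_re _
  simp only [h2] at h1
  have h3 := (hasSum_zero_iff_of_nonneg fun k => by positivity).1 h1
  simpa using congrFun h3 k

end Gram

/-! ### Independence of the relative entropy of the eigenbases. -/

section RelEntropy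

variable {E : Type*} [NormedAddCommGroup E] [InnerProductSpace ℂ E] [CompleteSpace E]

/-- The eigenspace of `T`. -/
noncomputable def eigenspace (T : E →L[ℂ] E) (μ : ℝ) : Submodule ℂ E :=
  LinearMap.ker ((T - (μ : ℂ) • ContinuousLinearMap.id ℂ E : E →L[ℂ] E) : E →ₗ[ℂ] E)

theorem mem_eigenspace {T : E →L[ℂ] E} {μ : ℝ} {x : E} :
    x ∈ eigenspace T μ ↔ T x = (μ : ℂ) • x := by
  simp [eigenspace, sub_eq_zero]

instance instCompleteEigenspace (T : E →L[ℂ] E) (μ : ℝ) : CompleteSpace (eigenspace T μ) :=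
  (ContinuousLinearMap.isClosed_ker _).completeSpace_coe

theorem inner_starProjection_eigenspace {T : E →L[ℂ] E} {ι : Type*} {φ : HilbertBasis ι ℂ E}
    {d : ι → ℝ} (hφ : IsEigenbasis T φ d) (v : E) (μ : ℝ) (j : ι) [Decidable (d j = μ)] :
    ⟪φ j, (eigenspace T μ).starProjection v⟫_ℂ = if d j = μ then ⟪φ j, v⟫_ℂ else 0 := by
  split_ifs with h
  · rw [← Submodule.inner_starProjection_left_eq_right]
    rw [Submodule.starProjection_eq_self_iff.2 (mem_eigenspace.2 (h ▸ hφ j))]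
  · have h1 := mem_eigenspace.1 ((eigenspace T μ).starProjection_apply_mem v)
    have h2 := inner_apply_of_isEigenbasis hφ j ((eigenspace T μ).starProjection v)
    rw [h1, inner_smul_right] at h2
    have h3 : ((μ : ℂ) - d j) * ⟪φ j, (eigenspace T μ).starProjection v⟫_ℂ = 0 := by
      rw [sub_mul, h2, sub_self]
    rcases mul_eq_zero.1 h3 with h4 | h4
    · exact absurd (by exact_mod_cast (sub_eq_zero.1 h4).symm) h
    · exact h4

/-- Grouping the indices `j` by eigenvalue turns the left side into the spectral measure of `v`,
which knows `T` but not the basis. On the right all but the eigenvalues contribute `0`. -/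
theorem tsum_eigenbasis {T : E →L[ℂ] E} {ι : Type*} {φ : HilbertBasis ι ℂ E}
    {d : ι → ℝ} (hφ : IsEigenbasis T φ d) (v : E) (f : ℝ → ℝ≥0∞) :
    ∑' j, ENNReal.ofReal (‖⟪φ j, v⟫_ℂ‖ ^ 2) * f (d j) =
      ∑' μ : ℝ, ENNReal.ofReal (‖(eigenspace T μ).starProjection v‖ ^ 2) * f μ := by
  classical
  have h : ∀ μ, ENNReal.ofReal (‖(eigenspace T μ).starProjection v‖ ^ 2) * f μ =
      ∑' j, if d j = μ then ENNReal.ofReal (‖⟪φ j, v⟫_ℂ‖ ^ 2) * f μ else 0 := by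
    intro μ
    rw [← HilbertBasis.tsum_ofReal_norm_sq φ, ← ENNReal.tsum_mul_right]
    refine tsum_congr fun j => ?_
    rw [inner_starProjection_eigenspace hφ]
    split_ifs <;> simp
  simp only [h]
  rw [ENNReal.tsum_comm]
  refine tsum_congr fun j => ?_
  rw [tsum_eq_single (d j) fun μ hμ => if_neg hμ.symm, if_pos rfl]

/-- The summand of the relative entropy. -/
noncomputable def entropyTerm (x y : ℝ) : ℝ := x * Real.log x - x * Real.log y + y - x

/-- The sum that gives the relative entropy, for orthonormal bases `φ`, `ψ`. -/
noncomputable def entropySum {ι κ : Type*} (φ : HilbertBasis ι ℂ E) (ψ : HilbertBasis κ ℂ E)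
    (d : ι → ℝ) (g : κ → ℝ) : ℝ≥0∞ :=
  ∑' (j : ι) (k : κ), ENNReal.ofReal (‖⟪φ j, ψ k⟫_ℂ‖ ^ 2 * entropyTerm (d j) (g k))

/-- The bases are exchanged one at a time by `tsum_eigenbasis`, with the other basis vector fixed.
All terms are in `ℝ≥0∞`, so the order of summation is free, and the truncation by `ENNReal.ofReal`
acts only on the factor that depends on the eigenvalues. -/
theorem entropySum_congr {D G : E →L[ℂ] E} {ι κ ι' κ' : Type*} {φ : HilbertBasis ι ℂ E}
    {ψ : HilbertBasis κ ℂ E} {d : ι → ℝ} {g : κ → ℝ} {φ' : HilbertBasis ι' ℂ E}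
    {ψ' : HilbertBasis κ' ℂ E} {d' : ι' → ℝ} {g' : κ' → ℝ} (hφ : IsEigenbasis D φ d)
    (hψ : IsEigenbasis G ψ g) (hφ' : IsEigenbasis D φ' d') (hψ' : IsEigenbasis G ψ' g') :
    entropySum φ ψ d g = entropySum φ' ψ' d' g' := by
  calc entropySum φ ψ d g
      = ∑' k, ∑' j, ENNReal.ofReal (‖⟪φ j, ψ k⟫_ℂ‖ ^ 2) *
          (fun x => ENNReal.ofReal (entropyTerm x (g k))) (d j) := by
        rw [entropySum, ENNReal.tsum_comm]
        simp only [ENNReal.ofReal_mul (sq_nonneg _)]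
    _ = ∑' k, ∑' j, ENNReal.ofReal (‖⟪φ' j, ψ k⟫_ℂ‖ ^ 2) *
          (fun x => ENNReal.ofReal (entropyTerm x (g k))) (d' j) := by
        refine tsum_congr fun k => ?_
        exact (tsum_eigenbasis hφ _ fun x => ENNReal.ofReal (entropyTerm x (g k))).trans
          (tsum_eigenbasis hφ' _ _).symm
    _ = ∑' j, ∑' k, ENNReal.ofReal (‖⟪ψ k, φ' j⟫_ℂ‖ ^ 2) *
          (fun y => ENNReal.ofReal (entropyTerm (d' j) y)) (g k) := by
        rw [ENNReal.tsum_comm]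
        simp only [norm_inner_symm]
    _ = ∑' j, ∑' k, ENNReal.ofReal (‖⟪ψ' k, φ' j⟫_ℂ‖ ^ 2) *
          (fun y => ENNReal.ofReal (entropyTerm (d' j) y)) (g' k) := by
        refine tsum_congr fun j => ?_
        exact (tsum_eigenbasis hψ _ fun y => ENNReal.ofReal (entropyTerm (d' j) y)).trans
          (tsum_eigenbasis hψ' _ _).symm
    _ = entropySum φ' ψ' d' g' := by
        rw [entropySum]
        simp only [ENNReal.ofReal_mul (sq_nonneg _), norm_inner_symm]

theorem IsEigenbasis.toRange {T : E →L[ℂ] E} {ι : Type*} {φ : HilbertBasis ι ℂ E}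
    {d : ι → ℝ} (hφ : IsEigenbasis T φ d) :
    IsEigenbasis T (HilbertBasis.toRange φ) (d ∘ (HilbertBasis.equivRange φ).symm) := by
  intro i
  obtain ⟨a, rfl⟩ := (HilbertBasis.equivRange φ).surjective i
  simp only [HilbertBasis.toRange_equivRange, hφ a, Function.comp, Equiv.symm_apply_apply]

/-- The relative entropy, computed in any eigenbases. -/
theorem relEntropy_eq {D G : E →L[ℂ] E}
    (hk : LinearMap.ker (G : E →ₗ[ℂ] E) ≤ LinearMap.ker (D : E →ₗ[ℂ] E)) {ι κ : Type*}
    {φ : HilbertBasis ι ℂ E} {ψ : HilbertBasis κ ℂ E} {d : ι → ℝ} {g : κ → ℝ}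
    (hφ : IsEigenbasis D φ d) (hψ : IsEigenbasis G ψ g) :
    relEntropy D G = entropySum φ ψ d g := by
  rw [relEntropy, if_pos hk]
  refine le_antisymm (sInf_le ⟨_, _, _, _, _, _, hφ.toRange, hψ.toRange, ?_⟩) (le_sInf ?_)
  · exact entropySum_congr hφ hψ hφ.toRange hψ.toRange
  · rintro S ⟨w, w', φ', ψ', d', g', hφ', hψ', rfl⟩
    exact (entropySum_congr hφ hψ hφ' hψ').le

/-- Lower bounds for the relative entropy only have to be checked when the kernel condition
holds and `D` has an eigenbasis. -/
theorem le_relEntropy {D G : E →L[ℂ] E} {S : ℝ≥0∞} {κ : Type*} {ψ : HilbertBasis κ ℂ E}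
    {g : κ → ℝ} (hψ : IsEigenbasis G ψ g)
    (h : LinearMap.ker (G : E →ₗ[ℂ] E) ≤ LinearMap.ker (D : E →ₗ[ℂ] E) →
      ∀ (w : Set E) (φ : HilbertBasis w ℂ E) (d : w → ℝ), IsEigenbasis D φ d →
        S ≤ entropySum φ ψ d g) : S ≤ relEntropy D G := by
  rw [relEntropy]
  split_ifs with hk
  · refine le_sInf ?_
    rintro S ⟨w, w', φ', ψ', d', g', hφ', hψ', rfl⟩
    exact (h hk w φ' d' hφ').trans (entropySum_congr hφ' hψ hφ' hψ').le
  · exact le_top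

end RelEntropy

/-! ### Hilbert space tensor products and partial traces. -/

section Tensor

variable {E₁ E₂ E : Type*} [NormedAddCommGroup E₁] [InnerProductSpace ℂ E₁]
  [NormedAddCommGroup E₂] [InnerProductSpace ℂ E₂]
  [NormedAddCommGroup E] [InnerProductSpace ℂ E]

/-- The bilinear map `m` identifies `E` with the Hilbert space tensor product of `E₁` and `E₂`. -/
structure IsTensor (m : E₁ →L[ℂ] E₂ →L[ℂ] E) : Prop where
  inner_map : ∀ ξ η ξ' η', ⟪m ξ η, m ξ' η'⟫_ℂ = ⟪ξ, ξ'⟫_ℂ * ⟪η, η'⟫_ℂ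
  eq_zero : ∀ x, (∀ ξ η, ⟪m ξ η, x⟫_ℂ = 0) → x = 0

theorem IsTensor.flip {m : E₁ →L[ℂ] E₂ →L[ℂ] E} (hm : IsTensor m) : IsTensor m.flip where
  inner_map ξ η ξ' η' := by
    rw [ContinuousLinearMap.flip_apply, ContinuousLinearMap.flip_apply, hm.inner_map, mul_comm]
  eq_zero x hx := hm.eq_zero x fun ξ η => hx η ξ

/-- `D₁` is the partial trace of `D` over the second factor. -/
def IsPartialTrace (m : E₁ →L[ℂ] E₂ →L[ℂ] E) (D : E →L[ℂ] E) (D₁ : E₁ →L[ℂ] E₁) : Prop :=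
  ∀ (ξ ξ' : E₁) (w : Set E₂) (b : HilbertBasis w ℂ E₂),
    HasSum (fun i => ⟪m ξ (b i), D (m ξ' (b i))⟫_ℂ) ⟪ξ, D₁ ξ'⟫_ℂ

variable [CompleteSpace E₁] [CompleteSpace E₂] [CompleteSpace E]

theorem IsTensor.ext_basis {m : E₁ →L[ℂ] E₂ →L[ℂ] E} (hm : IsTensor m) {ι₁ ι₂ : Type*}
    (b₁ : HilbertBasis ι₁ ℂ E₁) (b₂ : HilbertBasis ι₂ ℂ E₂) {x : E}
    (hx : ∀ i j, ⟪m (b₁ i) (b₂ j), x⟫_ℂ = 0) : x = 0 := by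
  refine hm.eq_zero x fun ξ η => ?_
  have h1 : ∀ i, ⟪m (b₁ i) η, x⟫_ℂ = 0 := by
    intro i
    rw [← ContinuousLinearMap.adjoint_inner_right,
      HilbertBasis.ext_inner b₂ (x := (m (b₁ i)).adjoint x) (y := 0) fun j => by
        rw [ContinuousLinearMap.adjoint_inner_right, hx, inner_zero_right], inner_zero_right]
  change ⟪m.flip η ξ, x⟫_ℂ = 0
  rw [← ContinuousLinearMap.adjoint_inner_right,
      HilbertBasis.ext_inner b₁ (x := (m.flip η).adjoint x) (y := 0) fun j => by
        rw [ContinuousLinearMap.adjoint_inner_right, ContinuousLinearMap.flip_apply, h1,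
          inner_zero_right], inner_zero_right]

theorem IsTensor.orthonormal {m : E₁ →L[ℂ] E₂ →L[ℂ] E} (hm : IsTensor m) {ι₁ ι₂ : Type*}
    {b₁ : ι₁ → E₁} {b₂ : ι₂ → E₂} (h₁ : Orthonormal ℂ b₁) (h₂ : Orthonormal ℂ b₂) :
    Orthonormal ℂ fun p : ι₁ × ι₂ => m (b₁ p.1) (b₂ p.2) := by
  classical
  rw [orthonormal_iff_ite] at *
  rintro ⟨i, j⟩ ⟨i', j'⟩
  rw [hm.inner_map, h₁, h₂]
  simp only [Prod.mk.injEq]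
  split_ifs <;> simp_all

/-- The product basis. -/
noncomputable def IsTensor.basis {m : E₁ →L[ℂ] E₂ →L[ℂ] E} (hm : IsTensor m) {ι₁ ι₂ : Type*}
    (b₁ : HilbertBasis ι₁ ℂ E₁) (b₂ : HilbertBasis ι₂ ℂ E₂) : HilbertBasis (ι₁ × ι₂) ℂ E :=
  HilbertBasis.mkOfOrthogonalEqBot (hm.orthonormal b₁.orthonormal b₂.orthonormal) (by
    rw [eq_bot_iff]
    intro x hx
    rw [Submodule.mem_orthogonal] at hx
    exact hm.ext_basis b₁ b₂ fun i j => hx _ (Submodule.subset_span ⟨(i, j), rfl⟩))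

theorem IsTensor.basis_apply {m : E₁ →L[ℂ] E₂ →L[ℂ] E} (hm : IsTensor m) {ι₁ ι₂ : Type*}
    (b₁ : HilbertBasis ι₁ ℂ E₁) (b₂ : HilbertBasis ι₂ ℂ E₂) (p : ι₁ × ι₂) :
    hm.basis b₁ b₂ p = m (b₁ p.1) (b₂ p.2) := by
  rw [IsTensor.basis, HilbertBasis.coe_mkOfOrthogonalEqBot]

theorem IsPartialTrace.hasSum {m : E₁ →L[ℂ] E₂ →L[ℂ] E} {D : E →L[ℂ] E} {D₁ : E₁ →L[ℂ] E₁}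
    (h : IsPartialTrace m D D₁) (ξ ξ' : E₁) {ι : Type*} (b : HilbertBasis ι ℂ E₂) :
    HasSum (fun i => ⟪m ξ (b i), D (m ξ' (b i))⟫_ℂ) ⟪ξ, D₁ ξ'⟫_ℂ := by
  have := (HilbertBasis.equivRange b).hasSum_iff.2 (h ξ ξ' _ (HilbertBasis.toRange b))
  simpa only [Function.comp_def, HilbertBasis.toRange_equivRange] using this

theorem IsPartialTrace.apply_eq_zero {m : E₁ →L[ℂ] E₂ →L[ℂ] E} {D : E →L[ℂ] E}
    {D₁ : E₁ →L[ℂ] E₁} (h : IsPartialTrace m D D₁) {ξ : E₁} (hξ : ∀ η, D (m ξ η) = 0) :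
    D₁ ξ = 0 := by
  obtain ⟨w, b, -⟩ := exists_hilbertBasis ℂ E₂
  refine ext_inner_left ℂ fun u => ?_
  rw [inner_zero_right]
  refine (h.hasSum u ξ b).unique ?_
  simp [hξ]

/-- Trace class operators have partial traces. -/
theorem IsTensor.exists_isPartialTrace {m : E₁ →L[ℂ] E₂ →L[ℂ] E} (hm : IsTensor m)
    {κ : Type*} {x : κ → E} {D : E →L[ℂ] E} (hD : HasGram x D) :
    ∃ (D₁ : E₁ →L[ℂ] E₁) (w : Set E₂) (y : κ × w → E₁), IsPartialTrace m D D₁ ∧ HasGram y D₁ ∧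
      ∑' p, ‖y p‖ ^ 2 = ∑' k, ‖x k‖ ^ 2 := by
  obtain ⟨w, b, -⟩ := exists_hilbertBasis ℂ E₂
  obtain ⟨w', c, -⟩ := exists_hilbertBasis ℂ E₁
  -- `y (k, i)` is the slice of `x k` along `b i`; the partial trace is the sum of the rank one
  -- operators of all slices.
  let y : κ × w → E₁ := fun p => (m.flip (b p.2)).adjoint (x p.1)
  have hy : ∀ ξ p, ⟪ξ, y p⟫_ℂ = ⟪m ξ (b p.2), x p.1⟫_ℂ := fun ξ p => by
    rw [ContinuousLinearMap.adjoint_inner_right, ContinuousLinearMap.flip_apply]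
  have hk : ∀ k, HasSum (fun i => ‖y (k, i)‖ ^ 2) (‖x k‖ ^ 2) := by
    intro k
    refine (HilbertBasis.hasSum_norm_sq (hm.flip.basis b c) (x k)).prod_fiberwise fun i => ?_
    simp only [IsTensor.basis_apply, ContinuousLinearMap.flip_apply]
    simpa only [hy] using HilbertBasis.hasSum_norm_sq c (y (k, i))
  have hS : Summable fun p => ‖y p‖ ^ 2 := by
    refine (summable_prod_of_nonneg fun p => by positivity).2 ⟨fun k => (hk k).summable, ?_⟩
    simp only [(hk _).tsum_eq]
    exact hD.summable
  obtain ⟨D₁, hD₁⟩ := exists_hasGram hS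
  refine ⟨D₁, w, y, fun ξ ξ' w' b' => ?_, hD₁, ?_⟩
  -- The slices were cut with the basis `b`, whereas the partial trace must be correct for every
  -- `b'`. Both sums have the basis-free value given by `hasSum_inner_map`.
  · have h1 := hD.hasSum_inner_map (m ξ) (m ξ') b
    have h2 : HasSum (fun i => ⟪m ξ (b i), D (m ξ' (b i))⟫_ℂ) ⟪ξ, D₁ ξ'⟫_ℂ := by
      refine ((Equiv.prodComm κ w).symm.hasSum_iff.2 (hD₁.hasSum ξ ξ')).prod_fiberwise
        fun i => ?_
      have h3 := hD.hasSum (m ξ (b i)) (m ξ' (b i))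
      have h4 : ∀ ξ p, ⟪y p, ξ⟫_ℂ = ⟪x p.1, m ξ (b p.2)⟫_ℂ := fun ξ p => by
        rw [← inner_conj_symm, hy, inner_conj_symm]
      simp only [Function.comp_apply, hy, h4]
      exact h3
    rw [h2.unique h1]
    exact hD.hasSum_inner_map (m ξ) (m ξ') b'
  · rw [hS.tsum_prod]
    simp only [(hk _).tsum_eq]

theorem IsPartialTrace.unique {m : E₁ →L[ℂ] E₂ →L[ℂ] E} {D : E →L[ℂ] E}
    {D₁ D₁' : E₁ →L[ℂ] E₁} (h : IsPartialTrace m D D₁) (h' : IsPartialTrace m D D₁') :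
    D₁ = D₁' := by
  obtain ⟨w, b, -⟩ := exists_hilbertBasis ℂ E₂
  ext ξ
  exact ext_inner_left ℂ fun u => (h u ξ w b).unique (h' u ξ w b)

/-- `Tr (D (B ⊗ 1)) = Tr (D₁ B)`: evaluate the left trace in a product basis and sum over the second
index first. This identifies the trace in one basis of `E₁` only; `HasGram` supplies the
independence of the basis. -/
theorem IsPartialTrace.hasTrace_comp {m : E₁ →L[ℂ] E₂ →L[ℂ] E} (hm : IsTensor m) {D : E →L[ℂ] E}
    {D₁ : E₁ →L[ℂ] E₁} (h : IsPartialTrace m D D₁) {κ : Type*} {y : κ → E₁} (hy : HasGram y D₁)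
    {B : E₁ →L[ℂ] E₁} {B' : E →L[ℂ] E} (hB : ∀ ξ η, B' (m ξ η) = m (B ξ) η) {z : ℂ}
    (hz : HasTrace (D ∘L B') z) : HasTrace (D₁ ∘L B) z := by
  obtain ⟨w, b, -⟩ := exists_hilbertBasis ℂ E₂
  obtain ⟨w', c, -⟩ := exists_hilbertBasis ℂ E₁
  have h1 : HasSum (fun a => ⟪c a, D₁ (B (c a))⟫_ℂ) z := by
    refine (hasTrace_apply hz (hm.basis c b)).prod_fiberwise fun a => ?_
    simpa only [IsTensor.basis_apply, ContinuousLinearMap.comp_apply, hB] using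
      h.hasSum (c a) (B (c a)) b
  have h2 := hy.hasTrace_comp B
  rwa [(h2 w' c).unique h1] at h2

end Tensor

/-! ### Compressions to finitely many vectors of a basis. -/

section Compression

variable {E : Type*} [NormedAddCommGroup E] [InnerProductSpace ℂ E]

/-- The projection onto the span of the `ψ k`, `k ∈ K`. -/
noncomputable def basisProj {ι : Type*} (ψ : HilbertBasis ι ℂ E) (K : Finset ι) : E →L[ℂ] E :=
  ∑ k ∈ K, InnerProductSpace.rankOne ℂ (ψ k) (ψ k)

theorem basisProj_apply {ι : Type*} (ψ : HilbertBasis ι ℂ E) (K : Finset ι) (x : E) :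
    basisProj ψ K x = ∑ k ∈ K, ⟪ψ k, x⟫_ℂ • ψ k := by
  simp [basisProj, sum_apply]

theorem inner_basisProj {ι : Type*} [DecidableEq ι] (ψ : HilbertBasis ι ℂ E) (K : Finset ι) (x : E)
    (i : ι) : ⟪ψ i, basisProj ψ K x⟫_ℂ = if i ∈ K then ⟪ψ i, x⟫_ℂ else 0 := by
  have h := orthonormal_iff_ite.1 ψ.orthonormal
  simp [basisProj_apply, h]

theorem norm_basisProj_le {ι : Type*} (ψ : HilbertBasis ι ℂ E) (K : Finset ι) (x : E) :
    ‖basisProj ψ K x‖ ≤ ‖x‖ := by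
  classical
  rw [← sq_le_sq₀ (norm_nonneg _) (norm_nonneg _)]
  refine hasSum_le (fun i => ?_) (HilbertBasis.hasSum_norm_sq ψ _)
    (HilbertBasis.hasSum_norm_sq ψ x)
  rw [inner_basisProj]
  split_ifs <;> simp

theorem tendsto_basisProj {ι : Type*} (ψ : HilbertBasis ι ℂ E) (x : E) :
    Filter.Tendsto (fun K => basisProj ψ K x) Filter.atTop (nhds x) := by
  have h := ψ.hasSum_repr x
  simp only [ψ.repr_apply_apply] at h
  simp only [basisProj_apply]
  exact h

/-- The compression of `T` to the span of the `ψ k`, `k ∈ K`. -/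
noncomputable def compress {ι : Type*} (ψ : HilbertBasis ι ℂ E) (K : Finset ι) (T : E →L[ℂ] E) :
    E →L[ℂ] E :=
  basisProj ψ K ∘L T ∘L basisProj ψ K

theorem compress_apply {ι : Type*} (ψ : HilbertBasis ι ℂ E) (K : Finset ι) (T : E →L[ℂ] E) (x : E) :
    compress ψ K T x = basisProj ψ K (T (basisProj ψ K x)) := rfl

/-- The projections are contractions that converge strongly to the identity, so they may also be
applied to a convergent net of vectors. This uniform bound is what lets powers of the compression
converge. -/
theorem tendsto_compress {ι : Type*} (ψ : HilbertBasis ι ℂ E) (T : E →L[ℂ] E) {y : Finset ι → E}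
    {x : E} (hy : Filter.Tendsto y Filter.atTop (nhds x)) :
    Filter.Tendsto (fun K => compress ψ K T (y K)) Filter.atTop (nhds (T x)) := by
  have h1 : ∀ {y : Finset ι → E} {x : E}, Filter.Tendsto y Filter.atTop (nhds x) →
      Filter.Tendsto (fun K => basisProj ψ K (y K)) Filter.atTop (nhds x) := by
    intro y x hy
    have h2 : Filter.Tendsto (fun K => basisProj ψ K (y K - x)) Filter.atTop (nhds 0) := by
      refine squeeze_zero_norm (fun K => norm_basisProj_le ψ K _) ?_
      simpa using (hy.sub_const x).norm
    simpa using h2.add (tendsto_basisProj ψ x)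
  exact h1 ((T.continuous.tendsto x).comp (h1 hy))

theorem tendsto_compress_pow {ι : Type*} (ψ : HilbertBasis ι ℂ E) (T : E →L[ℂ] E) (x : E) (n : ℕ) :
    Filter.Tendsto (fun K => (compress ψ K T ^ n) x) Filter.atTop (nhds ((T ^ n) x)) := by
  induction n with
  | zero => simp
  | succ n ih =>
    simp only [pow_succ', mul_apply_eq_comp]
    exact tendsto_compress ψ T ih

/-- The compression of a positive operator to a finite part of a Hilbert basis is diagonal in a
basis that agrees with the given one outside of this part. -/
theorem exists_trial_basis [CompleteSpace E] {T : E →L[ℂ] E} (hT : T.IsPositive) {ι : Type*}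
    (ψ : HilbertBasis ι ℂ E) (K : Finset ι) :
    ∃ (χ : HilbertBasis ι ℂ E) (u : ι → ℝ), IsEigenbasis (compress ψ K T) χ u ∧
      (∀ l ∉ K, χ l = ψ l) ∧ (∀ l ∈ K, basisProj ψ K (χ l) = χ l) ∧
      ∀ v, ∑ l ∈ K, ‖⟪χ l, v⟫_ℂ‖ ^ 2 = ∑ l ∈ K, ‖⟪ψ l, v⟫_ℂ‖ ^ 2 := by
  classical
  -- The compression is the Hermitian matrix `M` on the span of the `ψ k`, `k ∈ K`, and zero
  -- elsewhere. Its eigenvectors, read as coefficient vectors, replace the `ψ k` with `k ∈ K`.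
  let M : Matrix K K ℂ := Matrix.of fun k l => ⟪ψ k, T (ψ l)⟫_ℂ
  have hM : M.IsHermitian := by
    ext k l
    simp only [M, Matrix.conjTranspose_apply, Matrix.of_apply, RCLike.star_def, inner_conj_symm]
    exact hT.inner_left_eq_inner_right _ _
  let e := hM.eigenvectorBasis
  let χ : ι → E := fun l => if h : l ∈ K then ∑ k : K, e ⟨l, h⟩ k • ψ k else ψ l
  have hψ := orthonormal_iff_ite.1 ψ.orthonormal
  have hχK : ∀ l : K, χ l = ∑ k : K, e l k • ψ k := fun l => by simp [χ]
  have hχ : ∀ l ∉ K, χ l = ψ l := fun l hl => by simp [χ, hl]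
  have hin : ∀ (l : K) (v : E), ⟪χ l, v⟫_ℂ = ⟪e l, WithLp.toLp 2 fun k : K => ⟪ψ k, v⟫_ℂ⟫_ℂ := by
    intro l v
    rw [hχK, PiLp.inner_apply, sum_inner]
    refine Finset.sum_congr rfl fun k _ => ?_
    rw [inner_smul_left, RCLike.inner_apply']
  have hψχ : ∀ (l : K) (i : ι), ⟪ψ i, χ l⟫_ℂ = if h : i ∈ K then e l ⟨i, h⟩ else 0 := by
    intro l i
    rw [hχK, inner_sum]
    simp only [inner_smul_right, hψ]
    split_ifs with h
    · rw [Finset.sum_eq_single (⟨i, h⟩ : K)]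
      · simp
      · intro k _ hk
        rw [if_neg fun h' => hk (Subtype.ext h'.symm), mul_zero]
      · simp
    · refine Finset.sum_eq_zero fun k _ => ?_
      rw [if_neg fun h' : i = k => h (h' ▸ k.2), mul_zero]
  have horth : Orthonormal ℂ χ := by
    rw [orthonormal_iff_ite]
    intro i j
    by_cases hi : i ∈ K <;> by_cases hj : j ∈ K
    · rw [hin ⟨i, hi⟩]
      have : (WithLp.toLp 2 fun k : K => ⟪ψ k, χ j⟫_ℂ) = e ⟨j, hj⟩ := by
        ext k
        simp [hψχ ⟨j, hj⟩]
      rw [this, orthonormal_iff_ite.1 e.orthonormal]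
      simp [Subtype.ext_iff]
    · rw [hχ j hj, ← inner_conj_symm, hψχ ⟨i, hi⟩, dif_neg hj,
        if_neg fun h : i = j => hj (h ▸ hi), map_zero]
    · rw [hχ i hi, hψχ ⟨j, hj⟩, dif_neg hi, if_neg fun h : i = j => hi (h ▸ hj)]
    · rw [hχ i hi, hχ j hj, hψ]
  have hsum : ∀ v, ∑ l ∈ K, ‖⟪χ l, v⟫_ℂ‖ ^ 2 = ∑ l ∈ K, ‖⟪ψ l, v⟫_ℂ‖ ^ 2 := by
    intro v
    rw [← Finset.sum_coe_sort K, ← Finset.sum_coe_sort K]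
    simp only [hin]
    rw [e.sum_sq_norm_inner_right, EuclideanSpace.norm_sq_eq]
  -- A vector orthogonal to all `χ l` is orthogonal to `ψ l` for `l ∉ K` since these vectors agree,
  -- and for `l ∈ K` since the sums of squares agree.
  have hbot : (Submodule.span ℂ (Set.range χ))ᗮ = ⊥ := by
    rw [eq_bot_iff]
    intro x hx
    rw [Submodule.mem_orthogonal] at hx
    have h0 : ∀ l, ⟪χ l, x⟫_ℂ = 0 := fun l => hx _ (Submodule.subset_span ⟨l, rfl⟩)
    refine HilbertBasis.ext_inner ψ (y := 0) fun i => ?_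
    rw [inner_zero_right]
    by_cases hi : i ∈ K
    · have h1 := hsum x
      simp only [h0, norm_zero] at h1
      have h2 := (Finset.sum_eq_zero_iff_of_nonneg fun i _ => by positivity).1
        (h1.symm.trans (by simp)) i hi
      simpa using h2
    · rw [← hχ i hi, h0]
  have hproj : ∀ l : K, basisProj ψ K (χ l) = χ l := by
    intro l
    refine HilbertBasis.ext_inner ψ fun i => ?_
    rw [inner_basisProj, hψχ]
    split_ifs <;> rfl
  refine ⟨HilbertBasis.mkOfOrthogonalEqBot horth hbot,
    fun l => if h : l ∈ K then hM.eigenvalues ⟨l, h⟩ else 0, ?_, ?_, ?_, ?_⟩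
  · intro l
    rw [HilbertBasis.coe_mkOfOrthogonalEqBot]
    dsimp only
    by_cases hl : l ∈ K
    · refine HilbertBasis.ext_inner ψ fun i => ?_
      rw [compress_apply, hproj ⟨l, hl⟩, inner_basisProj, dif_pos hl, inner_smul_right,
        hψχ ⟨l, hl⟩]
      split_ifs with hi
      · have h1 := congrFun (hM.mulVec_eigenvectorBasis ⟨l, hl⟩) ⟨i, hi⟩
        simp only [Matrix.mulVec, dotProduct, M, Matrix.of_apply, Pi.smul_apply] at h1
        rw [hχK ⟨l, hl⟩, map_sum, inner_sum]
        simp only [map_smul, inner_smul_right]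
        refine (Finset.sum_congr rfl fun k _ => mul_comm _ _).trans (h1.trans ?_)
        simp [e]
      · simp
    · have : basisProj ψ K (ψ l) = 0 := by
        refine HilbertBasis.ext_inner ψ fun i => ?_
        rw [inner_basisProj, inner_zero_right, hψ]
        split_ifs with h1 h2
        · exact absurd (h2 ▸ h1) hl
        · rfl
        · rfl
      rw [compress_apply, hχ l hl, this, dif_neg hl]
      simp
  · rwa [HilbertBasis.coe_mkOfOrthogonalEqBot]
  · rw [HilbertBasis.coe_mkOfOrthogonalEqBot]
    exact fun l hl => hproj ⟨l, hl⟩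
  · rwa [HilbertBasis.coe_mkOfOrthogonalEqBot]

end Compression

/-! ### Quadratic forms of functions of a diagonal operator, and their limits. -/

section Quad

variable {E : Type*} [NormedAddCommGroup E] [InnerProductSpace ℂ E]

/-- The quadratic form with eigenbasis `φ` and eigenvalues `c`. -/
noncomputable def quad {ι : Type*} (φ : HilbertBasis ι ℂ E) (c : ι → ℝ) (x : E) : ℝ :=
  ∑' j, c j * ‖⟪φ j, x⟫_ℂ‖ ^ 2

theorem hasSum_quad {ι : Type*} (φ : HilbertBasis ι ℂ E) {c : ι → ℝ} {C : ℝ} (hc : ∀ j, |c j| ≤ C)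
    (x : E) : HasSum (fun j => c j * ‖⟪φ j, x⟫_ℂ‖ ^ 2) (quad φ c x) := by
  refine Summable.hasSum (Summable.of_norm_bounded
    ((HilbertBasis.hasSum_norm_sq φ x).summable.mul_left C) fun j => ?_)
  rw [norm_mul, Real.norm_eq_abs, Real.norm_of_nonneg (by positivity)]
  gcongr
  exact hc j

theorem quad_of_isEigenbasis {T : E →L[ℂ] E} {ι : Type*} {φ : HilbertBasis ι ℂ E} {d : ι → ℝ}
    (h : IsEigenbasis T φ d) (x : E) (n : ℕ) :
    HasSum (fun j => d j ^ n * ‖⟪φ j, x⟫_ℂ‖ ^ 2) (⟪x, (T ^ n) x⟫_ℂ).re := by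
  have hn : ∀ j, ⟪φ j, (T ^ n) x⟫_ℂ = (d j : ℂ) ^ n * ⟪φ j, x⟫_ℂ := by
    intro j
    induction n with
    | zero => simp
    | succ n ih =>
      rw [pow_succ', mul_apply_eq_comp, inner_apply_of_isEigenbasis h, ih]
      ring
  have h1 : HasSum (fun j => (⟪x, φ j⟫_ℂ * ⟪φ j, (T ^ n) x⟫_ℂ).re) (⟪x, (T ^ n) x⟫_ℂ).re :=
    (φ.hasSum_inner_mul_inner x ((T ^ n) x)).mapL Complex.reCLM
  convert h1 using 2 with j
  rw [hn, mul_left_comm, ← inner_conj_symm x (φ j), Complex.conj_mul', ← Complex.ofReal_pow,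
    ← Complex.ofReal_pow, ← Complex.ofReal_mul]
  exact (Complex.ofReal_re _).symm

theorem quad_eq_inner {T : E →L[ℂ] E} {ι : Type*} {φ : HilbertBasis ι ℂ E} {d : ι → ℝ}
    (h : IsEigenbasis T φ d) (x : E) : quad φ d x = (⟪x, T x⟫_ℂ).re := by
  rw [quad]
  simpa using (quad_of_isEigenbasis h x 1).tsum_eq

theorem abs_quad_le {ι : Type*} (φ : HilbertBasis ι ℂ E) {c : ι → ℝ} {C : ℝ} (hc : ∀ j, |c j| ≤ C)
    (x : E) : |quad φ c x| ≤ C * ‖x‖ ^ 2 := by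
  rw [← Real.norm_eq_abs, quad]
  refine tsum_of_norm_bounded ((HilbertBasis.hasSum_norm_sq φ x).mul_left C) fun j => ?_
  rw [norm_mul, Real.norm_eq_abs, Real.norm_of_nonneg (by positivity)]
  gcongr
  exact hc j

theorem quad_sub {ι : Type*} (φ : HilbertBasis ι ℂ E) {c c' : ι → ℝ} {C C' : ℝ}
    (hc : ∀ j, |c j| ≤ C) (hc' : ∀ j, |c' j| ≤ C') (x : E) :
    quad φ (fun j => c j - c' j) x = quad φ c x - quad φ c' x := by
  refine HasSum.tsum_eq ?_
  simpa only [sub_mul] using (hasSum_quad φ hc x).sub (hasSum_quad φ hc' x)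

theorem exists_bound_Icc {f : ℝ → ℝ} (hf : Continuous f) :
    ∃ C, ∀ t ∈ Set.Icc (0 : ℝ) 1, |f t| ≤ C :=
  isCompact_Icc.exists_bound_of_continuousOn hf.continuousOn

theorem quad_polynomial {T : E →L[ℂ] E} {ι : Type*} {φ : HilbertBasis ι ℂ E} {d : ι → ℝ}
    (h : IsEigenbasis T φ d) (p : Polynomial ℝ) (x : E) : quad φ (fun j => p.eval (d j)) x =
      ∑ n ∈ Finset.range (p.natDegree + 1), p.coeff n * (⟪x, (T ^ n) x⟫_ℂ).re := by
  have h1 := hasSum_sum (s := Finset.range (p.natDegree + 1)) fun n _ =>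
    (quad_of_isEigenbasis h x n).mul_left (p.coeff n)
  rw [← h1.tsum_eq]
  refine tsum_congr fun j => ?_
  dsimp only
  rw [Polynomial.eval_eq_sum_range, Finset.sum_mul]
  exact Finset.sum_congr rfl fun n _ => by ring

/-- Strong convergence of the powers of operators implies the convergence of the quadratic forms of
continuous functions of these operators. -/
theorem tendsto_quad {α : Type*} {l : Filter α} {T : α → E →L[ℂ] E} {T' : E →L[ℂ] E}
    {ι ι' : Type*} {b : α → HilbertBasis ι ℂ E} {c : α → ι → ℝ} {φ : HilbertBasis ι' ℂ E}
    {d : ι' → ℝ} (hb : ∀ a, IsEigenbasis (T a) (b a) (c a)) (hφ : IsEigenbasis T' φ d)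
    (hc : ∀ a j, c a j ∈ Set.Icc (0 : ℝ) 1) (hd : ∀ j, d j ∈ Set.Icc (0 : ℝ) 1) (x : E)
    (hT : ∀ n : ℕ, Filter.Tendsto (fun a => (T a ^ n) x) l (nhds ((T' ^ n) x)))
    {f : ℝ → ℝ} (hf : Continuous f) :
    Filter.Tendsto (fun a => quad (b a) (fun j => f (c a j)) x) l
      (nhds (quad φ (fun j => f (d j)) x)) := by
  obtain ⟨C, hC⟩ := exists_bound_Icc hf
  rw [Metric.tendsto_nhds]
  intro ε hε
  -- The accuracy of the Weierstrass approximation is chosen such that, multiplied by `‖x‖²`, it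
  -- stays below `ε / 3`. For polynomials the claim is the convergence of powers in `hT`.
  have hδ : 0 < ε / (3 * (‖x‖ ^ 2 + 1)) := by positivity
  obtain ⟨p, hp⟩ := exists_polynomial_near_of_continuousOn 0 1 f hf.continuousOn _ hδ
  obtain ⟨C', hC'⟩ := exists_bound_Icc p.continuous
  have hsmall : ε / (3 * (‖x‖ ^ 2 + 1)) * ‖x‖ ^ 2 < ε / 3 := by
    rw [div_mul_eq_mul_div, div_lt_div_iff₀ (by positivity) (by positivity)]
    nlinarith [sq_nonneg ‖x‖]
  have h1 : ∀ a, |quad (b a) (fun j => p.eval (c a j)) x - quad (b a) (fun j => f (c a j)) x| <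
      ε / 3 := by
    intro a
    rw [← quad_sub (b a) (fun j => hC' _ (hc a j)) (fun j => hC _ (hc a j))]
    exact (abs_quad_le (b a) (fun j => (hp _ (hc a j)).le) x).trans_lt hsmall
  have h2 : |quad φ (fun j => p.eval (d j)) x - quad φ (fun j => f (d j)) x| < ε / 3 := by
    rw [← quad_sub φ (fun j => hC' _ (hd j)) (fun j => hC _ (hd j))]
    exact (abs_quad_le φ (fun j => (hp _ (hd j)).le) x).trans_lt hsmall
  have h3 : Filter.Tendsto (fun a => quad (b a) (fun j => p.eval (c a j)) x) l
      (nhds (quad φ (fun j => p.eval (d j)) x)) := by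
    rw [quad_polynomial hφ]
    simp only [fun a => quad_polynomial (hb a) p x]
    refine tendsto_finsetSum _ fun n _ => Filter.Tendsto.const_mul _ ?_
    exact (Complex.continuous_re.tendsto _).comp (Filter.Tendsto.inner tendsto_const_nhds (hT n))
  filter_upwards [Metric.tendsto_nhds.1 h3 (ε / 3) (by positivity)] with a ha
  rw [Real.dist_eq] at ha ⊢
  have h1 := abs_lt.1 (h1 a)
  have h2 := abs_lt.1 h2
  have ha := abs_lt.1 ha
  rw [abs_lt]
  constructor <;> linarith

end Quad

/-! ### The entropy summand as a quadratic form, and changes of basis in finitely many directions.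
-/

section EntropyForm

variable {E : Type*} [NormedAddCommGroup E] [InnerProductSpace ℂ E]

theorem continuous_entropyTerm (y : ℝ) : Continuous fun x => entropyTerm x y := by
  have := Real.continuous_mul_log
  unfold entropyTerm
  fun_prop

/-- This is `log t ≤ t - 1` at `t = y / x`, multiplied by `x`. -/
theorem entropyTerm_nonneg {x y : ℝ} (hx : 0 ≤ x) (hy : 0 < y) : 0 ≤ entropyTerm x y := by
  rcases hx.eq_or_lt with rfl | hx
  · simpa [entropyTerm] using hy.le
  have h := Real.log_le_sub_one_of_pos (div_pos hy hx)
  rw [Real.log_div hy.ne' hx.ne'] at h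
  have h2 := mul_le_mul_of_nonneg_left h hx.le
  rw [mul_sub, mul_sub, mul_div_cancel₀ _ hx.ne'] at h2
  unfold entropyTerm
  linarith

theorem abs_le_one_of_mem_Icc {t : ℝ} (h : t ∈ Set.Icc (0 : ℝ) 1) : |t| ≤ 1 :=
  abs_le.2 ⟨by linarith [h.1], h.2⟩

theorem quad_nonneg {ι : Type*} (φ : HilbertBasis ι ℂ E) {c : ι → ℝ} (hc : ∀ j, 0 ≤ c j) (x : E) :
    0 ≤ quad φ c x :=
  tsum_nonneg fun j => mul_nonneg (hc j) (by positivity)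

theorem mul_norm_sq_eq_zero_of_quad {ι : Type*} {φ : HilbertBasis ι ℂ E} {d : ι → ℝ}
    (hd : ∀ j, d j ∈ Set.Icc (0 : ℝ) 1) {x : E} (hx : quad φ d x = 0) (j : ι) :
    d j * ‖⟪φ j, x⟫_ℂ‖ ^ 2 = 0 := by
  have h := hasSum_quad φ (fun j => abs_le_one_of_mem_Icc (hd j)) x
  rw [hx] at h
  exact congrFun ((hasSum_zero_iff_of_nonneg fun j =>
    mul_nonneg (hd j).1 (by positivity)).1 h) j

theorem quad_entropyTerm {ι : Type*} (φ : HilbertBasis ι ℂ E) {d : ι → ℝ}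
    (hd : ∀ j, d j ∈ Set.Icc (0 : ℝ) 1) (x : E) (y : ℝ) :
    quad φ (fun j => entropyTerm (d j) y) x =
      quad φ (fun j => d j * Real.log (d j)) x - quad φ d x * Real.log y + y * ‖x‖ ^ 2 -
        quad φ d x := by
  obtain ⟨C, hC⟩ := exists_bound_Icc Real.continuous_mul_log
  have h1 := hasSum_quad φ (fun j => hC _ (hd j)) x
  have h2 := hasSum_quad φ (fun j => abs_le_one_of_mem_Icc (hd j)) x
  have h3 := (HilbertBasis.hasSum_norm_sq φ x).mul_left y
  have h4 := ((h1.sub (h2.mul_right (Real.log y))).add h3).sub h2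
  rw [← h4.tsum_eq, quad]
  refine tsum_congr fun j => ?_
  unfold entropyTerm
  ring

/-- At `y = 0` the convention `Real.log 0 = 0` makes `entropyTerm` equal to `x log x - x`, which is
negative on `(0, 1]`. The kernel condition `h0` excludes this: each `j` then has `d j = 0` or `φ j`
orthogonal to `x`. -/
theorem entropyTerm_mul_nonneg {ι : Type*} {φ : HilbertBasis ι ℂ E} {d : ι → ℝ}
    (hd : ∀ j, d j ∈ Set.Icc (0 : ℝ) 1) {x : E} {y : ℝ} (hy : 0 ≤ y)
    (h0 : y = 0 → quad φ d x = 0) (j : ι) : 0 ≤ entropyTerm (d j) y * ‖⟪φ j, x⟫_ℂ‖ ^ 2 := by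
  rcases hy.eq_or_lt with rfl | hy
  · rcases mul_eq_zero.1 (mul_norm_sq_eq_zero_of_quad hd (h0 rfl) j) with h | h
    · simp [entropyTerm, h]
    · simp [h]
  · exact mul_nonneg (entropyTerm_nonneg (hd j).1 hy) (by positivity)

theorem quad_entropyTerm_nonneg {ι : Type*} {φ : HilbertBasis ι ℂ E} {d : ι → ℝ}
    (hd : ∀ j, d j ∈ Set.Icc (0 : ℝ) 1) {x : E} {y : ℝ} (hy : 0 ≤ y)
    (h0 : y = 0 → quad φ d x = 0) : 0 ≤ quad φ (fun j => entropyTerm (d j) y) x :=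
  tsum_nonneg fun j => entropyTerm_mul_nonneg hd hy h0 j

/-- The sum over `j` is carried out inside `ENNReal.ofReal`, which is legitimate because the kernel
condition makes all terms nonnegative. -/
theorem entropySum_eq_tsum_quad [CompleteSpace E] {ι κ : Type*} {φ : HilbertBasis ι ℂ E}
    {ψ : HilbertBasis κ ℂ E} {d : ι → ℝ} {g : κ → ℝ} (hd : ∀ j, d j ∈ Set.Icc (0 : ℝ) 1)
    (hg : ∀ k, 0 ≤ g k) (h0 : ∀ k, g k = 0 → quad φ d (ψ k) = 0) :
    entropySum φ ψ d g =
      ∑' k, ENNReal.ofReal (quad φ (fun j => entropyTerm (d j) (g k)) (ψ k)) := by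
  rw [entropySum, ENNReal.tsum_comm]
  refine tsum_congr fun k => ?_
  obtain ⟨C, hC⟩ := exists_bound_Icc (continuous_entropyTerm (g k))
  rw [quad, ENNReal.ofReal_tsum_of_nonneg (entropyTerm_mul_nonneg hd (hg k) (h0 k))
    (hasSum_quad φ (fun j => hC _ (hd j)) _).summable]
  simp only [mul_comm]

/-- The basis `χ` arises from `ψ` by a unitary change of the basis vectors with index in `K`. -/
structure IsTrial {ι : Type*} (ψ χ : HilbertBasis ι ℂ E) (K : Finset ι) : Prop where
  eq_of_notMem : ∀ l ∉ K, χ l = ψ l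
  sum_eq : ∀ v, ∑ l ∈ K, ‖⟪χ l, v⟫_ℂ‖ ^ 2 = ∑ l ∈ K, ‖⟪ψ l, v⟫_ℂ‖ ^ 2

/-- Over `K` both sides are the trace of one bounded form over the same finite-dimensional subspace,
computed in two orthonormal bases; over `L \ K` the vectors coincide. -/
theorem IsTrial.sum_quad_map {ι : Type*} {ψ χ : HilbertBasis ι ℂ E} {K : Finset ι}
    (h : IsTrial ψ χ K) {L : Finset ι} (hL : K ⊆ L) {F : Type*} [NormedAddCommGroup F]
    [InnerProductSpace ℂ F] [CompleteSpace E] [CompleteSpace F] (V : E →L[ℂ] F) {κ : Type*}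
    (φ : HilbertBasis κ ℂ F) {c : κ → ℝ} {C : ℝ} (hc : ∀ j, |c j| ≤ C) :
    ∑ l ∈ L, quad φ c (V (χ l)) = ∑ l ∈ L, quad φ c (V (ψ l)) := by
  classical
  rw [← Finset.sum_sdiff hL, ← Finset.sum_sdiff hL]
  congr 1
  · refine Finset.sum_congr rfl fun l hl => ?_
    rw [h.eq_of_notMem l (Finset.mem_sdiff.1 hl).2]
  · have h1 := hasSum_sum (s := K) fun l _ => hasSum_quad φ hc (V (χ l))
    have h2 := hasSum_sum (s := K) fun l _ => hasSum_quad φ hc (V (ψ l))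
    refine h1.unique ?_
    convert h2 using 2 with j
    have e : ∀ x, ‖⟪φ j, V x⟫_ℂ‖ = ‖⟪x, V.adjoint (φ j)⟫_ℂ‖ := fun x => by
      rw [← ContinuousLinearMap.adjoint_inner_left, norm_inner_symm]
    simp only [← Finset.mul_sum, e]
    rw [h.sum_eq]

end EntropyForm

/-! ### Klein's inequality for trial product operators. -/

section Bipartite

variable {E₁ E₂ E : Type*} [NormedAddCommGroup E₁] [InnerProductSpace ℂ E₁]
  [NormedAddCommGroup E₂] [InnerProductSpace ℂ E₂]
  [NormedAddCommGroup E] [InnerProductSpace ℂ E]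

theorem IsTensor.norm_map {m : E₁ →L[ℂ] E₂ →L[ℂ] E} (hm : IsTensor m) (ξ : E₁) (η : E₂) :
    ‖m ξ η‖ = ‖ξ‖ * ‖η‖ := by
  have h := hm.inner_map ξ η ξ η
  rw [inner_self_ofReal, inner_self_ofReal, inner_self_ofReal, ← Complex.ofReal_mul,
    ← mul_pow] at h
  rw [← sq_eq_sq₀ (norm_nonneg _) (by positivity)]
  exact_mod_cast h

/-- The logarithm of the product splits. Where a factor vanishes the splitting fails for `Real.log`,
but then `h₁` or `h₂` makes its coefficient vanish. -/
theorem IsTensor.sum_quad_entropyTerm {m : E₁ →L[ℂ] E₂ →L[ℂ] E} (hm : IsTensor m)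
    {ι ι₁ ι₂ : Type*} (φ : HilbertBasis ι ℂ E) {d : ι → ℝ} (hd : ∀ j, d j ∈ Set.Icc (0 : ℝ) 1)
    {a₁ : ι₁ → E₁} {a₂ : ι₂ → E₂} (ha₁ : ∀ l, ‖a₁ l‖ = 1) (ha₂ : ∀ l, ‖a₂ l‖ = 1)
    {y₁ : ι₁ → ℝ} {y₂ : ι₂ → ℝ} (h₁ : ∀ l l', y₁ l = 0 → quad φ d (m (a₁ l) (a₂ l')) = 0)
    (h₂ : ∀ l l', y₂ l' = 0 → quad φ d (m (a₁ l) (a₂ l')) = 0) (L₁ : Finset ι₁) (L₂ : Finset ι₂) :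
    ∑ p ∈ L₁ ×ˢ L₂, quad φ (fun j => entropyTerm (d j) (y₁ p.1 * y₂ p.2)) (m (a₁ p.1) (a₂ p.2)) =
      (∑ l ∈ L₁, ∑ l' ∈ L₂, quad φ (fun j => d j * Real.log (d j)) (m (a₁ l) (a₂ l'))) -
      (∑ l ∈ L₁, (∑ l' ∈ L₂, quad φ d (m (a₁ l) (a₂ l'))) * Real.log (y₁ l)) -
      (∑ l' ∈ L₂, (∑ l ∈ L₁, quad φ d (m (a₁ l) (a₂ l'))) * Real.log (y₂ l')) +
      (∑ l ∈ L₁, y₁ l) * (∑ l' ∈ L₂, y₂ l') -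
      ∑ l ∈ L₁, ∑ l' ∈ L₂, quad φ d (m (a₁ l) (a₂ l')) := by
  have hlog : ∀ l l', quad φ d (m (a₁ l) (a₂ l')) * Real.log (y₁ l * y₂ l') =
      quad φ d (m (a₁ l) (a₂ l')) * Real.log (y₁ l) +
      quad φ d (m (a₁ l) (a₂ l')) * Real.log (y₂ l') := by
    intro l l'
    by_cases h : y₁ l = 0
    · simp [h₁ l l' h]
    by_cases h' : y₂ l' = 0
    · simp [h₂ l l' h']
    rw [Real.log_mul h h', mul_add]
  simp only [quad_entropyTerm φ hd, hlog, hm.norm_map, ha₁, ha₂, Finset.sum_product,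
    Finset.sum_sub_distrib, Finset.sum_add_distrib, Finset.sum_mul, Finset.mul_sum]
  rw [Finset.sum_comm (s := L₂) (t := L₁)]
  simp only [mul_one, one_pow]
  rw [Finset.sum_comm (s := L₂) (t := L₁) (f := fun l' l => y₁ l * y₂ l')]
  ring

variable [CompleteSpace E₁] [CompleteSpace E₂] [CompleteSpace E]

theorem IsTensor.sum_quad_trial {m : E₁ →L[ℂ] E₂ →L[ℂ] E}
    {ι ι₁ ι₂ : Type*} (φ : HilbertBasis ι ℂ E) {c : ι → ℝ} {C : ℝ} (hc : ∀ j, |c j| ≤ C)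
    {ψ₁ χ₁ : HilbertBasis ι₁ ℂ E₁} {ψ₂ χ₂ : HilbertBasis ι₂ ℂ E₂} {K₁ L₁ : Finset ι₁}
    {K₂ L₂ : Finset ι₂} (t₁ : IsTrial ψ₁ χ₁ K₁) (t₂ : IsTrial ψ₂ χ₂ K₂) (hL₁ : K₁ ⊆ L₁)
    (hL₂ : K₂ ⊆ L₂) :
    ∑ l ∈ L₁, ∑ l' ∈ L₂, quad φ c (m (χ₁ l) (χ₂ l')) =
      ∑ l ∈ L₁, ∑ l' ∈ L₂, quad φ c (m (ψ₁ l) (ψ₂ l')) := by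
  simp only [t₂.sum_quad_map hL₂ (m _) φ hc]
  rw [Finset.sum_comm, Finset.sum_comm (s := L₁)]
  exact Finset.sum_congr rfl fun l' _ => t₁.sum_quad_map hL₁ (m.flip (ψ₂ l')) φ hc

/-- Klein's inequality for a trial product operator that differs from the given product operator
only in finitely many directions. -/
theorem IsTensor.le_sum_quad_entropyTerm {m : E₁ →L[ℂ] E₂ →L[ℂ] E} (hm : IsTensor m)
    {ι ι₁ ι₂ : Type*} (φ : HilbertBasis ι ℂ E) {d : ι → ℝ} (hd : ∀ j, d j ∈ Set.Icc (0 : ℝ) 1)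
    {ψ₁ χ₁ : HilbertBasis ι₁ ℂ E₁} {ψ₂ χ₂ : HilbertBasis ι₂ ℂ E₂} {K₁ L₁ : Finset ι₁}
    {K₂ L₂ : Finset ι₂} (t₁ : IsTrial ψ₁ χ₁ K₁) (t₂ : IsTrial ψ₂ χ₂ K₂) (hL₁ : K₁ ⊆ L₁)
    (hL₂ : K₂ ⊆ L₂) {g₁ h₁ : ι₁ → ℝ} {g₂ h₂ : ι₂ → ℝ} (hh₁ : ∀ l, 0 ≤ h₁ l) (hh₂ : ∀ l, 0 ≤ h₂ l)
    (e₁ : ∀ l ∉ K₁, h₁ l = g₁ l) (e₂ : ∀ l ∉ K₂, h₂ l = g₂ l)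
    (zg₁ : ∀ l η, g₁ l = 0 → quad φ d (m (ψ₁ l) η) = 0)
    (zh₁ : ∀ l η, h₁ l = 0 → quad φ d (m (χ₁ l) η) = 0)
    (zg₂ : ∀ l ξ, g₂ l = 0 → quad φ d (m ξ (ψ₂ l)) = 0)
    (zh₂ : ∀ l ξ, h₂ l = 0 → quad φ d (m ξ (χ₂ l)) = 0) :
    (∑ l ∈ K₁, ((∑ l' ∈ L₂, quad φ d (m (χ₁ l) (ψ₂ l'))) * Real.log (h₁ l) -
        (∑ l' ∈ L₂, quad φ d (m (ψ₁ l) (ψ₂ l'))) * Real.log (g₁ l))) +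
      (∑ l' ∈ K₂, ((∑ l ∈ L₁, quad φ d (m (ψ₁ l) (χ₂ l'))) * Real.log (h₂ l') -
        (∑ l ∈ L₁, quad φ d (m (ψ₁ l) (ψ₂ l'))) * Real.log (g₂ l'))) +
      ((∑ l ∈ L₁, g₁ l) * (∑ l' ∈ L₂, g₂ l') - (∑ l ∈ L₁, h₁ l) * (∑ l' ∈ L₂, h₂ l')) ≤
    ∑ p ∈ L₁ ×ˢ L₂, quad φ (fun j => entropyTerm (d j) (g₁ p.1 * g₂ p.2))
      (m (ψ₁ p.1) (ψ₂ p.2)) := by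
  obtain ⟨C, hC⟩ := exists_bound_Icc Real.continuous_mul_log
  have hd1 : ∀ j, |d j| ≤ 1 := fun j => abs_le_one_of_mem_Icc (hd j)
  have n0 : 0 ≤ ∑ p ∈ L₁ ×ˢ L₂, quad φ (fun j => entropyTerm (d j) (h₁ p.1 * h₂ p.2))
      (m (χ₁ p.1) (χ₂ p.2)) := by
    refine Finset.sum_nonneg fun p _ => quad_entropyTerm_nonneg hd
      (mul_nonneg (hh₁ _) (hh₂ _)) fun h => ?_
    rcases mul_eq_zero.1 h with h | h
    · exact zh₁ _ _ h
    · exact zh₂ _ _ h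
  -- After expansion, the `d log d` part and the trace part take the same values for `χ` and `ψ`. In
  -- the comparison with the sum for `g₁`, `g₂` only the logarithms of `h`, `g` and the products of
  -- total weights survive.
  rw [hm.sum_quad_entropyTerm φ hd (HilbertBasis.norm_apply χ₁) (HilbertBasis.norm_apply χ₂)
    (fun l l' => zh₁ l _) (fun l l' => zh₂ l' _), IsTensor.sum_quad_trial φ
      (fun j => hC _ (hd j)) t₁ t₂ hL₁ hL₂, IsTensor.sum_quad_trial φ hd1 t₁ t₂ hL₁ hL₂] at n0
  rw [hm.sum_quad_entropyTerm φ hd (HilbertBasis.norm_apply ψ₁) (HilbertBasis.norm_apply ψ₂)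
    (fun l l' => zg₁ l _) (fun l l' => zg₂ l' _)]
  simp only [t₂.sum_quad_map hL₂ (m _) φ hd1] at n0
  simp only [fun η => t₁.sum_quad_map hL₁ (m.flip η) φ hd1, ← ContinuousLinearMap.flip_apply m] at n0
  simp only [ContinuousLinearMap.flip_apply] at n0
  -- Off `K₁` the trial data agree with the given data, so the logarithmic difference is a sum over
  -- the fixed set `K₁`, whatever `L₁` is.
  have k₁ : ∑ l ∈ K₁, ((∑ l' ∈ L₂, quad φ d (m (χ₁ l) (ψ₂ l'))) * Real.log (h₁ l) -
        (∑ l' ∈ L₂, quad φ d (m (ψ₁ l) (ψ₂ l'))) * Real.log (g₁ l)) =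
      ∑ l ∈ L₁, ((∑ l' ∈ L₂, quad φ d (m (χ₁ l) (ψ₂ l'))) * Real.log (h₁ l) -
        (∑ l' ∈ L₂, quad φ d (m (ψ₁ l) (ψ₂ l'))) * Real.log (g₁ l)) := by
    refine Finset.sum_subset hL₁ fun l _ hl => ?_
    rw [e₁ l hl, t₁.eq_of_notMem l hl, sub_self]
  have k₂ : ∑ l' ∈ K₂, ((∑ l ∈ L₁, quad φ d (m (ψ₁ l) (χ₂ l'))) * Real.log (h₂ l') -
        (∑ l ∈ L₁, quad φ d (m (ψ₁ l) (ψ₂ l'))) * Real.log (g₂ l')) =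
      ∑ l' ∈ L₂, ((∑ l ∈ L₁, quad φ d (m (ψ₁ l) (χ₂ l'))) * Real.log (h₂ l') -
        (∑ l ∈ L₁, quad φ d (m (ψ₁ l) (ψ₂ l'))) * Real.log (g₂ l')) := by
    refine Finset.sum_subset hL₂ fun l _ hl => ?_
    rw [e₂ l hl, t₂.eq_of_notMem l hl, sub_self]
  rw [k₁, k₂, Finset.sum_sub_distrib, Finset.sum_sub_distrib]
  linarith

end Bipartite

/-! ### Trial operators in one factor. -/

section Trials

variable {E : Type*} [NormedAddCommGroup E] [InnerProductSpace ℂ E] [CompleteSpace E]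

theorem IsDensity.hasSum_eigenvalues {D : E →L[ℂ] E} (hD : IsDensity D) {ι : Type*}
    {φ : HilbertBasis ι ℂ E} {d : ι → ℝ} (hφ : IsEigenbasis D φ d) : HasSum d 1 := by
  have h := hasTrace_apply hD.2 φ
  have e : ∀ i, ⟪φ i, D (φ i)⟫_ℂ = (d i : ℂ) := by
    intro i
    rw [hφ i, inner_smul_right, inner_self_ofReal, HilbertBasis.norm_apply]
    simp
  simp only [e] at h
  rw [← Complex.ofReal_one] at h
  exact Complex.hasSum_ofReal.1 h

theorem IsDensity.eigenvalue_mem_Icc {D : E →L[ℂ] E} (hD : IsDensity D) {ι : Type*}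
    {φ : HilbertBasis ι ℂ E} {d : ι → ℝ} (hφ : IsEigenbasis D φ d) (i : ι) :
    d i ∈ Set.Icc (0 : ℝ) 1 :=
  ⟨eigenvalue_nonneg hD.1 hφ i,
    le_hasSum (hD.hasSum_eigenvalues hφ) i fun j _ => eigenvalue_nonneg hD.1 hφ j⟩

theorem IsDensity.hasSum_quad {D : E →L[ℂ] E} (hD : IsDensity D) {ι κ : Type*}
    {φ : HilbertBasis ι ℂ E} {d : ι → ℝ} (hφ : IsEigenbasis D φ d) (ψ : HilbertBasis κ ℂ E) :
    HasSum (fun k => quad φ d (ψ k)) 1 := by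
  simp only [quad_eq_inner hφ]
  exact (hasTrace_apply hD.2 ψ).mapL Complex.reCLM

theorem basisProj_basis {ι : Type*} (ψ : HilbertBasis ι ℂ E) {K : Finset ι} {k : ι} (hk : k ∈ K) :
    basisProj ψ K (ψ k) = ψ k := by
  classical
  refine HilbertBasis.ext_inner ψ fun i => ?_
  rw [inner_basisProj]
  split_ifs with hi
  · rfl
  · rw [ψ.orthonormal.2 fun h : i = k => hi (h ▸ hk)]

theorem inner_basisProj_left {ι : Type*} (ψ : HilbertBasis ι ℂ E) (K : Finset ι) (x y : E) :
    ⟪basisProj ψ K x, y⟫_ℂ = ⟪x, basisProj ψ K y⟫_ℂ := by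
  simp only [basisProj_apply, sum_inner, inner_sum, inner_smul_left, inner_smul_right,
    inner_conj_symm]
  exact Finset.sum_congr rfl fun k _ => mul_comm _ _

theorem inner_compress_self {ι : Type*} (ψ : HilbertBasis ι ℂ E) (K : Finset ι) (T : E →L[ℂ] E)
    (x : E) :
    ⟪x, compress ψ K T x⟫_ℂ = ⟪basisProj ψ K x, T (basisProj ψ K x)⟫_ℂ := by
  rw [compress_apply, ← inner_basisProj_left]

/-- Trial bases for one factor: the relative entropy with respect to the compressed operator is
`Y K`, and in the limit it is at least the relative entropy of `D`. -/
theorem IsDensity.exists_trials {D : E →L[ℂ] E} (hD : IsDensity D) {κ ι : Type*}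
    {φ : HilbertBasis κ ℂ E} {d : κ → ℝ} (hφ : IsEigenbasis D φ d) (ψ : HilbertBasis ι ℂ E)
    {g : ι → ℝ} {G : ℝ} (hG : HasSum g G) (hg : ∀ k, 0 ≤ g k)
    (h0 : ∀ k, g k = 0 → D (ψ k) = 0) :
    ∃ (χ : Finset ι → HilbertBasis ι ℂ E) (h : Finset ι → ι → ℝ) (Y : Finset ι → ℝ),
      (∀ K, IsTrial ψ (χ K) K) ∧ (∀ K l, 0 ≤ h K l) ∧ (∀ K, ∀ l ∉ K, h K l = g l) ∧
      (∀ K l, h K l = 0 → quad φ d (χ K l) = 0) ∧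
      (∀ K, HasSum (h K) (G + (∑ k ∈ K, quad φ d (ψ k) - ∑ k ∈ K, g k))) ∧
      (∀ K, ∑ k ∈ K, (quad φ d (χ K k) * Real.log (h K k) - quad φ d (ψ k) * Real.log (g k)) =
        Y K + ∑ k ∈ K, quad φ d (ψ k) - ∑ k ∈ K, g k) ∧
      ∀ J : Finset ι, ∃ y : Finset ι → ℝ, Filter.Tendsto y Filter.atTop
          (nhds (∑ k ∈ J, quad φ (fun j => entropyTerm (d j) (g k)) (ψ k))) ∧
        ∀ K, J ⊆ K → y K ≤ Y K := by
  classical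
  have hd := hD.eigenvalue_mem_Icc hφ
  choose χ u hχ hoff hproj hsum using fun K => exists_trial_basis hD.1 ψ K
  have ht : ∀ K, IsTrial ψ (χ K) K := fun K => ⟨hoff K, hsum K⟩
  have hu' : ∀ K l, u K l = quad φ d (basisProj ψ K (χ K l)) := by
    intro K l
    rw [quad_eq_inner hφ, ← inner_compress_self, hχ K l, inner_smul_right, inner_self_ofReal,
      HilbertBasis.norm_apply]
    simp
  have hu : ∀ K l, u K l ∈ Set.Icc (0 : ℝ) 1 := by
    intro K l
    rw [hu']
    refine ⟨quad_nonneg φ (fun j => (hd j).1) _, ?_⟩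
    refine (le_abs_self _).trans ((abs_quad_le φ (fun j => abs_le_one_of_mem_Icc (hd j)) _).trans ?_)
    rw [one_mul]
    have h1 := norm_basisProj_le ψ K (χ K l)
    rw [HilbertBasis.norm_apply] at h1
    exact pow_le_one₀ (norm_nonneg _) h1
  have huK : ∀ K, ∀ l ∈ K, quad φ d (χ K l) = u K l := fun K l hl => by
    rw [hu', hproj K l hl]
  have hq : ∀ K, ∀ k ∈ K, quad (χ K) (u K) (ψ k) = quad φ d (ψ k) := by
    intro K k hk
    rw [quad_eq_inner (hχ K), inner_compress_self, basisProj_basis ψ hk, quad_eq_inner hφ]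
  -- The contribution of `ψ k` to the entropy of the compression of `D`, with eigenvalues `u K`,
  -- relative to the weights `g`.
  let y : Finset ι → ι → ℝ := fun K k => quad (χ K) (fun l => entropyTerm (u K l) (g k)) (ψ k)
  have hy : ∀ K, ∀ k ∈ K, 0 ≤ y K k := by
    intro K k hk
    refine quad_entropyTerm_nonneg (hu K) (hg k) fun h => ?_
    rw [hq K k hk, quad_eq_inner hφ, h0 k h]
    simp
  -- The trace of `u log u` over the span of the `ψ k`, `k ∈ K`, evaluated in its eigenbasis.
  -- Vectors `χ K l` with `l ∉ K` are orthogonal to this span.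
  have hη : ∀ K, ∑ k ∈ K, quad (χ K) (fun l => u K l * Real.log (u K l)) (ψ k) =
      ∑ l ∈ K, u K l * Real.log (u K l) := by
    intro K
    have h1 : ∀ k ∈ K, quad (χ K) (fun l => u K l * Real.log (u K l)) (ψ k) =
        ∑ l ∈ K, u K l * Real.log (u K l) * ‖⟪χ K l, ψ k⟫_ℂ‖ ^ 2 := by
      intro k hk
      refine tsum_eq_sum fun l hl => ?_
      rw [hoff K l hl, ψ.orthonormal.2 fun h : l = k => hl (h ▸ hk)]
      simp
    rw [Finset.sum_congr rfl h1, Finset.sum_comm]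
    refine Finset.sum_congr rfl fun l hl => ?_
    rw [← Finset.mul_sum]
    have h2 : ∑ k ∈ K, ‖⟪χ K l, ψ k⟫_ℂ‖ ^ 2 = 1 := by
      simp only [norm_inner_symm (χ K l)]
      rw [← hsum K, Finset.sum_eq_single l]
      · rw [inner_self_ofReal, HilbertBasis.norm_apply]
        simp
      · intro k _ hk
        rw [(χ K).orthonormal.2 hk]
        simp
      · exact fun h => absurd hl h
    rw [h2, mul_one]
  -- The trial weights are the eigenvalues of the compression on `K` and the weights `g` elsewhere.
  refine ⟨χ, fun K l => if l ∈ K then u K l else g l, fun K => ∑ k ∈ K, y K k, ht, fun K l => ?_,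
    fun K l hl => if_neg hl, fun K l hl => ?_, fun K => ?_, fun K => ?_, fun J => ?_⟩
  · dsimp only
    split_ifs
    exacts [(hu K l).1, hg l]
  · dsimp only at hl
    split_ifs at hl with h
    · rw [huK K l h, hl]
    · rw [hoff K l h, quad_eq_inner hφ, h0 l hl]
      simp
  · have e1 : ∑ k ∈ K, quad φ d (ψ k) = ∑ k ∈ K, u K k := by
      rw [← Finset.sum_congr rfl (huK K)]
      exact ((ht K).sum_quad_map subset_rfl (ContinuousLinearMap.id ℂ E) φ
        fun j => abs_le_one_of_mem_Icc (hd j)).symm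
    have e2 : HasSum (fun l => if l ∈ K then u K l - g l else 0)
        (∑ k ∈ K, u K k - ∑ k ∈ K, g k) := by
      rw [← Finset.sum_sub_distrib]
      have e3 := hasSum_sum_of_ne_finset_zero (s := K) (L := SummationFilter.unconditional ι)
        (f := fun l => if l ∈ K then u K l - g l else 0) (fun l hl => if_neg hl)
      rwa [Finset.sum_congr rfl fun k hk => if_pos hk] at e3
    rw [e1]
    convert hG.add e2 using 2 with l
    dsimp only
    by_cases hl : l ∈ K
    · rw [if_pos hl, if_pos hl]
      ring
    · rw [if_neg hl, if_neg hl, add_zero]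
  · have h1 : ∀ k ∈ K, y K k = quad (χ K) (fun l => u K l * Real.log (u K l)) (ψ k) -
        quad φ d (ψ k) * Real.log (g k) + g k - quad φ d (ψ k) := by
      intro k hk
      simp only [y]
      rw [quad_entropyTerm _ (hu K), hq K k hk, HilbertBasis.norm_apply, one_pow, mul_one]
    have h2 : ∑ k ∈ K, quad φ d (χ K k) * Real.log (if k ∈ K then u K k else g k) =
        ∑ k ∈ K, u K k * Real.log (u K k) :=
      Finset.sum_congr rfl fun k hk => by rw [huK K k hk, if_pos hk]
    dsimp only
    rw [Finset.sum_congr rfl h1, Finset.sum_sub_distrib, Finset.sum_sub_distrib,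
      Finset.sum_add_distrib, Finset.sum_sub_distrib, hη, h2]
    ring
  -- Fixing `J` avoids a limit of sums over growing sets: dropping the nonnegative terms outside `J`
  -- leaves a lower bound with a fixed finite number of convergent terms.
  · refine ⟨fun K => ∑ k ∈ J, y K k, ?_, fun K hK =>
      Finset.sum_le_sum_of_subset_of_nonneg hK fun k hk _ => hy K k hk⟩
    exact tendsto_finsetSum _ fun k _ => tendsto_quad hχ hφ hu hd (ψ k)
      (fun n => tendsto_compress_pow ψ D (ψ k) n) (continuous_entropyTerm (g k))

end Trials

/-! ### Superadditivity of relative entropy by a double limit. -/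

section Superadditivity

variable {E₁ E₂ E : Type*} [NormedAddCommGroup E₁] [InnerProductSpace ℂ E₁]
  [NormedAddCommGroup E₂] [InnerProductSpace ℂ E₂]
  [NormedAddCommGroup E] [InnerProductSpace ℂ E]
  [CompleteSpace E₁] [CompleteSpace E₂] [CompleteSpace E]

theorem IsPartialTrace.hasSum_quad {m : E₁ →L[ℂ] E₂ →L[ℂ] E} {D : E →L[ℂ] E}
    {D₁ : E₁ →L[ℂ] E₁} (h : IsPartialTrace m D D₁) {ι κ ι₂ : Type*} {φ : HilbertBasis ι ℂ E}
    {d : ι → ℝ} (hφ : IsEigenbasis D φ d) {φ₁ : HilbertBasis κ ℂ E₁} {d₁ : κ → ℝ}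
    (hφ₁ : IsEigenbasis D₁ φ₁ d₁) (b : HilbertBasis ι₂ ℂ E₂) (ξ : E₁) :
    HasSum (fun l => quad φ d (m ξ (b l))) (quad φ₁ d₁ ξ) := by
  simp only [quad_eq_inner hφ, quad_eq_inner hφ₁]
  exact (h.hasSum ξ ξ b).mapL Complex.reCLM

/-- The form of `D₁` at `ξ` is the sum of the nonnegative values of the form of `D` at `m ξ (b l)`,
so all of these vanish. Thus every `φ j` with `d j ≠ 0` is orthogonal to each `m ξ (b l)`, and by
continuity to `m ξ η`. -/
theorem IsPartialTrace.quad_eq_zero {m : E₁ →L[ℂ] E₂ →L[ℂ] E} {D : E →L[ℂ] E}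
    {D₁ : E₁ →L[ℂ] E₁} (h : IsPartialTrace m D D₁) {ι κ : Type*} {φ : HilbertBasis ι ℂ E}
    {d : ι → ℝ} (hd : ∀ j, d j ∈ Set.Icc (0 : ℝ) 1) (hφ : IsEigenbasis D φ d)
    {φ₁ : HilbertBasis κ ℂ E₁} {d₁ : κ → ℝ} (hφ₁ : IsEigenbasis D₁ φ₁ d₁) {ξ : E₁}
    (hξ : quad φ₁ d₁ ξ = 0) (η : E₂) : quad φ d (m ξ η) = 0 := by
  obtain ⟨w, b, -⟩ := exists_hilbertBasis ℂ E₂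
  have h1 := h.hasSum_quad hφ hφ₁ b ξ
  rw [hξ] at h1
  have h2 := (hasSum_zero_iff_of_nonneg fun l => quad_nonneg φ (fun j => (hd j).1) _).1 h1
  refine (tsum_congr fun j => ?_).trans tsum_zero
  by_cases hj : d j = 0
  · rw [hj, zero_mul]
  have h3 : ∀ l, ⟪b l, (m ξ).adjoint (φ j)⟫_ℂ = 0 := by
    intro l
    have h4 := (mul_eq_zero.1 (mul_norm_sq_eq_zero_of_quad hd (congrFun h2 l) j)).resolve_left hj
    rw [ContinuousLinearMap.adjoint_inner_right, ← norm_eq_zero, norm_inner_symm]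
    simpa using h4
  have h5 : (m ξ).adjoint (φ j) = 0 :=
    HilbertBasis.ext_inner b fun l => by rw [h3, inner_zero_right]
  rw [← ContinuousLinearMap.adjoint_inner_left, h5]
  simp

/-- Reduces an inequality in `ℝ≥0∞` to finite partial sums and a finite bound, where subtraction is
available. -/
theorem ofReal_sum_add_le_of_forall {ι₁ ι₂ : Type*} {f₁ : ι₁ → ℝ} {f₂ : ι₂ → ℝ}
    (h₁ : ∀ i, 0 ≤ f₁ i) (h₂ : ∀ i, 0 ≤ f₂ i) {S : ℝ≥0∞}
    (h : S ≠ ⊤ → ∀ (J₁ : Finset ι₁) (J₂ : Finset ι₂), ∑ i ∈ J₁, f₁ i + ∑ i ∈ J₂, f₂ i ≤ S.toReal) :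
    ∑' i, ENNReal.ofReal (f₁ i) + ∑' i, ENNReal.ofReal (f₂ i) ≤ S := by
  rcases eq_or_ne S ⊤ with rfl | hS
  · exact le_top
  rw [ENNReal.tsum_eq_iSup_sum, ENNReal.tsum_eq_iSup_sum]
  refine ENNReal.iSup_add_iSup_le fun J₁ J₂ => ?_
  rw [← ENNReal.ofReal_sum_of_nonneg fun i _ => h₁ i, ← ENNReal.ofReal_sum_of_nonneg fun i _ => h₂ i,
    ← ENNReal.ofReal_add (Finset.sum_nonneg fun i _ => h₁ i) (Finset.sum_nonneg fun i _ => h₂ i)]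
  exact ENNReal.ofReal_le_of_le_toReal (h hS J₁ J₂)

theorem tendsto_sum_sub {ι : Type*} {f g : ι → ℝ} {a b : ℝ} (hf : HasSum f a) (hg : HasSum g b) :
    Filter.Tendsto (fun K : Finset ι => ∑ k ∈ K, f k - ∑ k ∈ K, g k) Filter.atTop
      (nhds (a - b)) := by
  rw [HasSum, SummationFilter.unconditional_filter] at hf hg
  exact hf.sub hg

/-- Superadditivity of the relative entropy with respect to a product operator. -/
theorem IsTensor.entropySum_add_le {m : E₁ →L[ℂ] E₂ →L[ℂ] E} (hm : IsTensor m)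
    {D : E →L[ℂ] E} {D₁ : E₁ →L[ℂ] E₁} {D₂ : E₂ →L[ℂ] E₂} (hD : IsDensity D) (hD₁ : IsDensity D₁)
    (hD₂ : IsDensity D₂) (p₁ : IsPartialTrace m D D₁) (p₂ : IsPartialTrace m.flip D D₂)
    {ι κ₁ κ₂ ι₁ ι₂ : Type*} {φ : HilbertBasis ι ℂ E} {d : ι → ℝ} (hφ : IsEigenbasis D φ d)
    {φ₁ : HilbertBasis κ₁ ℂ E₁} {d₁ : κ₁ → ℝ} (hφ₁ : IsEigenbasis D₁ φ₁ d₁)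
    {φ₂ : HilbertBasis κ₂ ℂ E₂} {d₂ : κ₂ → ℝ} (hφ₂ : IsEigenbasis D₂ φ₂ d₂)
    (ψ₁ : HilbertBasis ι₁ ℂ E₁) (ψ₂ : HilbertBasis ι₂ ℂ E₂) {g₁ : ι₁ → ℝ} {g₂ : ι₂ → ℝ}
    (hg₁ : ∀ k, 0 ≤ g₁ k) (hg₂ : ∀ k, 0 ≤ g₂ k) {G₁ G₂ : ℝ} (s₁ : HasSum g₁ G₁)
    (s₂ : HasSum g₂ G₂) (hG₁ : G₁ ≤ 1) (hG₂ : G₂ ≤ 1) (z₁ : ∀ k, g₁ k = 0 → D₁ (ψ₁ k) = 0)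
    (z₂ : ∀ k, g₂ k = 0 → D₂ (ψ₂ k) = 0) :
    entropySum φ₁ ψ₁ d₁ g₁ + entropySum φ₂ ψ₂ d₂ g₂ ≤
      entropySum φ (hm.basis ψ₁ ψ₂) d fun p => g₁ p.1 * g₂ p.2 := by
  have hd := hD.eigenvalue_mem_Icc hφ
  have hd₁ := hD₁.eigenvalue_mem_Icc hφ₁
  have hd₂ := hD₂.eigenvalue_mem_Icc hφ₂
  have w₁ : ∀ k, g₁ k = 0 → quad φ₁ d₁ (ψ₁ k) = 0 := fun k hk => by
    rw [quad_eq_inner hφ₁, z₁ k hk]; simp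
  have w₂ : ∀ k, g₂ k = 0 → quad φ₂ d₂ (ψ₂ k) = 0 := fun k hk => by
    rw [quad_eq_inner hφ₂, z₂ k hk]; simp
  have v₁ : ∀ {ξ}, quad φ₁ d₁ ξ = 0 → ∀ η, quad φ d (m ξ η) = 0 :=
    fun h => p₁.quad_eq_zero hd hφ hφ₁ h
  have v₂ : ∀ {η}, quad φ₂ d₂ η = 0 → ∀ ξ, quad φ d (m ξ η) = 0 :=
    fun h => p₂.quad_eq_zero hd hφ hφ₂ h
  have hw : ∀ p : ι₁ × ι₂, g₁ p.1 * g₂ p.2 = 0 → quad φ d (hm.basis ψ₁ ψ₂ p) = 0 := by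
    intro p hp
    rw [hm.basis_apply]
    rcases mul_eq_zero.1 hp with h | h
    · exact v₁ (w₁ _ h) _
    · exact v₂ (w₂ _ h) _
  rw [entropySum_eq_tsum_quad hd₁ hg₁ w₁, entropySum_eq_tsum_quad hd₂ hg₂ w₂,
    entropySum_eq_tsum_quad hd (fun p => mul_nonneg (hg₁ _) (hg₂ _)) hw]
  set Q : ι₁ × ι₂ → ℝ := fun p => quad φ (fun j => entropyTerm (d j) (g₁ p.1 * g₂ p.2))
    (hm.basis ψ₁ ψ₂ p) with hQ
  have hQ0 : ∀ p, 0 ≤ Q p := fun p =>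
    quad_entropyTerm_nonneg hd (mul_nonneg (hg₁ _) (hg₂ _)) (hw p)
  refine ofReal_sum_add_le_of_forall (fun k => quad_entropyTerm_nonneg hd₁ (hg₁ k) (w₁ k))
    (fun k => quad_entropyTerm_nonneg hd₂ (hg₂ k) (w₂ k)) fun hS J₁ J₂ => ?_
  set S := ∑' p, ENNReal.ofReal (Q p)
  have hSle : ∀ L : Finset (ι₁ × ι₂), ∑ p ∈ L, Q p ≤ S.toReal := by
    intro L
    refine (ENNReal.ofReal_le_iff_le_toReal hS).1 ?_
    rw [ENNReal.ofReal_sum_of_nonneg fun p _ => hQ0 p]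
    exact ENNReal.sum_le_tsum L
  obtain ⟨χ₁, h₁, Y₁, t₁, n₁, e₁, q₁, sh₁, r₁, l₁⟩ := hD₁.exists_trials hφ₁ ψ₁ s₁ hg₁ z₁
  obtain ⟨χ₂, h₂, Y₂, t₂, n₂, e₂, q₂, sh₂, r₂, l₂⟩ := hD₂.exists_trials hφ₂ ψ₂ s₂ hg₂ z₂
  -- First limit: `K₁`, `K₂` are fixed and the box `L₁ × L₂` of the Klein inequality grows. Partial
  -- sums of the form of `D` turn into the forms of `D₁` and `D₂`.
  have key : ∀ K₁ K₂, Y₁ K₁ + Y₂ K₂ +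
      ((∑ k ∈ K₁, quad φ₁ d₁ (ψ₁ k) - ∑ k ∈ K₁, g₁ k) +
        (∑ k ∈ K₂, quad φ₂ d₂ (ψ₂ k) - ∑ k ∈ K₂, g₂ k) + (G₁ * G₂ -
          (G₁ + (∑ k ∈ K₁, quad φ₁ d₁ (ψ₁ k) - ∑ k ∈ K₁, g₁ k)) *
          (G₂ + (∑ k ∈ K₂, quad φ₂ d₂ (ψ₂ k) - ∑ k ∈ K₂, g₂ k)))) ≤ S.toReal := by
    intro K₁ K₂
    have T₁ : ∀ {f : ι₁ → ℝ} {z : ℝ}, HasSum f z → Filter.Tendsto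
        (fun L : Finset ι₁ × Finset ι₂ => ∑ l ∈ L.1, f l) (Filter.atTop ×ˢ Filter.atTop)
        (nhds z) := by
      intro f z h
      rw [HasSum, SummationFilter.unconditional_filter] at h
      exact h.comp Filter.tendsto_fst
    have T₂ : ∀ {f : ι₂ → ℝ} {z : ℝ}, HasSum f z → Filter.Tendsto
        (fun L : Finset ι₁ × Finset ι₂ => ∑ l ∈ L.2, f l) (Filter.atTop ×ˢ Filter.atTop)
        (nhds z) := by
      intro f z h
      rw [HasSum, SummationFilter.unconditional_filter] at h
      exact h.comp Filter.tendsto_snd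
    have N₁ : ∀ ξ, HasSum (fun l => quad φ d (m ξ (ψ₂ l))) (quad φ₁ d₁ ξ) :=
      fun ξ => p₁.hasSum_quad hφ hφ₁ ψ₂ ξ
    have N₂ : ∀ η, HasSum (fun l => quad φ d (m (ψ₁ l) η)) (quad φ₂ d₂ η) :=
      fun η => p₂.hasSum_quad hφ hφ₂ ψ₁ η
    have lim := ((tendsto_finsetSum K₁ fun l _ => ((T₂ (N₁ (χ₁ K₁ l))).mul_const
        (Real.log (h₁ K₁ l))).sub ((T₂ (N₁ (ψ₁ l))).mul_const (Real.log (g₁ l)))).add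
      (tendsto_finsetSum K₂ fun l _ => ((T₁ (N₂ (χ₂ K₂ l))).mul_const
        (Real.log (h₂ K₂ l))).sub ((T₁ (N₂ (ψ₂ l))).mul_const (Real.log (g₂ l))))).add
      (((T₁ s₁).mul (T₂ s₂)).sub ((T₁ (sh₁ K₁)).mul (T₂ (sh₂ K₂))))
    have le := le_of_tendsto lim (b := S.toReal) (by
      filter_upwards [(Filter.eventually_ge_atTop K₁).prod_mk (Filter.eventually_ge_atTop K₂)]
        with L hL
      refine (hm.le_sum_quad_entropyTerm φ hd (t₁ K₁) (t₂ K₂) hL.1 hL.2 (n₁ K₁) (n₂ K₂)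
        (e₁ K₁) (e₂ K₂) (fun l η h => v₁ (w₁ l h) η)
        (fun l η h => v₁ (q₁ K₁ l h) η) (fun l ξ h => v₂ (w₂ l h) ξ)
        (fun l ξ h => v₂ (q₂ K₂ l h) ξ)).trans ?_
      simpa only [hQ, hm.basis_apply] using hSle (L.1 ×ˢ L.2))
    rw [r₁, r₂] at le
    linarith
  obtain ⟨y₁, ty₁, ly₁⟩ := l₁ J₁
  obtain ⟨y₂, ty₂, ly₂⟩ := l₂ J₂
  have c₁ : Filter.Tendsto (fun K : Finset ι₁ × Finset ι₂ =>
      ∑ k ∈ K.1, quad φ₁ d₁ (ψ₁ k) - ∑ k ∈ K.1, g₁ k) (Filter.atTop ×ˢ Filter.atTop)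
      (nhds (1 - G₁)) :=
    (tendsto_sum_sub (hD₁.hasSum_quad hφ₁ ψ₁) s₁).comp Filter.tendsto_fst
  have c₂ : Filter.Tendsto (fun K : Finset ι₁ × Finset ι₂ =>
      ∑ k ∈ K.2, quad φ₂ d₂ (ψ₂ k) - ∑ k ∈ K.2, g₂ k) (Filter.atTop ×ˢ Filter.atTop)
      (nhds (1 - G₂)) :=
    (tendsto_sum_sub (hD₂.hasSum_quad hφ₂ ψ₂) s₂).comp Filter.tendsto_snd
  -- Second limit: `K₁` and `K₂` grow, while `J₁` and `J₂` stay fixed. The trial weights then tend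
  -- to total weight `1` in each factor.
  have lim := ((ty₁.comp Filter.tendsto_fst).add (ty₂.comp Filter.tendsto_snd)).add
    ((c₁.add c₂).add ((tendsto_const_nhds (x := G₁ * G₂)).sub
      ((c₁.const_add G₁).mul (c₂.const_add G₂))))
  have le := le_of_tendsto lim (b := S.toReal) (by
    filter_upwards [(Filter.eventually_ge_atTop J₁).prod_mk (Filter.eventually_ge_atTop J₂)]
      with K hK
    refine le_trans ?_ (key K.1 K.2)
    have h1 := ly₁ K.1 hK.1
    have h2 := ly₂ K.2 hK.2
    simp only [Function.comp_apply]
    linarith)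
  -- The remaining constant is `(1 - G₁) + (1 - G₂) + (G₁ G₂ - 1) = (1 - G₁) (1 - G₂)`, so `Gᵢ ≤ 1`
  -- suffices and normalization of the weights is not required.
  nlinarith [mul_nonneg (sub_nonneg.2 hG₁) (sub_nonneg.2 hG₂)]

end Superadditivity

/-! ### Creators, annihilators and their anticommutation relations. -/

section FockBasics

variable {H : Type*} [NormedAddCommGroup H] [InnerProductSpace ℂ H]

theorem Fock.clm_ext {F : Type*} [NormedAddCommGroup F] [NormedSpace ℂ F] {S T : Fock H →L[ℂ] F}
    (h : ∀ x, S (wedge x) = T (wedge x)) (ψ : Fock H) : S ψ = T ψ := by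
  refine congrFun (denseRange_wedgeComb.equalizer S.continuous T.continuous ?_) ψ
  ext f
  simp [wedgeComb, Finsupp.linearCombination_apply, Finsupp.sum, map_sum, h]

theorem Fock.ext_inner {ψ χ : Fock H} (h : ∀ x : Tuple H, ⟪wedge x, ψ⟫_ℂ = ⟪wedge x, χ⟫_ℂ) :
    ψ = χ := by
  refine ext_inner_right ℂ fun φ => Fock.clm_ext (S := innerSL ℂ ψ) (T := innerSL ℂ χ) ?_ φ
  intro x
  rw [innerSL_apply_apply, innerSL_apply_apply, ← inner_conj_symm, h, inner_conj_symm]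

/-- The wedge product as an alternating map. -/
noncomputable def wedgeAlt (H : Type*) [NormedAddCommGroup H] [InnerProductSpace ℂ H] (n : ℕ) :
    H [⋀^Fin n]→ₗ[ℂ] Fock H where
  toFun v := wedge ⟨n, v⟩
  map_update_add' {inst} v i x y := by
    refine Fock.ext_inner fun u => ?_
    obtain ⟨m, u⟩ := u
    obtain rfl : inst = instDecidableEqFin n := Subsingleton.elim _ _
    rw [inner_add_right]
    simp only [inner_wedge_wedge]
    by_cases h : m = n
    · subst h
      simp only [gramKernel_self]
      have e : ∀ x : H, (Matrix.of fun a b => ⟪u a, Function.update v i x b⟫_ℂ) =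
          (Matrix.of fun a b => ⟪u a, v b⟫_ℂ).updateCol i fun a => ⟪u a, x⟫_ℂ := by
        intro x
        ext a b
        by_cases hb : b = i
        · subst hb; simp
        · simp [hb]
      rw [e, e, e, ← Matrix.det_updateCol_add]
      congr 2
      ext a
      simp
    · simp [gramKernel_of_ne h]
  map_update_smul' {inst} v i c x := by
    refine Fock.ext_inner fun u => ?_
    obtain ⟨m, u⟩ := u
    obtain rfl : inst = instDecidableEqFin n := Subsingleton.elim _ _
    rw [inner_smul_right]
    simp only [inner_wedge_wedge]
    by_cases h : m = n
    · subst h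
      simp only [gramKernel_self]
      have e : ∀ x : H, (Matrix.of fun a b => ⟪u a, Function.update v i x b⟫_ℂ) =
          (Matrix.of fun a b => ⟪u a, v b⟫_ℂ).updateCol i fun a => ⟪u a, x⟫_ℂ := by
        intro x
        ext a b
        by_cases hb : b = i
        · subst hb; simp
        · simp [hb]
      rw [e, e, ← Matrix.det_updateCol_smul]
      congr 2
      ext a
      simp
    · simp [gramKernel_of_ne h]
  map_eq_zero_of_eq' v i j hv hij := by
    refine Fock.ext_inner fun u => ?_
    obtain ⟨m, u⟩ := u
    rw [inner_zero_right, inner_wedge_wedge]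
    by_cases h : m = n
    · subst h
      rw [gramKernel_self]
      exact Matrix.det_zero_of_column_eq hij fun a => by simp [hv]
    · exact gramKernel_of_ne h _ _

theorem wedgeAlt_apply {n : ℕ} (v : Fin n → H) : wedgeAlt H n v = wedge ⟨n, v⟩ := rfl

theorem Fock.norm_le {F : Type*} [NormedAddCommGroup F] [NormedSpace ℂ F]
    (T : Fock H →L[ℂ] F) {C : ℝ} (h : ∀ f : Tuple H →₀ ℂ, ‖T (wedgeComb f)‖ ≤ C * ‖wedgeComb f‖)
    (ψ : Fock H) : ‖T ψ‖ ≤ C * ‖ψ‖ := by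
  refine denseRange_wedgeComb.induction (P := fun ψ => ‖T ψ‖ ≤ C * ‖ψ‖) ?_
    (isClosed_le (by fun_prop) (by fun_prop)) ψ
  rintro _ ⟨f, rfl⟩
  exact h f

theorem norm_creator_le (h : H) (ψ : Fock H) : ‖creator h ψ‖ ≤ ‖h‖ * ‖ψ‖ := by
  refine Fock.norm_le (creator h) (fun f => ?_) ψ
  convert creator_bound h f using 2
  simp [wedgeComb, Finsupp.linearCombination_apply, Finsupp.sum, map_sum, creator_wedge]

theorem creator_add (g h : H) (ψ : Fock H) : creator (g + h) ψ = creator g ψ + creator h ψ := by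
  refine Fock.clm_ext (T := creator g + creator h) (fun x => ?_) ψ
  rw [add_apply, creator_wedge, creator_wedge, creator_wedge]
  exact (wedgeAlt H (x.1 + 1)).map_vecCons_add x.2 g h

theorem creator_smul (c : ℂ) (h : H) (ψ : Fock H) : creator (c • h) ψ = c • creator h ψ := by
  refine Fock.clm_ext (T := c • creator h) (fun x => ?_) ψ
  rw [smul_apply, creator_wedge, creator_wedge]
  exact (wedgeAlt H (x.1 + 1)).map_vecCons_smul x.2 c h

/-- The bounded linear map `h ↦ a†_h ψ`. -/
noncomputable def creatorAt (ψ : Fock H) : H →L[ℂ] Fock H :=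
  LinearMap.mkContinuous
    { toFun := fun h => creator h ψ
      map_add' := fun g h => creator_add g h ψ
      map_smul' := fun c h => creator_smul c h ψ } ‖ψ‖ fun h => by
    rw [mul_comm]; exact norm_creator_le h ψ

theorem creatorAt_apply (ψ : Fock H) (h : H) : creatorAt ψ h = creator h ψ := rfl

theorem creator_creator (g h : H) (ψ : Fock H) :
    creator g (creator h ψ) = -creator h (creator g ψ) := by
  refine Fock.clm_ext (S := creator g ∘L creator h) (T := -(creator h ∘L creator g))
    (fun x => ?_) ψ
  simp only [neg_apply, ContinuousLinearMap.comp_apply, creator_wedge]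
  have h1 := (wedgeAlt H (x.1 + 2)).map_swap (Fin.cons h (Fin.cons g x.2 : Fin (x.1 + 1) → H))
    (i := 0) (j := 1) (by simp)
  rw [wedgeAlt_apply, wedgeAlt_apply] at h1
  refine Eq.trans ?_ h1
  have e : (Fin.cons g (Fin.cons h x.2 : Fin (x.1 + 1) → H) : Fin (x.1 + 2) → H) =
      (Fin.cons h (Fin.cons g x.2 : Fin (x.1 + 1) → H) : Fin (x.1 + 2) → H) ∘
        Equiv.swap 0 1 := by
    ext i
    refine Fin.cases ?_ (fun i => Fin.cases ?_ (fun i => ?_) i) i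
    · simp
    · simp
    · have h2 : Equiv.swap (0 : Fin (x.1 + 2)) 1 i.succ.succ = i.succ.succ :=
        Equiv.swap_apply_of_ne_of_ne (Fin.succ_ne_zero _) (by
          rw [← Fin.succ_zero_eq_one]
          exact fun h => Fin.succ_ne_zero _ (Fin.succ_injective _ h))
      simp [h2]
  rw [← e]
  rfl

theorem inner_annihilator (h : H) (ψ χ : Fock H) :
    ⟪ψ, annihilator h χ⟫_ℂ = ⟪creator h ψ, χ⟫_ℂ := by
  rw [annihilator, ContinuousLinearMap.adjoint_inner_right]

theorem annihilator_inner (h : H) (ψ χ : Fock H) :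
    ⟪annihilator h ψ, χ⟫_ℂ = ⟪ψ, creator h χ⟫_ℂ := by
  rw [annihilator, ContinuousLinearMap.adjoint_inner_left]

/-- The vacuum vector `Ω`. -/
noncomputable def vacuum (H : Type*) [NormedAddCommGroup H] [InnerProductSpace ℂ H] : Fock H :=
  wedge ⟨0, Fin.elim0⟩

theorem wedge_zero (v : Fin 0 → H) : wedge ⟨0, v⟩ = vacuum H := by
  rw [vacuum, Subsingleton.elim v Fin.elim0]

theorem wedge_succ {n : ℕ} (v : Fin (n + 1) → H) :
    wedge ⟨n + 1, v⟩ = creator (v 0) (wedge ⟨n, Fin.tail v⟩) := by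
  rw [creator_wedge, Tuple.cons, Fin.cons_self_tail]

theorem annihilator_vacuum (h : H) : annihilator h (vacuum H) = 0 := by
  refine Fock.ext_inner fun u => ?_
  rw [inner_annihilator, creator_wedge, vacuum, inner_wedge_wedge, inner_zero_right]
  exact gramKernel_of_ne (Nat.succ_ne_zero _) _ _

/-- Paired with a wedge product, this is the Laplace expansion of the Gram determinant along its
first row. -/
theorem annihilator_wedge {n : ℕ} (h : H) (v : Fin (n + 1) → H) :
    annihilator h (wedge ⟨n + 1, v⟩) =
      ∑ i : Fin (n + 1), ((-1) ^ (i : ℕ) * ⟪h, v i⟫_ℂ) • wedge ⟨n, v ∘ i.succAbove⟩ := by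
  refine Fock.ext_inner fun u => ?_
  obtain ⟨m, u⟩ := u
  rw [inner_annihilator, creator_wedge, inner_sum]
  simp only [inner_smul_right, inner_wedge_wedge]
  by_cases hm : m = n
  · subst hm
    change gramKernel ⟨m + 1, Fin.cons h u⟩ _ = _
    simp only [gramKernel_self]
    rw [Matrix.det_succ_row_zero]
    rfl
  · simp only [gramKernel_of_ne hm, mul_zero, Finset.sum_const_zero]
    exact gramKernel_of_ne (by simpa using hm) _ _

/-- The canonical anticommutation relations. -/
theorem annihilator_creator (h g : H) (ψ : Fock H) :
    annihilator h (creator g ψ) = ⟪h, g⟫_ℂ • ψ - creator g (annihilator h ψ) := by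
  refine Fock.clm_ext (S := annihilator h ∘L creator g)
    (T := ⟪h, g⟫_ℂ • ContinuousLinearMap.id ℂ _ - creator g ∘L annihilator h) (fun x => ?_) ψ
  obtain ⟨n, v⟩ := x
  rw [sub_apply, smul_apply,
    ContinuousLinearMap.comp_apply, ContinuousLinearMap.comp_apply, creator_wedge,
    ContinuousLinearMap.id_apply, Tuple.cons, annihilator_wedge, Fin.sum_univ_succ]
  have e0 : (Fin.cons g v : Fin (n + 1) → H) ∘ Fin.succAbove 0 = v := by
    ext i; simp
  rw [Fin.cons_zero, e0, Fin.val_zero, pow_zero, one_mul, sub_eq_add_neg]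
  congr 1
  -- The term of index `0` gave `⟪h, g⟫`. The others are the expansion of `annihilator h` on the
  -- remaining factors, each index being shifted by one, which produces the minus sign.
  cases n with
  | zero => simp [wedge_zero, annihilator_vacuum]
  | succ n =>
    rw [annihilator_wedge, map_sum, ← Finset.sum_neg_distrib]
    refine Finset.sum_congr rfl fun i _ => ?_
    rw [map_smul, creator_wedge, Tuple.cons, Fin.cons_succ, Fin.val_succ, pow_succ, ← neg_smul]
    congr 1
    · ring
    · congr 2
      ext j
      refine Fin.cases ?_ (fun j => ?_) j <;> simp

theorem norm_annihilator_le (h : H) (ψ : Fock H) : ‖annihilator h ψ‖ ≤ ‖h‖ * ‖ψ‖ := by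
  refine (ContinuousLinearMap.le_opNorm _ _).trans ?_
  gcongr
  rw [annihilator, LinearIsometryEquiv.norm_map]
  exact ContinuousLinearMap.opNorm_le_bound _ (norm_nonneg _) (norm_creator_le h)

/-- The creators of a total set of vectors generate Fock space from the vacuum. -/
theorem Fock.eq_top_of_creator {S : Submodule ℂ (Fock H)} (hS : IsClosed (S : Set (Fock H)))
    (h0 : vacuum H ∈ S) {G : Set H} (hG : Dense (Submodule.span ℂ G : Set H))
    (hc : ∀ g ∈ G, ∀ ψ ∈ S, creator g ψ ∈ S) : S = ⊤ := by
  have h1 : ∀ (h : H), ∀ ψ ∈ S, creator h ψ ∈ S := by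
    intro h ψ hψ
    have h2 : (Submodule.span ℂ G : Set H) ⊆ creatorAt ψ ⁻¹' S := by
      intro g hg
      have : Submodule.span ℂ G ≤ S.comap (creatorAt ψ : H →ₗ[ℂ] Fock H) :=
        Submodule.span_le.2 fun g hg => hc g hg ψ hψ
      exact this hg
    have h3 := (hS.preimage (creatorAt ψ).continuous).closure_subset_iff.2 h2
    rw [hG.closure_eq] at h3
    exact h3 (Set.mem_univ h)
  have h2 : ∀ x : Tuple H, wedge x ∈ S := by
    rintro ⟨n, v⟩
    induction n with
    | zero => rwa [wedge_zero]
    | succ n ih => rw [wedge_succ]; exact h1 _ _ (ih _)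
  rw [eq_top_iff]
  intro ψ _
  refine denseRange_wedgeComb.induction (P := fun ψ => ψ ∈ S) ?_ hS ψ
  rintro _ ⟨f, rfl⟩
  rw [wedgeComb, Finsupp.linearCombination_apply]
  exact S.sum_mem fun x _ => S.smul_mem _ (h2 x)

/-- A version of `Fock.eq_top_of_creator` for the closed span of a set of vectors. -/
theorem Fock.eq_zero_of_creator {A : Set (Fock H)} (h0 : vacuum H ∈ A) {G : Set H}
    (hG : Dense (Submodule.span ℂ G : Set H))
    (hc : ∀ g ∈ G, ∀ ψ ∈ A, creator g ψ ∈ Submodule.span ℂ A) {χ : Fock H}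
    (hχ : ∀ ψ ∈ A, ⟪ψ, χ⟫_ℂ = 0) : χ = 0 := by
  have h1 : (Submodule.span ℂ A).topologicalClosure = ⊤ := by
    refine Fock.eq_top_of_creator (Submodule.isClosed_topologicalClosure _)
      (Submodule.le_topologicalClosure _ (Submodule.subset_span h0)) hG fun g hg ψ hψ => ?_
    have h2 : Submodule.span ℂ A ≤ (Submodule.span ℂ A).comap (creator g : Fock H →ₗ[ℂ] Fock H) :=
      Submodule.span_le.2 fun ψ hψ => hc g hg ψ hψ
    exact map_mem_closure (creator g).continuous hψ fun ψ hψ => h2 hψ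
  have h2 : ∀ ψ ∈ (Submodule.span ℂ A).topologicalClosure, ⟪ψ, χ⟫_ℂ = 0 := by
    intro ψ hψ
    have h3 : χ ∈ (Submodule.span ℂ A)ᗮ := by
      rw [Submodule.mem_orthogonal]
      intro u hu
      refine Submodule.span_induction (p := fun u _ => ⟪u, χ⟫_ℂ = 0) hχ (by simp) ?_ ?_ hu
      · intro x y _ _ hx hy; rw [inner_add_left, hx, hy, add_zero]
      · intro a x _ hx; rw [inner_smul_left, hx, mul_zero]
    rw [← Submodule.orthogonal_closure, Submodule.mem_orthogonal] at h3
    exact h3 ψ hψ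
  exact inner_self_eq_zero.1 (h2 χ (h1 ▸ Submodule.mem_top))

end FockBasics

/-! ### The basis of Slater determinants. -/

section Slater

variable {H : Type*} [NormedAddCommGroup H] [InnerProductSpace ℂ H]

theorem wedge_eq_zero_of_not_injective {ι : Type*} (f : ι → H) {n : ℕ} {t : Fin n → ι}
    (ht : ¬ Function.Injective t) : wedge ⟨n, f ∘ t⟩ = 0 := by
  rw [Function.not_injective_iff] at ht
  obtain ⟨i, j, h, hij⟩ := ht
  exact (wedgeAlt H n).map_eq_zero_of_eq (f ∘ t) (by simp [h]) hij

/-- The scalar is the sign of the permutation that sorts the indices. -/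
theorem wedge_eq_smul_slater {ι : Type*} [LinearOrder ι] (f : ι → H) {n : ℕ} {t : Fin n → ι}
    (ht : Function.Injective t) :
    ∃ ε : ℂ, wedge ⟨n, f ∘ t⟩ = ε • slater f (Finset.univ.image t) := by
  have hc : (Finset.univ.image t).card = n := by
    rw [Finset.card_image_of_injective _ ht, Finset.card_univ, Fintype.card_fin]
  have hs : slater f (Finset.univ.image t) =
      wedge ⟨n, f ∘ (Finset.univ.image t).orderEmbOfFin hc⟩ := by
    rw [slater]
    congr 1
    refine Fin.sigma_eq_of_eq_comp_cast hc ?_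
    ext i
    simp [Finset.orderEmbOfFin_apply]
  let τ : Fin n ≃ (Finset.univ.image t : Finset ι) :=
    Equiv.ofBijective (fun i => ⟨t i, Finset.mem_image_of_mem _ (Finset.mem_univ _)⟩)
      ⟨fun i j h => ht (congrArg Subtype.val h), by
        rintro ⟨x, hx⟩
        obtain ⟨i, -, rfl⟩ := Finset.mem_image.1 hx
        exact ⟨i, rfl⟩⟩
  let σ : Equiv.Perm (Fin n) :=
    τ.trans ((Finset.univ.image t).orderIsoOfFin hc).symm.toEquiv
  have e : f ∘ t = (f ∘ (Finset.univ.image t).orderEmbOfFin hc) ∘ σ := by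
    ext i
    simp [σ, τ, Finset.orderEmbOfFin]
    rfl
  refine ⟨((Equiv.Perm.sign σ : ℤ) : ℂ), ?_⟩
  rw [hs, ← wedgeAlt_apply, e, AlternatingMap.map_perm, wedgeAlt_apply, Units.smul_def,
    Int.cast_smul_eq_zsmul]

/-- For different sets of the same size, an index of `s` that is missing in `t` gives a zero row of
the Gram matrix. -/
theorem orthonormal_slater {ι : Type*} [LinearOrder ι] {f : ι → H} (hf : Orthonormal ℂ f) :
    Orthonormal ℂ (slater f) := by
  classical
  rw [orthonormal_iff_ite]
  intro s t
  rw [slater, slater, inner_wedge_wedge]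
  have hi := orthonormal_iff_ite.1 hf
  split_ifs with h
  · subst h
    rw [gramKernel_self, ← Matrix.det_one (n := Fin s.card)]
    congr 1
    ext i j
    simp [hi, Matrix.one_apply]
  · by_cases hc : s.card = t.card
    · rw [gramKernel_of_eq hc]
      have : ¬ s ⊆ t := fun hst => h (Finset.eq_of_subset_of_card_le hst hc.ge)
      obtain ⟨a, ha, hat⟩ := Finset.not_subset.1 this
      rw [← Finset.mem_coe, ← Finset.range_orderEmbOfFin s rfl] at ha
      obtain ⟨i, rfl⟩ := ha
      refine Matrix.det_eq_zero_of_row_eq_zero i fun j => ?_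
      simp only [Matrix.of_apply]
      refine hf.2 fun h => hat ?_
      rw [h]
      exact Finset.orderEmbOfFin_mem _ _ _
    · exact gramKernel_of_ne hc _ _

/-- The Slater determinants of an orthonormal basis are an orthonormal basis of Fock space. -/
noncomputable def slaterBasis {ι : Type*} [LinearOrder ι] (f : HilbertBasis ι ℂ H) :
    HilbertBasis (Finset ι) ℂ (Fock H) :=
  HilbertBasis.mkOfOrthogonalEqBot (orthonormal_slater f.orthonormal) (by
    rw [eq_bot_iff]
    intro x hx
    rw [Submodule.mem_orthogonal] at hx
    -- Index sequences that are unsorted or have repetitions are admitted, so that the set is stable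
    -- under the creators of basis vectors.
    refine Fock.eq_zero_of_creator (A := {ψ | ∃ (n : ℕ) (t : Fin n → ι), ψ = wedge ⟨n, f ∘ t⟩})
      (G := Set.range f) ⟨0, Fin.elim0, (wedge_zero _).symm⟩ ?_ ?_ ?_
    · rw [Submodule.dense_iff_topologicalClosure_eq_top]
      exact f.dense_span
    · rintro _ ⟨i, rfl⟩ _ ⟨n, t, rfl⟩
      refine Submodule.subset_span ⟨n + 1, Fin.cons i t, ?_⟩
      rw [creator_wedge, Tuple.cons, Fin.comp_cons]
    · rintro _ ⟨n, t, rfl⟩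
      by_cases ht : Function.Injective t
      · obtain ⟨ε, hε⟩ := wedge_eq_smul_slater f ht
        rw [hε, inner_smul_left, hx _ (Submodule.subset_span ⟨_, rfl⟩), mul_zero]
      · rw [wedge_eq_zero_of_not_injective f ht, inner_zero_left])

theorem slaterBasis_apply {ι : Type*} [LinearOrder ι] (f : HilbertBasis ι ℂ H) (s : Finset ι) :
    slaterBasis f s = slater f s := by
  rw [slaterBasis, HilbertBasis.coe_mkOfOrthogonalEqBot]

end Slater

/-! ### Fock space over an orthogonal sum as a tensor product. -/

section WedgeProd

variable {H : Type*} [NormedAddCommGroup H] [InnerProductSpace ℂ H] {H₁ H₂ : Submodule ℂ H}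

theorem Fock.clm_ext₂ {F : Type*} [NormedAddCommGroup F] [NormedSpace ℂ F]
    {S T : Fock H₁ →L[ℂ] Fock H₂ →L[ℂ] F}
    (h : ∀ x y, S (wedge x) (wedge y) = T (wedge x) (wedge y)) (ξ : Fock H₁) (η : Fock H₂) :
    S ξ η = T ξ η := by
  refine DFunLike.congr_fun (Fock.clm_ext (S := S) (T := T) (fun x => ?_) ξ) η
  ext η
  exact Fock.clm_ext (h x) η

theorem wedgeProd_creator (hH : H₁ ⟂ H₂) (h : H₁) (ξ : Fock H₁) (η : Fock H₂) :
    creator (h : H) (wedgeProd H₁ H₂ ξ η) = wedgeProd H₁ H₂ (creator h ξ) η := by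
  refine Fock.clm_ext₂ (S := (ContinuousLinearMap.compL ℂ _ _ _ (creator (h : H))) ∘L
    wedgeProd H₁ H₂) (T := wedgeProd H₁ H₂ ∘L creator h) (fun x y => ?_) ξ η
  simp only [ContinuousLinearMap.comp_apply, ContinuousLinearMap.compL_apply, creator_wedge,
    wedgeProd_wedge hH]
  congr 1
  refine Fin.sigma_eq_of_eq_comp_cast (Nat.add_right_comm _ _ _).symm ?_
  have e : (fun i => ((Fin.cons h x.2 : Fin (x.1 + 1) → H₁) i : H)) =
      Fin.cons (h : H) fun i => (x.2 i : H) := by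
    ext i
    refine Fin.cases ?_ (fun i => ?_) i <;> simp
  simp only [Tuple.cons, Tuple.append]
  rw [e, Fin.append_cons]
  ext i
  simp

theorem wedgeProd_vacuum_creator (hH : H₁ ⟂ H₂) (h : H₂) (η : Fock H₂) :
    creator (h : H) (wedgeProd H₁ H₂ (vacuum H₁) η) = wedgeProd H₁ H₂ (vacuum H₁) (creator h η) := by
  refine Fock.clm_ext (S := creator (h : H) ∘L wedgeProd H₁ H₂ (vacuum H₁))
    (T := wedgeProd H₁ H₂ (vacuum H₁) ∘L creator h) (fun y => ?_) η
  simp only [ContinuousLinearMap.comp_apply, creator_wedge, wedgeProd_wedge hH, vacuum]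
  congr 1
  refine Fin.sigma_eq_of_eq_comp_cast (by simp [Tuple.cons, Tuple.append]) ?_
  simp only [Tuple.cons, Tuple.append]
  rw [Fin.append_left_nil _ _ rfl, Fin.append_left_nil _ _ rfl]
  ext i
  simp only [Function.comp_apply]
  refine Fin.cases ?_ (fun i => ?_) i
  · rfl
  · rfl

/-- Each of the `x.1` factors from `H₁` that the creator is moved past contributes a sign. -/
theorem wedgeProd_wedge_creator (hH : H₁ ⟂ H₂) (x : Tuple H₁) (h : H₂) (η : Fock H₂) :
    creator (h : H) (wedgeProd H₁ H₂ (wedge x) η) =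
      (-1 : ℂ) ^ x.1 • wedgeProd H₁ H₂ (wedge x) (creator h η) := by
  obtain ⟨n, v⟩ := x
  induction n with
  | zero => rw [wedge_zero, wedgeProd_vacuum_creator hH, pow_zero, one_smul]
  | succ n ih =>
    rw [wedge_succ, ← wedgeProd_creator hH, ← wedgeProd_creator hH, creator_creator, ih, map_smul,
      ← neg_smul]
    congr 1
    dsimp only
    ring

theorem inner_wedgeProd (hH : H₁ ⟂ H₂) (ξ : Fock H₁) (η : Fock H₂) (ξ' : Fock H₁) (η' : Fock H₂) :
    ⟪wedgeProd H₁ H₂ ξ η, wedgeProd H₁ H₂ ξ' η'⟫_ℂ = ⟪ξ, ξ'⟫_ℂ * ⟪η, η'⟫_ℂ := by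
  have key : ∀ (p : Fock H) (a : Fock H₁) (b : Fock H₂), (∀ x y,
      ⟪p, wedgeProd H₁ H₂ (wedge x) (wedge y)⟫_ℂ = ⟪a, wedge x⟫_ℂ * ⟪b, wedge y⟫_ℂ) → ∀ ξ η,
      ⟪p, wedgeProd H₁ H₂ ξ η⟫_ℂ = ⟪a, ξ⟫_ℂ * ⟪b, η⟫_ℂ := by
    intro p a b h
    refine Fock.clm_ext₂ (S := (ContinuousLinearMap.compL ℂ _ _ _ (innerSL ℂ p)) ∘L
      wedgeProd H₁ H₂) (T := (innerSL ℂ a).smulRight (innerSL ℂ b)) fun x y => ?_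
    simpa using h x y
  refine key _ _ _ (fun x y => ?_) ξ' η'
  rw [← inner_conj_symm, key _ (wedge x) (wedge y), map_mul, inner_conj_symm, inner_conj_symm]
  intro x' y'
  rw [wedgeProd_wedge hH, wedgeProd_wedge hH]
  simp only [inner_wedge_wedge, gramKernel_append hH]

/-- Fock space over an orthogonal sum is the tensor product of the Fock spaces. -/
theorem isTensor_wedgeProd (hH : H₁ ⟂ H₂) (hd : Dense ((H₁ ⊔ H₂ : Submodule ℂ H) : Set H)) :
    IsTensor (wedgeProd H₁ H₂) where
  inner_map := inner_wedgeProd hH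
  eq_zero χ hχ := by
    -- The first factor is taken to be a wedge product because a creator from `H₂` then acts on the
    -- second factor up to a definite sign.
    refine Fock.eq_zero_of_creator (G := (H₁ : Set H) ∪ H₂)
      (A := {ψ | ∃ (x : Tuple H₁) (η : Fock H₂), ψ = wedgeProd H₁ H₂ (wedge x) η})
      ⟨⟨0, Fin.elim0⟩, vacuum H₂, ?_⟩ ?_ ?_ ?_
    · rw [vacuum, vacuum, wedgeProd_wedge hH]
      exact (wedge_zero _).symm
    · rwa [Submodule.span_union, Submodule.span_eq, Submodule.span_eq]
    · rintro g (hg | hg) _ ⟨x, η, rfl⟩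
      · refine Submodule.subset_span ⟨x.cons ⟨g, hg⟩, η, ?_⟩
        rw [← creator_wedge, ← wedgeProd_creator hH]
      · rw [wedgeProd_wedge_creator hH x ⟨g, hg⟩]
        exact Submodule.smul_mem _ _ (Submodule.subset_span ⟨x, _, rfl⟩)
    · rintro _ ⟨x, η, rfl⟩
      exact hχ _ _

theorem IsTensor.ext {E₁ E₂ E : Type*} [NormedAddCommGroup E₁] [InnerProductSpace ℂ E₁]
    [NormedAddCommGroup E₂] [InnerProductSpace ℂ E₂] [NormedAddCommGroup E] [InnerProductSpace ℂ E]
    {m : E₁ →L[ℂ] E₂ →L[ℂ] E} (hm : IsTensor m) {x y : E}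
    (h : ∀ ξ η, ⟪m ξ η, x⟫_ℂ = ⟪m ξ η, y⟫_ℂ) : x = y :=
  sub_eq_zero.1 (hm.eq_zero _ fun ξ η => by rw [inner_sub_right, h, sub_self])

theorem wedgeProd_annihilator (hH : H₁ ⟂ H₂) (hm : IsTensor (wedgeProd H₁ H₂)) (h : H₁)
    (ξ : Fock H₁) (η : Fock H₂) :
    annihilator (h : H) (wedgeProd H₁ H₂ ξ η) = wedgeProd H₁ H₂ (annihilator h ξ) η := by
  refine hm.ext fun ξ' η' => ?_
  rw [inner_annihilator, wedgeProd_creator hH, hm.inner_map, hm.inner_map, inner_annihilator]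

/-- Taking the adjoint yields the sign `(-1) ^ y.1` of the test vector instead of `(-1) ^ x.1`. The
two agree whenever the inner product of `wedge x` and `wedge y` is nonzero. -/
theorem wedgeProd_wedge_annihilator (hH : H₁ ⟂ H₂) (hm : IsTensor (wedgeProd H₁ H₂))
    (x : Tuple H₁) (h : H₂) (η : Fock H₂) :
    annihilator (h : H) (wedgeProd H₁ H₂ (wedge x) η) =
      (-1 : ℂ) ^ x.1 • wedgeProd H₁ H₂ (wedge x) (annihilator h η) := by
  refine hm.ext fun ξ η' => ?_
  rw [← inner_conj_symm, ← inner_conj_symm (wedgeProd H₁ H₂ ξ η')]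
  congr 1
  refine Fock.clm_ext (S := innerSL ℂ _ ∘L (wedgeProd H₁ H₂).flip η')
    (T := innerSL ℂ _ ∘L (wedgeProd H₁ H₂).flip η') (fun y => ?_) ξ
  simp only [ContinuousLinearMap.comp_apply, ContinuousLinearMap.flip_apply, innerSL_apply_apply]
  rw [annihilator_inner, wedgeProd_wedge_creator hH, inner_smul_right, inner_smul_left,
    hm.inner_map, hm.inner_map, annihilator_inner]
  by_cases hxy : x.1 = y.1
  · rw [hxy]
    simp
  · have : ⟪wedge x, wedge y⟫_ℂ = 0 := by
      rw [inner_wedge_wedge]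
      exact gramKernel_of_ne hxy _ _
    simp [this]

/-- `a†_g a_h` acts on the first factor for `g`, `h` in the first subspace. -/
theorem wedgeProd_creator_annihilator (hH : H₁ ⟂ H₂) (hm : IsTensor (wedgeProd H₁ H₂)) (g h : H₁)
    (ξ : Fock H₁) (η : Fock H₂) : (creator (g : H) ∘L annihilator (h : H)) (wedgeProd H₁ H₂ ξ η) =
      wedgeProd H₁ H₂ ((creator g ∘L annihilator h) ξ) η := by
  rw [ContinuousLinearMap.comp_apply, wedgeProd_annihilator hH hm, wedgeProd_creator hH]
  rfl

/-- `a†_g a_h` acts on the second factor for `g`, `h` in the second subspace. -/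
theorem wedgeProd_creator_annihilator' (hH : H₁ ⟂ H₂) (hm : IsTensor (wedgeProd H₁ H₂)) (g h : H₂)
    (ξ : Fock H₁) (η : Fock H₂) : (creator (g : H) ∘L annihilator (h : H)) (wedgeProd H₁ H₂ ξ η) =
      wedgeProd H₁ H₂ ξ ((creator g ∘L annihilator h) η) := by
  refine Fock.clm_ext (S := (creator (g : H) ∘L annihilator (h : H)) ∘L (wedgeProd H₁ H₂).flip η)
    (T := (wedgeProd H₁ H₂).flip ((creator g ∘L annihilator h) η)) (fun x => ?_) ξ
  simp only [ContinuousLinearMap.comp_apply, ContinuousLinearMap.flip_apply]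
  rw [wedgeProd_wedge_annihilator hH hm, map_smul, wedgeProd_wedge_creator hH, smul_smul,
    ← mul_pow]
  simp

/-- The number operator counts the factors of a wedge product. -/
theorem hasSum_creator_annihilator_wedge [CompleteSpace H] {ι : Type*} (e : HilbertBasis ι ℂ H)
    (x : Tuple H) : HasSum (fun j => creator (e j) (annihilator (e j) (wedge x)))
      ((x.1 : ℂ) • wedge x) := by
  obtain ⟨n, v⟩ := x
  induction n with
  | zero => simp [wedge_zero, annihilator_vacuum]
  | succ n ih =>
    rw [wedge_succ]
    simp only [annihilator_creator, map_sub, map_smul]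
    -- By the anticommutation relations `N a†_v = a†_v + a†_v N`; the first summand comes from
    -- expanding `v 0` in the basis `e`.
    have h1 : HasSum (fun j => ⟪e j, v 0⟫_ℂ • creator (e j) (wedge ⟨n, Fin.tail v⟩))
        (creator (v 0) (wedge ⟨n, Fin.tail v⟩)) := by
      have := (e.hasSum_repr (v 0)).mapL (creatorAt (wedge ⟨n, Fin.tail v⟩))
      simpa only [map_smul, creatorAt_apply, e.repr_apply_apply] using this
    have h2 := h1.add ((ih (Fin.tail v)).mapL (creator (v 0)))
    have e1 : (((n + 1 : ℕ) : ℂ) • creator (v 0) (wedge ⟨n, Fin.tail v⟩)) =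
        creator (v 0) (wedge ⟨n, Fin.tail v⟩) +
          creator (v 0) ((n : ℂ) • wedge ⟨n, Fin.tail v⟩) := by
      rw [map_smul, Nat.cast_succ, add_smul, one_smul, add_comm]
    rw [e1]
    refine h2.congr_fun fun j => ?_
    rw [creator_creator (e j), sub_neg_eq_add]

end WedgeProd

/-! ### Infinite products and the total weight of a free state. -/

section Weights

theorem prod_le_prod_of_subset_Icc {ι : Type*} {q : ι → ℝ} (hq : ∀ i, q i ∈ Set.Icc (0 : ℝ) 1)
    {S T : Finset ι} (h : S ⊆ T) : ∏ i ∈ T, q i ≤ ∏ i ∈ S, q i := by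
  classical
  rw [← Finset.prod_sdiff h]
  exact mul_le_of_le_one_left (Finset.prod_nonneg fun i _ => (hq i).1)
    (Finset.prod_le_one (fun i _ => (hq i).1) fun i _ => (hq i).2)

/-- The finite products decrease to their infimum, possibly `0`. Hence the infinite product in
`freeWeight` is a genuine limit and not a default value. -/
theorem multipliable_of_mem_Icc {ι : Type*} {q : ι → ℝ} (hq : ∀ i, q i ∈ Set.Icc (0 : ℝ) 1) :
    Multipliable q := by
  refine ⟨⨅ S : Finset ι, ∏ i ∈ S, q i, ?_⟩
  rw [HasProd, SummationFilter.unconditional_filter]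
  refine tendsto_atTop_ciInf (fun S T h => prod_le_prod_of_subset_Icc hq h) ⟨0, ?_⟩
  rintro _ ⟨S, rfl⟩
  exact Finset.prod_nonneg fun i _ => (hq i).1

theorem hasProd_le_prod {ι : Type*} {q : ι → ℝ} (hq : ∀ i, q i ∈ Set.Icc (0 : ℝ) 1) {a : ℝ}
    (h : HasProd q a) (S : Finset ι) : a ≤ ∏ i ∈ S, q i := by
  rw [HasProd, SummationFilter.unconditional_filter] at h
  exact le_of_tendsto h ((Filter.eventually_ge_atTop S).mono fun T hT =>
    prod_le_prod_of_subset_Icc hq hT)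

theorem hasProd_nonneg {ι : Type*} {q : ι → ℝ} (hq : ∀ i, q i ∈ Set.Icc (0 : ℝ) 1) {a : ℝ}
    (h : HasProd q a) : 0 ≤ a := by
  rw [HasProd, SummationFilter.unconditional_filter] at h
  exact ge_of_tendsto' h fun T => Finset.prod_nonneg fun i _ => (hq i).1

theorem one_sub_mem_Icc {x : ℝ} (h : x ∈ Set.Icc (0 : ℝ) 1) : 1 - x ∈ Set.Icc (0 : ℝ) 1 :=
  ⟨by linarith [h.2], by linarith [h.1]⟩

variable {ι : Type*} [DecidableEq ι] {p : ι → ℝ}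

theorem ite_mem_Icc (hp : ∀ i, p i ∈ Set.Icc (0 : ℝ) 1) (s : Finset ι) (i : ι) :
    (if i ∈ s then p i else 1 - p i) ∈ Set.Icc (0 : ℝ) 1 := by
  split_ifs
  exacts [hp i, one_sub_mem_Icc (hp i)]

/-- The weight as a single product over all indices. -/
theorem hasProd_freeWeight (hp : ∀ i, p i ∈ Set.Icc (0 : ℝ) 1) (s : Finset ι) :
    HasProd (fun i => if i ∈ s then p i else 1 - p i) (freeWeight p s) := by
  refine HasProd.mul_isCompl (s := (s : Set ι)) isCompl_compl ?_ ?_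
  · have h := s.hasProd (fun i => if i ∈ s then p i else 1 - p i)
    rwa [Finset.prod_congr rfl fun i hi => if_pos hi] at h
  · have h := (multipliable_of_mem_Icc (q := fun j : {j // j ∉ s} => 1 - p j)
      fun j => one_sub_mem_Icc (hp j)).hasProd
    refine h.congr_fun fun j => ?_
    exact if_neg j.2

theorem freeWeight_nonneg (hp : ∀ i, p i ∈ Set.Icc (0 : ℝ) 1) (s : Finset ι) :
    0 ≤ freeWeight p s :=
  hasProd_nonneg (ite_mem_Icc hp s) (hasProd_freeWeight hp s)

/-- Let `U` be the union of the sets in `F`. Discarding the factors outside `U` only enlarges a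
weight, and the truncated weights of all subsets of `U` add up to `∏ (p i + (1 - p i)) = 1`. -/
theorem sum_freeWeight_le_one (hp : ∀ i, p i ∈ Set.Icc (0 : ℝ) 1) (F : Finset (Finset ι)) :
    ∑ s ∈ F, freeWeight p s ≤ 1 := by
  have h1 : ∀ s ∈ (F.sup id).powerset, freeWeight p s ≤
      (∏ i ∈ s, p i) * ∏ i ∈ F.sup id \ s, (1 - p i) := by
    intro s hs
    have h := hasProd_le_prod (ite_mem_Icc hp s) (hasProd_freeWeight hp s) (F.sup id)
    rw [← Finset.prod_sdiff (Finset.mem_powerset.1 hs), mul_comm,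
      Finset.prod_congr rfl fun i (hi : i ∈ s) => if_pos hi,
      Finset.prod_congr rfl fun i (hi : i ∈ F.sup id \ s) => if_neg (Finset.mem_sdiff.1 hi).2] at h
    exact h
  calc ∑ s ∈ F, freeWeight p s ≤ ∑ s ∈ (F.sup id).powerset, freeWeight p s :=
        Finset.sum_le_sum_of_subset_of_nonneg
          (fun s hs => Finset.mem_powerset.2 (Finset.le_sup (f := id) hs))
          fun s _ _ => freeWeight_nonneg hp s
    _ ≤ ∑ s ∈ (F.sup id).powerset, (∏ i ∈ s, p i) * ∏ i ∈ F.sup id \ s, (1 - p i) :=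
        Finset.sum_le_sum h1
    _ = 1 := by
        rw [← Finset.prod_add]
        simp

theorem summable_freeWeight (hp : ∀ i, p i ∈ Set.Icc (0 : ℝ) 1) : Summable (freeWeight p) :=
  summable_of_sum_le (freeWeight_nonneg hp) (sum_freeWeight_le_one hp)

theorem tsum_freeWeight_le_one (hp : ∀ i, p i ∈ Set.Icc (0 : ℝ) 1) : ∑' s, freeWeight p s ≤ 1 :=
  (summable_freeWeight hp).tsum_le_of_sum_le (sum_freeWeight_le_one hp)

/-- The weights are multiplicative. -/
theorem freeWeight_disjSum {ι' : Type*} [DecidableEq ι'] {p' : ι' → ℝ}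
    (hp : ∀ i, p i ∈ Set.Icc (0 : ℝ) 1) (hp' : ∀ i, p' i ∈ Set.Icc (0 : ℝ) 1) (s : Finset ι)
    (s' : Finset ι') :
    freeWeight (Sum.elim p p') (s.disjSum s') = freeWeight p s * freeWeight p' s' := by
  have h : ∀ i, Sum.elim p p' i ∈ Set.Icc (0 : ℝ) 1 := by
    rintro (i | i)
    exacts [hp i, hp' i]
  refine (hasProd_freeWeight h _).unique (HasProd.sum ?_ ?_)
  · refine (hasProd_freeWeight hp s).congr_fun fun i => ?_
    simp
  · refine (hasProd_freeWeight hp' s').congr_fun fun i => ?_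
    simp

end Weights

/-! ### The weights depend on the multiplicities of nonzero eigenvalues only. -/

section Multiplicities

theorem ncard_diff_map {κ : Type*} {q : κ → ℝ} {c : ℝ} (h : {i | q i = c}.Finite) {n : ℕ}
    (v : Fin n ↪ κ) : {i | i ∉ Finset.univ.map v ∧ q i = c}.ncard + {k | q (v k) = c}.ncard =
      {i | q i = c}.ncard := by
  have hf : {i | i ∉ Finset.univ.map v ∧ q i = c}.Finite := h.subset fun i hi => hi.2
  rw [← Set.ncard_image_of_injective _ v.injective,
    ← Set.ncard_union_eq ?_ hf (Set.toFinite _)]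
  · congr 1
    ext i
    simp only [Set.mem_union, Set.mem_image, Set.mem_ofPred_eq, Finset.mem_map, Finset.mem_univ,
      true_and]
    constructor
    · rintro (⟨-, h⟩ | ⟨k, h, rfl⟩) <;> exact h
    · intro h
      by_cases hi : ∃ k, v k = i
      · obtain ⟨k, rfl⟩ := hi
        exact Or.inr ⟨k, h, rfl⟩
      · exact Or.inl ⟨hi, h⟩
  · rw [Set.disjoint_left]
    rintro _ ⟨h, -⟩ ⟨k, -, rfl⟩
    exact h (Finset.mem_map_of_mem _ (Finset.mem_univ k))

/-- The fibres over nonzero values in the support of a product of factors `1 - q j`. -/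
noncomputable def fiberEquiv {κ : Type*} (q : κ → ℝ) {c : ℝ} (hc : c ≠ 0) (s : Finset κ) :
    {x : Function.mulSupport fun j : {j // j ∉ s} => 1 - q j // q x = c} ≃
      {i | i ∉ s ∧ q i = c} where
  toFun x := ⟨x.1.1.1, x.1.1.2, x.2⟩
  invFun x := ⟨⟨⟨x.1, x.2.1⟩, by
    rw [Function.mem_mulSupport]
    simpa [x.2.2] using hc⟩, x.2.2⟩
  left_inv _ := rfl
  right_inv _ := rfl

/-- The weight depends only on the multiplicities of the nonzero values of `p`, and on the values
of `p` on `s`. -/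
theorem freeWeight_map_eq {ι ι' : Type*} {p : ι → ℝ} {p' : ι' → ℝ}
    (h : ∀ c ≠ 0, {i | p i = c}.Finite ∧ {i | p' i = c}.Finite ∧
      {i | p i = c}.ncard = {i | p' i = c}.ncard) {n : ℕ} (u : Fin n ↪ ι) (t : Fin n ↪ ι')
    (hut : ∀ k, p (u k) = p' (t k)) :
    freeWeight p (Finset.univ.map u) = freeWeight p' (Finset.univ.map t) := by
  rw [freeWeight, freeWeight, Finset.prod_map, Finset.prod_map, Finset.prod_congr rfl
    fun k _ => hut k]
  congr 1
  have key : ∀ c, Nonempty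
      ({x : Function.mulSupport fun j : {j // j ∉ Finset.univ.map u} => 1 - p j // p x = c} ≃
      {x : Function.mulSupport fun j : {j // j ∉ Finset.univ.map t} => 1 - p' j // p' x = c}) := by
    intro c
    by_cases hc : c = 0
    · subst hc
      -- Indices with `p = 0` contribute the factor `1` and lie outside the multiplicative support,
      -- so the multiplicity of `0`, which may be infinite, plays no role.
      have h1 : IsEmpty {x : Function.mulSupport
          fun j : {j // j ∉ Finset.univ.map u} => 1 - p j // p x = 0} :=
        ⟨fun x => x.1.2 (by simp [x.2])⟩
      have h2 : IsEmpty {x : Function.mulSupport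
          fun j : {j // j ∉ Finset.univ.map t} => 1 - p' j // p' x = 0} :=
        ⟨fun x => x.1.2 (by simp [x.2])⟩
      exact ⟨Equiv.equivOfIsEmpty _ _⟩
    · obtain ⟨h1, h2, h3⟩ := h c hc
      have h4 := ncard_diff_map h1 u
      have h5 := ncard_diff_map h2 t
      simp only [hut] at h4
      have : Finite {i | i ∉ Finset.univ.map u ∧ p i = c} := h1.subset fun i hi => hi.2
      have : Finite {i | i ∉ Finset.univ.map t ∧ p' i = c} := h2.subset fun i hi => hi.2
      obtain ⟨e⟩ := Finite.card_eq.1 (show Nat.card {i | i ∉ Finset.univ.map u ∧ p i = c} =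
        Nat.card {i | i ∉ Finset.univ.map t ∧ p' i = c} by
          rw [Nat.card_coe_set_eq, Nat.card_coe_set_eq]; omega)
      exact ⟨(fiberEquiv p hc _).trans (e.trans (fiberEquiv p' hc _).symm)⟩
  refine (Equiv.ofFiberEquiv fun c => (key c).some).tprod_eq_tprod_of_mulSupport fun x => ?_
  exact congrArg (1 - ·) (Equiv.ofFiberEquiv_map (fun c => (key c).some) x)

end Multiplicities

/-! ### The free density operator in an arbitrary eigenbasis. -/

section Density

variable {H : Type*} [NormedAddCommGroup H] [InnerProductSpace ℂ H]

theorem HasGram.summable_eigenvalue [CompleteSpace H] {κ : Type*} {y : κ → H} {γ : H →L[ℂ] H}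
    (hγ : HasGram y γ) {ι : Type*} {f : HilbertBasis ι ℂ H} {p : ι → ℝ}
    (hf : IsEigenbasis γ f p) : Summable p := by
  have h := (hasTrace_apply hγ.hasTrace f).summable
  refine Complex.summable_ofReal.1 (h.congr fun i => ?_)
  rw [hf i, inner_smul_right, inner_self_ofReal, HilbertBasis.norm_apply]
  simp

theorem finite_setOf_eq {ι : Type*} {p : ι → ℝ} (h : Summable p) {c : ℝ} (hc : c ≠ 0) :
    {i | p i = c}.Finite := by
  have h1 := h.tendsto_cofinite_zero.eventually (isOpen_ne.mem_nhds hc.symm)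
  refine h1.subset fun i hi => ?_
  simpa using hi

theorem inner_eq_zero_of_eigenvalue_ne {γ : H →L[ℂ] H} {ι ι' : Type*} {f : HilbertBasis ι ℂ H}
    {p : ι → ℝ} (hf : IsEigenbasis γ f p) {f' : HilbertBasis ι' ℂ H} {p' : ι' → ℝ}
    (hf' : IsEigenbasis γ f' p') {i : ι} {j : ι'} (h : p i ≠ p' j) : ⟪f i, f' j⟫_ℂ = 0 := by
  have h1 := inner_apply_of_isEigenbasis hf i (f' j)
  rw [hf' j, inner_smul_right] at h1
  by_contra h0
  exact h (by exact_mod_cast (mul_right_cancel₀ h0 h1).symm)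

/-- Parseval for `f i`, whose coefficients vanish at vectors of other eigenvalues. Summing over the
eigenvalue `c` in both bases counts its multiplicity twice. -/
theorem sum_norm_sq_eigenspace {γ : H →L[ℂ] H} {ι ι' : Type*} {f : HilbertBasis ι ℂ H}
    {p : ι → ℝ} (hf : IsEigenbasis γ f p) {f' : HilbertBasis ι' ℂ H} {p' : ι' → ℝ}
    (hf' : IsEigenbasis γ f' p') {c : ℝ} {S : Finset ι'} (hS : ∀ j, j ∈ S ↔ p' j = c) {i : ι}
    (hi : p i = c) : ∑ j ∈ S, ‖⟪f i, f' j⟫_ℂ‖ ^ 2 = 1 := by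
  have h1 := HilbertBasis.hasSum_norm_sq f' (f i)
  rw [HilbertBasis.norm_apply, one_pow] at h1
  refine HasSum.unique ?_ (h1.congr_fun fun j => by rw [norm_inner_symm])
  refine hasSum_sum_of_ne_finset_zero fun j hj => ?_
  rw [inner_eq_zero_of_eigenvalue_ne hf hf' fun e => hj ((hS j).2 (e ▸ hi))]
  simp

/-- The multiplicities of the nonzero eigenvalues do not depend on the eigenbasis. -/
theorem ncard_eigenvalue_eq {γ : H →L[ℂ] H} {ι ι' : Type*} {f : HilbertBasis ι ℂ H}
    {p : ι → ℝ} (hf : IsEigenbasis γ f p) {f' : HilbertBasis ι' ℂ H} {p' : ι' → ℝ}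
    (hf' : IsEigenbasis γ f' p') {c : ℝ} (h : {i | p i = c}.Finite) (h' : {i | p' i = c}.Finite) :
    {i | p i = c}.ncard = {i | p' i = c}.ncard := by
  rw [Set.ncard_eq_toFinset_card _ h, Set.ncard_eq_toFinset_card _ h']
  have h1 : (∑ i ∈ h.toFinset, ∑ j ∈ h'.toFinset, ‖⟪f i, f' j⟫_ℂ‖ ^ 2) = h.toFinset.card := by
    rw [Finset.sum_congr rfl fun i hi => sum_norm_sq_eigenspace hf hf' (S := h'.toFinset) (c := c) (fun j => by simp) (by simpa using hi)]
    simp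
  have h2 : (∑ i ∈ h.toFinset, ∑ j ∈ h'.toFinset, ‖⟪f i, f' j⟫_ℂ‖ ^ 2) = h'.toFinset.card := by
    rw [Finset.sum_comm]
    simp only [norm_inner_symm (f _)]
    rw [Finset.sum_congr rfl fun i hi => sum_norm_sq_eigenspace hf' hf (S := h.toFinset) (c := c) (fun j => by simp) (by simpa using hi)]
    simp
  exact_mod_cast h1.symm.trans h2

theorem isEigenbasis_slaterBasis {ι : Type*} [LinearOrder ι] {f : HilbertBasis ι ℂ H}
    {p : ι → ℝ} {G : Fock H →L[ℂ] Fock H} (hG : HasSum (fun s : Finset ι =>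
      (freeWeight p s : ℂ) • InnerProductSpace.rankOne ℂ (slater f s) (slater f s)) G) :
    IsEigenbasis G (slaterBasis f) (freeWeight p) := by
  intro s
  have h1 := hG.mapL (ContinuousLinearMap.apply ℂ (Fock H) (slaterBasis f s))
  refine h1.unique ?_
  convert hasSum_single s fun s' hs' => ?_ using 1
  · simp [slaterBasis_apply, (orthonormal_slater f.orthonormal).1]
  · simp [slaterBasis_apply, (orthonormal_slater f.orthonormal).2 hs']

theorem exists_isFreeDensity [CompleteSpace H] {γ : H →L[ℂ] H} {w : Set H}
    {f : HilbertBasis w ℂ H} {p : w → ℝ} (hf : IsEigenbasis γ f p)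
    (hp : ∀ i, p i ∈ Set.Icc (0 : ℝ) 1) : ∃ G, IsFreeDensity γ G := by
  -- Any order will do: reordering changes a Slater determinant by a sign, which cancels in the rank
  -- one operator.
  let _ : LinearOrder w := IsWellOrder.linearOrder WellOrderingRel
  have h : Summable fun s : Finset w =>
      (freeWeight p s : ℂ) • InnerProductSpace.rankOne ℂ (slater f s) (slater f s) := by
    refine Summable.of_norm ((summable_freeWeight hp).congr fun s => ?_)
    rw [norm_smul, InnerProductSpace.norm_rankOne, (orthonormal_slater f.orthonormal).1]
    simp [abs_of_nonneg (freeWeight_nonneg hp s)]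
  exact ⟨_, w, inferInstance, f, p, hf, h.hasSum⟩

/-- Wedge products of eigenvectors of `γ` are eigenvectors of the free density operator. -/
theorem IsFreeDensity.apply_wedge [CompleteSpace H] {γ : H →L[ℂ] H} {G : Fock H →L[ℂ] Fock H}
    (hG : IsFreeDensity γ G) {κ : Type*} {y : κ → H} (hγ : HasGram y γ) {ι : Type*}
    {f : HilbertBasis ι ℂ H} {p : ι → ℝ} (hf : IsEigenbasis γ f p) {n : ℕ} (t : Fin n ↪ ι) :
    G (wedge ⟨n, f ∘ t⟩) = (freeWeight p (Finset.univ.map t) : ℂ) • wedge ⟨n, f ∘ t⟩ := by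
  obtain ⟨w, _, f', p', hf', hs⟩ := hG
  have hE := isEigenbasis_slaterBasis hs
  refine HilbertBasis.ext_inner (slaterBasis f') fun s => ?_
  rw [inner_apply_of_isEigenbasis hE, inner_smul_right]
  -- Only those Slater determinants of the chosen basis `f'` matter that are not orthogonal to the
  -- wedge product, and for these the weights must coincide.
  by_cases h0 : ⟪slaterBasis f' s, wedge ⟨n, f ∘ t⟩⟫_ℂ = 0
  · rw [h0, mul_zero, mul_zero]
  congr 2
  rw [slaterBasis_apply, slater, inner_wedge_wedge] at h0
  have hc : s.card = n := by
    by_contra hc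
    exact h0 (gramKernel_of_ne hc _ _)
  subst hc
  rw [gramKernel_self, Matrix.det_apply] at h0
  -- A nonzero term of the determinant matches the two families of vectors in pairs that are not
  -- orthogonal. Eigenvectors in such a pair have the same eigenvalue.
  obtain ⟨σ, -, hσ⟩ := Finset.exists_ne_zero_of_sum_ne_zero h0
  have hσ := right_ne_zero_of_smul hσ
  rw [Finset.prod_ne_zero_iff] at hσ
  have e : Finset.univ.map (σ.toEmbedding.trans (s.orderEmbOfFin rfl).toEmbedding) = s := by
    rw [← Finset.map_map, Finset.map_univ_equiv, Finset.map_orderEmbOfFin_univ]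
  refine (congrArg (freeWeight p') e.symm).trans ?_
  refine freeWeight_map_eq (fun c hc => ?_) _ _ fun k => ?_
  · have h1 := finite_setOf_eq (hγ.summable_eigenvalue hf') hc
    have h2 := finite_setOf_eq (hγ.summable_eigenvalue hf) hc
    exact ⟨h1, h2, ncard_eigenvalue_eq hf' hf h1 h2⟩
  · by_contra hne
    exact hσ k (Finset.mem_univ k) (inner_eq_zero_of_eigenvalue_ne hf' hf hne)

end Density

/-! ### Existence and eigenvalues of the one-particle operator. -/

section OneParticle

variable {H : Type*} [NormedAddCommGroup H] [InnerProductSpace ℂ H]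

theorem hasTrace_creator_annihilator [CompleteSpace H] {κ : Type*} {x : κ → Fock H}
    {D : Fock H →L[ℂ] Fock H} (hx : HasGram x D) (g h : H) :
    HasTrace (D ∘L creator g ∘L annihilator h)
      (∑' k, ⟪annihilator g (x k), annihilator h (x k)⟫_ℂ) := by
  have h1 := hx.hasTrace_comp (creator g ∘L annihilator h)
  simpa only [ContinuousLinearMap.comp_apply, ← annihilator_inner] using h1

variable [CompleteSpace H]

theorem oneParticleOp_eq {D : Fock H →L[ℂ] Fock H} {γ : H →L[ℂ] H} (h : IsOneParticleOp D γ) :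
    oneParticleOp D = γ := by
  have h1 : IsOneParticleOp D (oneParticleOp D) := Classical.epsilon_spec ⟨γ, h⟩
  ext g
  exact ext_inner_left ℂ fun u => hasTrace_unique (h1 g u) (h g u)

theorem summable_norm_annihilator_sq {κ : Type*} {x : κ → Fock H}
    (hx : Summable fun k => ‖x k‖ ^ 2) (h : H) : Summable fun k => ‖annihilator h (x k)‖ ^ 2 := by
  refine Summable.of_nonneg_of_le (fun k => by positivity) (fun k => ?_) (hx.mul_left (‖h‖ ^ 2))
  rw [← mul_pow]
  gcongr
  exact norm_annihilator_le h (x k)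

theorem IsOneParticleOp.inner_eq {κ : Type*} {x : κ → Fock H} {D : Fock H →L[ℂ] Fock H}
    (hx : HasGram x D) {γ : H →L[ℂ] H} (h : IsOneParticleOp D γ) (g u : H) :
    ⟪u, γ g⟫_ℂ = ∑' k, ⟪annihilator g (x k), annihilator u (x k)⟫_ℂ :=
  hasTrace_unique (h g u) (hasTrace_creator_annihilator hx g u)

/-- Pauli's principle: the eigenvalues of the `1`-particle operator are in `[0, 1]`. -/
theorem IsOneParticleOp.eigenvalue_mem_Icc {κ : Type*} {x : κ → Fock H} {D : Fock H →L[ℂ] Fock H}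
    (hx : HasGram x D) (h1 : ∑' k, ‖x k‖ ^ 2 = 1) {γ : H →L[ℂ] H} (h : IsOneParticleOp D γ)
    {ι : Type*} {f : HilbertBasis ι ℂ H} {p : ι → ℝ} (hf : IsEigenbasis γ f p) (i : ι) :
    p i ∈ Set.Icc (0 : ℝ) 1 := by
  have h2 := h.inner_eq hx (f i) (f i)
  simp only [inner_self_ofReal, ← Complex.ofReal_tsum] at h2
  rw [hf i, inner_smul_right, inner_self_ofReal, HilbertBasis.norm_apply, one_pow,
    ← Complex.ofReal_mul, mul_one, Complex.ofReal_inj] at h2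
  -- The eigenvalue is `∑ ‖a_f (x k)‖²` with `f` a unit vector, and `‖a_f‖ ≤ 1`.
  rw [h2]
  refine ⟨tsum_nonneg fun k => by positivity, h1 ▸ ?_⟩
  refine (summable_norm_annihilator_sq hx.summable _).tsum_le_tsum (fun k => ?_) hx.summable
  have h3 := norm_annihilator_le (f i) (x k)
  rw [HilbertBasis.norm_apply, one_mul] at h3
  gcongr

/-- States of finite mean particle number have a trace class `1`-particle operator. -/
theorem exists_isOneParticleOp {κ : Type*} {x : κ → Fock H} {D : Fock H →L[ℂ] Fock H}
    (hx : HasGram x D) (hD : meanNumber D < ⊤) :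
    ∃ (y : κ × stdIndex (Fock H) → H) (γ : H →L[ℂ] H), HasGram y γ ∧ IsOneParticleOp D γ := by
  let b := stdBasis (Fock H)
  -- For fixed `k`, the vectors `y (k, i)` record the coordinates of the antilinear map `u ↦ a_u (x
  -- k)` in the basis `b`, so that `γ = ∑ |y⟩⟨y|` has the required matrix elements.
  let y : κ × stdIndex (Fock H) → H := fun p => (creatorAt (b p.2)).adjoint (x p.1)
  have hy : ∀ u p, ⟪u, y p⟫_ℂ = ⟪b p.2, annihilator u (x p.1)⟫_ℂ := by
    intro u p
    rw [ContinuousLinearMap.adjoint_inner_right, creatorAt_apply, inner_annihilator]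
  have h1 : ∀ j i, ENNReal.ofReal (⟪b i, annihilator (stdBasis H j)
      (D (creator (stdBasis H j) (b i)))⟫_ℂ).re =
      ∑' k, ENNReal.ofReal (‖⟪stdBasis H j, y (k, i)⟫_ℂ‖ ^ 2) := by
    intro j i
    rw [inner_annihilator]
    have h2 := hx.hasSum (creator (stdBasis H j) (b i)) (creator (stdBasis H j) (b i))
    have h3 : ∀ k, ⟪creator (stdBasis H j) (b i), x k⟫_ℂ * ⟪x k, creator (stdBasis H j) (b i)⟫_ℂ =
        ((‖⟪stdBasis H j, y (k, i)⟫_ℂ‖ ^ 2 : ℝ) : ℂ) := by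
      intro k
      rw [hy, inner_annihilator, ← inner_conj_symm (x k), Complex.mul_conj,
        Complex.normSq_eq_norm_sq]
    simp only [h3] at h2
    have h4 := h2.mapL Complex.reCLM
    simp only [Complex.reCLM_apply, Complex.ofReal_re] at h4
    rw [← h4.tsum_eq, ENNReal.ofReal_tsum_of_nonneg (fun k => by positivity) h4.summable]
  -- The trace of the operator to be constructed is the mean particle number, by Parseval and
  -- exchange of nonnegative sums.
  have h2 : ∑' p, ENNReal.ofReal (‖y p‖ ^ 2) ≠ ⊤ := by
    refine ne_of_eq_of_ne ?_ hD.ne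
    calc ∑' p, ENNReal.ofReal (‖y p‖ ^ 2)
        = ∑' (p) (j), ENNReal.ofReal (‖⟪stdBasis H j, y p⟫_ℂ‖ ^ 2) :=
          tsum_congr fun p => (HilbertBasis.tsum_ofReal_norm_sq _ _).symm
      _ = ∑' (j) (k) (i), ENNReal.ofReal (‖⟪stdBasis H j, y (k, i)⟫_ℂ‖ ^ 2) := by
          rw [ENNReal.tsum_comm]
          exact tsum_congr fun j => ENNReal.tsum_prod (f := fun k i =>
            ENNReal.ofReal (‖⟪stdBasis H j, y (k, i)⟫_ℂ‖ ^ 2))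
      _ = meanNumber D := by
          refine tsum_congr fun j => ?_
          rw [ENNReal.tsum_comm]
          exact tsum_congr fun i => (h1 j i).symm
  have hS : Summable fun p => ‖y p‖ ^ 2 := by
    have := ENNReal.summable_toReal h2
    simpa using this
  obtain ⟨γ, hγ⟩ := exists_hasGram hS
  refine ⟨y, γ, hγ, fun g u => ?_⟩
  have h3 : HasSum (fun k => ⟪annihilator g (x k), annihilator u (x k)⟫_ℂ) ⟪u, γ g⟫_ℂ := by
    refine (hγ.hasSum u g).prod_fiberwise fun k => ?_
    refine (b.hasSum_inner_mul_inner (annihilator g (x k)) (annihilator u (x k))).congr_fun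
      fun i => ?_
    rw [hy, ← inner_conj_symm _ g, hy, inner_conj_symm, mul_comm]
  rw [← h3.tsum_eq]
  exact hasTrace_creator_annihilator hx g u

/-- The free density operator of a state of finite mean particle number exists. -/
theorem isFreeDensity_freeDensity {κ κ' : Type*} {x : κ → Fock H} {D : Fock H →L[ℂ] Fock H}
    (hx : HasGram x D) (h1 : ∑' k, ‖x k‖ ^ 2 = 1) {y : κ' → H} {γ : H →L[ℂ] H} (hy : HasGram y γ)
    (h : IsOneParticleOp D γ) : IsFreeDensity γ (freeDensity γ) := by
  obtain ⟨w, f, p, hf⟩ := exists_isEigenbasis hy.isCompactOperator hy.isPositive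
  exact Classical.epsilon_spec (exists_isFreeDensity hf (h.eigenvalue_mem_Icc hx h1 hf))

end OneParticle

/-! ### Block decomposition of one-particle operators. -/

section Compression

variable {H : Type*} [NormedAddCommGroup H] [InnerProductSpace ℂ H] [CompleteSpace H]

/-- The compression of an operator to a closed subspace. -/
noncomputable def compression (K : Submodule ℂ H) [CompleteSpace K] (γ : H →L[ℂ] H) : K →L[ℂ] K :=
  K.subtypeL.adjoint ∘L γ ∘L K.subtypeL

theorem inner_compression (K : Submodule ℂ H) [CompleteSpace K] (γ : H →L[ℂ] H) (u v : K) :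
    ⟪u, compression K γ v⟫_ℂ = ⟪(u : H), γ v⟫_ℂ := by
  rw [compression, ContinuousLinearMap.comp_apply, ContinuousLinearMap.adjoint_inner_right]
  rfl

theorem HasGram.compression {K : Submodule ℂ H} [CompleteSpace K] {γ : H →L[ℂ] H} {κ : Type*}
    {y : κ → H} (h : HasGram y γ) :
    HasGram (fun k => K.subtypeL.adjoint (y k)) (Fermion.compression K γ) where
  summable := by
    refine Summable.of_nonneg_of_le (fun k => by positivity) (fun k => ?_)
      (h.summable.mul_left (‖K.subtypeL.adjoint‖ ^ 2))
    rw [← mul_pow]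
    gcongr
    exact ContinuousLinearMap.le_opNorm _ _
  hasSum u v := by
    simp only [ContinuousLinearMap.adjoint_inner_right, ContinuousLinearMap.adjoint_inner_left,
      inner_compression]
    exact h.hasSum u v

/-- If the compression of `γ` has no off-diagonal part, it is the restriction of `γ`. -/
theorem coe_compression {K : Submodule ℂ H} [CompleteSpace K] {γ : H →L[ℂ] H}
    (h : ∀ v ∈ K, ∀ u ∈ Kᗮ, ⟪u, γ v⟫_ℂ = 0) (v : K) : (compression K γ v : H) = γ v := by
  refine ext_inner_left ℂ fun u => ?_
  obtain ⟨a, ha, c, hc, rfl⟩ := K.exists_add_mem_mem_orthogonal u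
  rw [inner_add_left, inner_add_left, h v v.2 c hc,
    Submodule.inner_left_of_mem_orthogonal (compression K γ v).2 hc]
  congr 1
  exact inner_compression K γ ⟨a, ha⟩ v

/-- The union of orthonormal bases of a closed subspace and its complement. -/
noncomputable def sumBasis (K : Submodule ℂ H) [CompleteSpace K] {ι₁ ι₂ : Type*}
    (f₁ : HilbertBasis ι₁ ℂ K) (f₂ : HilbertBasis ι₂ ℂ Kᗮ) : HilbertBasis (ι₁ ⊕ ι₂) ℂ H :=
  HilbertBasis.mkOfOrthogonalEqBot
    (v := Sum.elim (fun i => (f₁ i : H)) (fun i => (f₂ i : H))) (by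
      constructor
      · rintro (i | i)
        exacts [f₁.orthonormal.1 i, f₂.orthonormal.1 i]
      · rintro (i | i) (j | j) hij
        · exact f₁.orthonormal.2 (fun h => hij (by rw [h]))
        · exact Submodule.inner_right_of_mem_orthogonal (f₁ i).2 (f₂ j).2
        · exact Submodule.inner_left_of_mem_orthogonal (f₁ j).2 (f₂ i).2
        · exact f₂.orthonormal.2 (fun h => hij (by rw [h]))) (by
    rw [eq_bot_iff]
    intro x hx
    rw [Submodule.mem_orthogonal] at hx
    obtain ⟨a, ha, c, hc, rfl⟩ := K.exists_add_mem_mem_orthogonal x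
    have h1 : (⟨a, ha⟩ : K) = 0 := HilbertBasis.ext_inner f₁ fun i => by
      have := hx _ (Submodule.subset_span ⟨Sum.inl i, rfl⟩)
      rw [Sum.elim_inl, inner_add_right,
        Submodule.inner_right_of_mem_orthogonal (f₁ i).2 hc, add_zero] at this
      rw [inner_zero_right]
      exact this
    have h2 : (⟨c, hc⟩ : Kᗮ) = 0 := HilbertBasis.ext_inner f₂ fun i => by
      have := hx _ (Submodule.subset_span ⟨Sum.inr i, rfl⟩)
      rw [Sum.elim_inr, inner_add_right,
        Submodule.inner_left_of_mem_orthogonal ha (f₂ i).2, zero_add] at this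
      rw [inner_zero_right]
      exact this
    have h1' : a = 0 := congrArg Subtype.val h1
    have h2' : c = 0 := congrArg Subtype.val h2
    simp [h1', h2'])

theorem coe_sumBasis (K : Submodule ℂ H) [CompleteSpace K] {ι₁ ι₂ : Type*}
    (f₁ : HilbertBasis ι₁ ℂ K) (f₂ : HilbertBasis ι₂ ℂ Kᗮ) :
    ⇑(sumBasis K f₁ f₂) = Sum.elim (fun i => (f₁ i : H)) (fun i => (f₂ i : H)) :=
  HilbertBasis.coe_mkOfOrthogonalEqBot _ _

end Compression

/-! ### Vanishing of the off-diagonal block for definite particle number. -/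

section DefiniteNumber

variable {H : Type*} [NormedAddCommGroup H] [InnerProductSpace ℂ H] [CompleteSpace H]
  {H₁ : Submodule ℂ H} [CompleteSpace H₁]

/-- An operator of definite particle number `n` in `H₁` vanishes on the other sectors. -/
theorem inner_eq_zero_of_hasDefiniteValue (hm : IsTensor (wedgeProd H₁ H₁ᗮ))
    {κ : Type*} {x : κ → Fock H} {D : Fock H →L[ℂ] Fock H} (hx : HasGram x D) {n : ℤ}
    (hn : HasDefiniteValue (numberOn H₁) D n) (t : Tuple H₁) (ht : (t.1 : ℤ) ≠ n) (η : Fock H₁ᗮ)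
    (k : κ) : ⟪wedgeProd H₁ H₁ᗮ (wedge t) η, x k⟫_ℂ = 0 := by
  have hH : H₁ ⟂ H₁ᗮ := Submodule.isOrtho_orthogonal_right H₁
  have hs : ∀ u v, ⟪D u, v⟫_ℂ = ⟪u, D v⟫_ℂ := fun u v => hx.isPositive.isSymmetric u v
  set χ := wedgeProd H₁ H₁ᗮ (wedge t) η with hχ
  have h1 : HasSum (fun j => creator (stdBasis H₁ j : H) (annihilator (stdBasis H₁ j : H) χ))
      ((t.1 : ℂ) • χ) := by
    have h2 := (hasSum_creator_annihilator_wedge (stdBasis H₁) t).mapL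
      ((wedgeProd H₁ H₁ᗮ).flip η)
    rw [map_smul] at h2
    refine h2.congr_fun fun j => ?_
    exact wedgeProd_creator_annihilator hH hm _ _ _ _
  refine hx.inner_eq_zero ?_ k
  refine ext_inner_right ℂ fun ψ => ?_
  rw [hs, inner_zero_left]
  obtain ⟨hd, he⟩ := hn.1 ψ
  have h3 : HasSum (fun j => creator (stdBasis H₁ j : H) (annihilator (stdBasis H₁ j : H) (D ψ)))
      ((n : ℂ) • D ψ) := by
    rw [← he]
    exact Summable.hasSum hd
  have h4 := h3.mapL (innerSL ℂ χ)
  have h5 := ((h1.mapL (innerSL ℂ (D ψ))).mapL (Complex.conjCLE : ℂ →L[ℝ] ℂ))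
  simp only [innerSL_apply_apply, ContinuousLinearEquiv.coe_coe, Complex.conjCLE_apply,
    inner_conj_symm] at h4 h5
  -- Evaluating `⟪χ, N₁ D ψ⟫` with `N₁` on the right gives the factor `n`, and moving it termwise to
  -- the left gives the particle number of `t`.
  have h6 := h4.unique (h5.congr_fun fun j => by
    rw [← annihilator_inner, inner_annihilator])
  rw [inner_smul_left, inner_smul_right] at h6
  have h7 : ((n : ℂ) - t.1) * ⟪χ, D ψ⟫_ℂ = 0 := by
    rw [sub_mul, h6]; simp
  rcases mul_eq_zero.1 h7 with h8 | h8
  · refine absurd ?_ ht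
    have : (n : ℂ) = t.1 := sub_eq_zero.1 h8
    exact_mod_cast this.symm
  · exact h8

/-- In a product basis of Slater determinants, the coefficient of `a_g (x k)` at `s` can be nonzero
only if `s` has `n - 1` particles in `H₁`, and that of `a_h (x k)` only if it has `n`. No `s`
satisfies both. -/
theorem inner_annihilator_eq_zero (hm : IsTensor (wedgeProd H₁ H₁ᗮ))
    {κ : Type*} {x : κ → Fock H} {D : Fock H →L[ℂ] Fock H} (hx : HasGram x D) {n : ℤ}
    (hn : HasDefiniteValue (numberOn H₁) D n) {g h : H} (hg : g ∈ H₁) (hh : h ∈ H₁ᗮ) (k : κ) :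
    ⟪annihilator g (x k), annihilator h (x k)⟫_ℂ = 0 := by
  have hH : H₁ ⟂ H₁ᗮ := Submodule.isOrtho_orthogonal_right H₁
  obtain ⟨w₁, f₁, -⟩ := exists_hilbertBasis ℂ H₁
  obtain ⟨w₂, f₂, -⟩ := exists_hilbertBasis ℂ H₁ᗮ
  let _ : LinearOrder w₁ := IsWellOrder.linearOrder WellOrderingRel
  let _ : LinearOrder w₂ := IsWellOrder.linearOrder WellOrderingRel
  refine ((hm.basis (slaterBasis f₁) (slaterBasis f₂)).hasSum_inner_mul_inner _ _).unique ?_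
  refine hasSum_zero.congr_fun fun s => ?_
  rw [IsTensor.basis_apply, slaterBasis_apply, annihilator_inner, inner_annihilator]
  simp only [slater]
  set t : Tuple H₁ := ⟨s.1.card, fun i => f₁ (s.1.orderEmbOfFin rfl i)⟩
  by_cases ht : (t.1 : ℤ) = n
  · rw [← inner_conj_symm, wedgeProd_creator hH ⟨g, hg⟩, creator_wedge,
      inner_eq_zero_of_hasDefiniteValue hm hx hn _ _ _ k, map_zero, zero_mul]
    simp only [Tuple.cons]
    omega
  · rw [wedgeProd_wedge_creator hH t ⟨h, hh⟩, inner_smul_left,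
      inner_eq_zero_of_hasDefiniteValue hm hx hn _ ht _ k, mul_zero, mul_zero]

end DefiniteNumber

/-! ### One-particle operators and free states of the restrictions. -/

section Factor

variable {H : Type*} [NormedAddCommGroup H] [InnerProductSpace ℂ H] [CompleteSpace H]

/-- A restriction of a state of finite mean particle number is a density operator, whose
`1`-particle operator is a compression, and whose free state has an eigenbasis of Slater
determinants. -/
theorem IsPartialTrace.exists_slaterBasis {K : Submodule ℂ H} [CompleteSpace K] {E : Type*}
    [NormedAddCommGroup E] [InnerProductSpace ℂ E] [CompleteSpace E]
    {m : Fock K →L[ℂ] E →L[ℂ] Fock H} (hm : IsTensor m)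
    (hc : ∀ (g h : K) (ξ : Fock K) (η : E), (creator (g : H) ∘L annihilator (h : H)) (m ξ η) =
      m ((creator g ∘L annihilator h) ξ) η)
    {κ κ' : Type*} {x : κ → Fock H} {D : Fock H →L[ℂ] Fock H} (hx : HasGram x D)
    (h1 : ∑' k, ‖x k‖ ^ 2 = 1) {y : κ' → H} {γ : H →L[ℂ] H} (hy : HasGram y γ)
    (hγ : IsOneParticleOp D γ) {D₁ : Fock K →L[ℂ] Fock K} (hD₁ : IsPartialTrace m D D₁) :
    IsDensity D₁ ∧ ∃ (w : Set K) (_ : LinearOrder w) (f : HilbertBasis w ℂ K) (p : w → ℝ),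
      IsEigenbasis (compression K γ) f p ∧ (∀ i, p i ∈ Set.Icc (0 : ℝ) 1) ∧
      IsEigenbasis (freeDensity (oneParticleOp D₁)) (slaterBasis f) (freeWeight p) := by
  obtain ⟨D₁', w, x', hD₁', hx', h2⟩ := hm.exists_isPartialTrace hx
  rw [hD₁'.unique hD₁] at hx'
  rw [h1] at h2
  -- By `hc` the operators `a†_g a_h` with `g`, `h` in `K` act on the first factor, so their
  -- expectations in `D` and `D₁` are the same.
  have h3 : IsOneParticleOp D₁ (compression K γ) := by
    intro g h
    rw [inner_compression]
    exact hD₁.hasTrace_comp hm hx' (hc g h) (hγ g h)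
  refine ⟨hx'.isDensity h2, ?_⟩
  obtain ⟨w, o, f, p, hf, hs⟩ := isFreeDensity_freeDensity hx' h2 hy.compression h3
  rw [oneParticleOp_eq h3]
  exact ⟨w, o, f, p, hf, h3.eigenvalue_mem_Icc hx' h2 hf, isEigenbasis_slaterBasis hs⟩

end Factor

/-! ### Factorization of the free density operator. -/

section Product

/-- Every coordinate of `G (m ξ η)` contains the factor `g₁ s.1 * ⟪ψ₁ s.1, ξ⟫`, a coordinate of `G₁
ξ`. This carries the kernel condition over from the product to its factors. -/
theorem IsTensor.apply_eq_zero {E₁ E₂ E : Type*} [NormedAddCommGroup E₁] [InnerProductSpace ℂ E₁]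
    [CompleteSpace E₁] [NormedAddCommGroup E₂] [InnerProductSpace ℂ E₂] [CompleteSpace E₂]
    [NormedAddCommGroup E] [InnerProductSpace ℂ E] [CompleteSpace E] {m : E₁ →L[ℂ] E₂ →L[ℂ] E}
    (hm : IsTensor m) {ι₁ ι₂ : Type*} {ψ₁ : HilbertBasis ι₁ ℂ E₁} {ψ₂ : HilbertBasis ι₂ ℂ E₂}
    {g₁ : ι₁ → ℝ} {g₂ : ι₂ → ℝ} {G : E →L[ℂ] E} {G₁ : E₁ →L[ℂ] E₁}
    (hG : IsEigenbasis G (hm.basis ψ₁ ψ₂) fun s => g₁ s.1 * g₂ s.2) (hG₁ : IsEigenbasis G₁ ψ₁ g₁)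
    {ξ : E₁} (hξ : G₁ ξ = 0) (η : E₂) : G (m ξ η) = 0 := by
  refine HilbertBasis.ext_inner (hm.basis ψ₁ ψ₂) fun s => ?_
  have h := inner_apply_of_isEigenbasis hG₁ s.1 ξ
  rw [hξ, inner_zero_right] at h
  rw [inner_apply_of_isEigenbasis hG, IsTensor.basis_apply, hm.inner_map, inner_zero_right,
    Complex.ofReal_mul]
  linear_combination -((g₂ s.2 : ℂ) * ⟪ψ₂ s.2, η⟫_ℂ) * h

variable {H : Type*} [NormedAddCommGroup H] [InnerProductSpace ℂ H] [CompleteSpace H]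
  {H₁ : Submodule ℂ H} [CompleteSpace H₁]

/-- The free density operator of a block diagonal `γ` is a product. -/
theorem IsFreeDensity.isEigenbasis_prod (hm : IsTensor (wedgeProd H₁ H₁ᗮ)) {γ : H →L[ℂ] H}
    {G : Fock H →L[ℂ] Fock H} (hG : IsFreeDensity γ G) {κ : Type*} {y : κ → H} (hy : HasGram y γ)
    {w₁ w₂ : Type*} [LinearOrder w₁] [LinearOrder w₂] {f₁ : HilbertBasis w₁ ℂ H₁}
    {f₂ : HilbertBasis w₂ ℂ H₁ᗮ} {p₁ : w₁ → ℝ} {p₂ : w₂ → ℝ}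
    (hf : IsEigenbasis γ (sumBasis H₁ f₁ f₂) (Sum.elim p₁ p₂))
    (hp₁ : ∀ i, p₁ i ∈ Set.Icc (0 : ℝ) 1) (hp₂ : ∀ i, p₂ i ∈ Set.Icc (0 : ℝ) 1) :
    IsEigenbasis G (hm.basis (slaterBasis f₁) (slaterBasis f₂))
      fun s => freeWeight p₁ s.1 * freeWeight p₂ s.2 := by
  rintro ⟨s₁, s₂⟩
  -- Lists the indices of `s₁` in increasing order, followed by those of `s₂`, as the concatenation
  -- in `wedgeProd` does.
  let t : Fin (s₁.card + s₂.card) ↪ w₁ ⊕ w₂ := finSumFinEquiv.symm.toEmbedding.trans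
    ((s₁.orderEmbOfFin rfl).toEmbedding.sumMap (s₂.orderEmbOfFin rfl).toEmbedding)
  have ht : Finset.univ.map t = s₁.disjSum s₂ := by
    rw [← Finset.map_map, Finset.map_univ_equiv]
    ext (i | i)
    · rw [Finset.inl_mem_disjSum]
      simp
      exact Set.ext_iff.1 (Finset.range_orderEmbOfFin s₁ rfl) i
    · rw [Finset.inr_mem_disjSum]
      simp
      exact Set.ext_iff.1 (Finset.range_orderEmbOfFin s₂ rfl) i
  have hw : hm.basis (slaterBasis f₁) (slaterBasis f₂) (s₁, s₂) =
      wedge ⟨s₁.card + s₂.card, sumBasis H₁ f₁ f₂ ∘ t⟩ := by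
    rw [IsTensor.basis_apply, slaterBasis_apply, slaterBasis_apply, slater, slater,
      wedgeProd_wedge (Submodule.isOrtho_orthogonal_right H₁), Tuple.append]
    congr 2
    ext i
    refine Fin.addCases (fun i => ?_) (fun i => ?_) i <;> simp [t, coe_sumBasis]
  rw [hw, hG.apply_wedge hy hf t, ht, freeWeight_disjSum hp₁ hp₂]

end Product

/-! ### Assembly of the inequality for the nonfreeness. -/

section Nonfreeness

/-- Superadditivity of the nonfreeness for states of definite particle number in `H₁`. -/
theorem nonfreeness_add_le {H : Type*} [NormedAddCommGroup H] [InnerProductSpace ℂ H] [CompleteSpace H]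
    (H₁ : Submodule ℂ H) [CompleteSpace H₁] (Δ : Fock H →L[ℂ] Fock H)
    (hΔ : IsFiniteState Δ) (n : ℤ)
    (hn : HasDefiniteValue (numberOn H₁) Δ n) :
    nonfreeness (restrictFst H₁ Δ) +
      nonfreeness (restrictSnd H₁ Δ) ≤ nonfreeness Δ := by
  have hH : H₁ ⟂ H₁ᗮ := Submodule.isOrtho_orthogonal_right H₁
  have hm : IsTensor (wedgeProd H₁ H₁ᗮ) := isTensor_wedgeProd hH (by
    rw [Submodule.sup_orthogonal_of_hasOrthogonalProjection]
    exact dense_univ)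
  obtain ⟨w, x, hx, hx1⟩ := hΔ.1.exists_hasGram
  obtain ⟨y, γ, hy, hγ⟩ := exists_isOneParticleOp hx hΔ.2.2
  -- The restrictions are defined by choice, so the existence of partial traces for the trace class
  -- operator `Δ` must be supplied before anything is known about them.
  have r₁ : IsPartialTrace (wedgeProd H₁ H₁ᗮ) Δ (restrictFst H₁ Δ) := by
    obtain ⟨D₁, _, _, h, -, -⟩ := hm.exists_isPartialTrace hx
    exact Classical.epsilon_spec (p := IsPartialTrace (wedgeProd H₁ H₁ᗮ) Δ) ⟨D₁, h⟩
  have r₂ : IsPartialTrace (wedgeProd H₁ H₁ᗮ).flip Δ (restrictSnd H₁ Δ) := by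
    obtain ⟨D₂, _, _, h, -, -⟩ := hm.flip.exists_isPartialTrace hx
    exact Classical.epsilon_spec (p := IsPartialTrace (wedgeProd H₁ H₁ᗮ).flip Δ) ⟨D₂, h⟩
  obtain ⟨hD₁, w₁, _, f₁, p₁, hf₁, hp₁, hG₁⟩ := r₁.exists_slaterBasis hm
    (wedgeProd_creator_annihilator hH hm) hx hx1 hy hγ
  obtain ⟨hD₂, w₂, _, f₂, p₂, hf₂, hp₂, hG₂⟩ := r₂.exists_slaterBasis hm.flip
    (fun g h η ξ => wedgeProd_creator_annihilator' hH hm g h ξ η) hx hx1 hy hγ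
  have o₁ : ∀ v ∈ H₁, ∀ u ∈ H₁ᗮ, ⟪u, γ v⟫_ℂ = 0 := fun v hv u hu => by
    rw [hγ.inner_eq hx]
    simp [inner_annihilator_eq_zero hm hx hn hv hu]
  have o₂ : ∀ v ∈ H₁ᗮ, ∀ u ∈ H₁ᗮᗮ, ⟪u, γ v⟫_ℂ = 0 := fun v hv u hu => by
    rw [Submodule.orthogonal_orthogonal] at hu
    exact (hy.isPositive.isSymmetric u v).symm.trans (inner_eq_zero_symm.1 (o₁ u hu v hv))
  have hf : IsEigenbasis γ (sumBasis H₁ f₁ f₂) (Sum.elim p₁ p₂) := by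
    rintro (i | i)
    · rw [coe_sumBasis, Sum.elim_inl, Sum.elim_inl, ← coe_compression o₁, hf₁ i]
      rfl
    · rw [coe_sumBasis, Sum.elim_inr, Sum.elim_inr, ← coe_compression o₂, hf₂ i]
      rfl
  have hG : IsEigenbasis (freeDensity (oneParticleOp Δ))
      (hm.basis (slaterBasis f₁) (slaterBasis f₂))
      fun s => freeWeight p₁ s.1 * freeWeight p₂ s.2 := by
    rw [oneParticleOp_eq hγ]
    exact (isFreeDensity_freeDensity hx hx1 hy hγ).isEigenbasis_prod hm hy hf hp₁ hp₂
  -- If the kernel condition for `Δ` fails, the right side is `∞`. Otherwise the condition passes to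
  -- both restrictions, and all three relative entropies are given by sums over eigenbases.
  refine le_relEntropy hG fun hk w φ d hφ => ?_
  have k₁ : LinearMap.ker (freeDensity (oneParticleOp (restrictFst H₁ Δ)) : Fock H₁ →ₗ[ℂ] Fock H₁) ≤
      LinearMap.ker (restrictFst H₁ Δ : Fock H₁ →ₗ[ℂ] Fock H₁) := fun ξ hξ =>
    r₁.apply_eq_zero fun η => hk (hm.apply_eq_zero hG hG₁ hξ η)
  -- The same product eigenbasis with the two factors exchanged, as needed for the partial trace
  -- over the first factor.
  have hG' : IsEigenbasis (freeDensity (oneParticleOp Δ))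
      (hm.flip.basis (slaterBasis f₂) (slaterBasis f₁))
      fun s => freeWeight p₂ s.1 * freeWeight p₁ s.2 := fun s => by
    have := hG s.swap
    rw [IsTensor.basis_apply] at this ⊢
    simpa [mul_comm] using this
  have k₂ : LinearMap.ker (freeDensity (oneParticleOp (restrictSnd H₁ Δ)) :
      Fock H₁ᗮ →ₗ[ℂ] Fock H₁ᗮ) ≤ LinearMap.ker (restrictSnd H₁ Δ : Fock H₁ᗮ →ₗ[ℂ] Fock H₁ᗮ) :=
    fun η hη => r₂.apply_eq_zero fun ξ => hk (hm.flip.apply_eq_zero hG' hG₂ hη ξ)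
  obtain ⟨_, x₁, hx₁, -⟩ := hD₁.exists_hasGram
  obtain ⟨_, x₂, hx₂, -⟩ := hD₂.exists_hasGram
  obtain ⟨_, φ₁, d₁, hφ₁⟩ := exists_isEigenbasis hx₁.isCompactOperator hx₁.isPositive
  obtain ⟨_, φ₂, d₂, hφ₂⟩ := exists_isEigenbasis hx₂.isCompactOperator hx₂.isPositive
  rw [nonfreeness, nonfreeness, relEntropy_eq k₁ hφ₁ hG₁, relEntropy_eq k₂ hφ₂ hG₂]
  refine hm.entropySum_add_le hΔ.1 hD₁ hD₂ r₁ r₂ hφ hφ₁ hφ₂ _ _ (freeWeight_nonneg hp₁)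
    (freeWeight_nonneg hp₂) (summable_freeWeight hp₁).hasSum (summable_freeWeight hp₂).hasSum
    (tsum_freeWeight_le_one hp₁) (tsum_freeWeight_le_one hp₂) (fun s hs => k₁ ?_) fun s hs => k₂ ?_
  · rw [LinearMap.mem_ker]
    exact (hG₁ s).trans (by simp [hs])
  · rw [LinearMap.mem_ker]
    exact (hG₂ s).trans (by simp [hs])

end Nonfreeness

end Fermion

theorem corollary3 {H : Type*} [NormedAddCommGroup H] [InnerProductSpace ℂ H] [CompleteSpace H]
    (H₁ : Submodule ℂ H) [CompleteSpace H₁] (Δ : Fermion.Fock H →L[ℂ] Fermion.Fock H)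
    (hΔ : Fermion.IsFiniteState Δ) (n : ℤ)
    (hn : Fermion.HasDefiniteValue (Fermion.numberOn H₁) Δ n) :
    Fermion.nonfreeness (Fermion.restrictFst H₁ Δ) +
      Fermion.nonfreeness (Fermion.restrictSnd H₁ Δ) ≤ Fermion.nonfreeness Δ :=
  Fermion.nonfreeness_add_le H₁ Δ hΔ n hn
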